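/- \textbf{Setting.} Let $\mathcal G\rightrightarrows M$ be a Lie groupoid with source $s$ and target $t$ ($M$ is a smooth finite-dimensional Hausdorff second countable manifold of constant dimension $n$; the finite-dimensional manifold of arrows, of constant dimension, need not be Hausdorff or second countable; $s$ is a submersion with Hausdorff fibres). Products $gh$ are defined when $s(g)=t(h)$. Let $A_x=\ker (ds)_{1_x}$ be the fibres of its Lie algebroid $A$, of rank $k$. For a vector space $V$ with set of frames $\mathrm{Fr}(V)$ let $\Lambda^{\rm top}V^*=\{\xi:\mathrm{Fr}(V)\to\mathbb R \mid \xi(eC)=\det(C)\,\xi(e)\}$ and $\mathcal D_V=\{\xi:\mathrm{Fr}(V)\to\mathbb R\mid \xi(eC)=|\det C|\,\xi(e)\}$. The transverse volume and density bundles are the line bundles $$\mathcal V_A^{\rm tr}=\Lambda^{\rm top}A\otimes\Lambda^{\rm top}T^*M,\qquad \mathcal D_A^{\rm tr}=\mathcal D_{A^*}\otimes\mathcal D_{TM}.$$ They are representations of $\mathcal G$: for $g:x\to y$ the exact sequences $0\to A_y\to T_g\mathcal G\xrightarrow{ds}T_xM\to 0$ and $0\to A_x\to T_{g^{-1}}\mathcal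 G\xrightarrow{ds}T_yM\to 0$ (with first maps given by right translation) and the differential of the inversion $T_{g^{-1}}\mathcal G\cong T_g\mathcal G$ induce $\mathcal D_{A_y}\otimes\mathcal D_{T_xM}\cong\mathcal D_{A_x}\otimes\mathcal D_{T_yM}$, hence an isomorphism $g\cdot:\mathcal D_{A_x^*}\otimes\mathcal D_{T_xM}\to\mathcal D_{A_y^*}\otimes\mathcal D_{T_yM}$; the action on $\mathcal V_A^{\rm tr}$ is obtained in the same way from top exterior powers, with the Koszul sign $(-1)^k$ for the interchange of the two lines of degree $k$ coming from $A_x$ and $A_y$ (so that units act trivially). Let $H^1_{\rm diff}(\mathcal G)$ be the space of smooth $c:\mathcal G\to\mathbb R$ with $c(gh)=c(g)+c(h)$ for composable $g,h$, modulo the functions $f\circ s-f\circ t$, $f\in C^\infty(M)$. The modular class $\mathrm{mod}(\mathcal G)\in H^1_{\rm diff}(\mathcal G)$ is the class of $$c_\sigma(g)=\ln\frac{\sigma(y)}{g\cdot\sigma(x)}\qquad(g:x\to y)$$ for any strictly positive smooth section $\sigma$ of $\mathcal D_A^{\rm tr}$. For a $1$-dimensional representation $L$ of $\mathcal G$ that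 is trivializable as a vector bundle, $\theta_{\mathcal G}(L)\in H^1_{\rm diff}(\mathcal G)$ is the class of $\ln|\tilde c_\sigma|$, where $\sigma(y)=\tilde c_\sigma(g)\,(g\cdot\sigma(x))$, for any nowhere vanishing smooth section $\sigma$ of $L$; for arbitrary $L$, $\theta_{\mathcal G}(L):=\tfrac12\theta_{\mathcal G}(L\otimes L)$. A transverse volume form is a nowhere vanishing $\mathcal G$-invariant smooth section of $\mathcal V_A^{\rm tr}$. \textbf{Proposition.} (1) For every Lie groupoid $\mathcal G$, $\mathcal V_A^{\rm tr}$ and $\mathcal D_A^{\rm tr}$ are representations of $\mathcal G$, the classes $\mathrm{mod}(\mathcal G)$ and $\theta_{\mathcal G}(\mathcal V_A^{\rm tr})$ are well defined, and $$\mathrm{mod}(\mathcal G)=\theta_{\mathcal G}(\mathcal V_A^{\rm tr}).$$ (2) However, it is not true that $\mathrm{mod}(\mathcal G)=0$ if and only if $\mathcal G$ admits a transverse volume form: for every non-orientable manifold $M$, viewed as a groupoid with unit arrows only, the modular class is zero but there is no transverse volume form; and non-orientable manifolds exist. -/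

import Mathlib

open scoped Manifold ContDiff TensorProduct
open Module

universe u₁ u₂ u₃ u₄

noncomputable section

/-! ### One-dimensional vector spaces attached to characters of `GL_r` -/

section FrameLines

variable (δ : ℝ →*₀ ℝ) (r : ℕ) (V : Type*) [AddCommGroup V] [Module ℝ V]

/-- For an `r`-dimensional real vector space `V` and the character `δ ∘ det` of `GL_r`, the line
`{ξ : Fr(V) → ℝ | ξ(e · A) = δ(det A) ξ(e)}`, where `Fr(V)` is the set of frames (ordered bases)
of `V`. Here `e' = e · A` with `A` the matrix of `e'` with respect to `e`, so that
`det A = e.det e'`. For `δ = id` this is `Λ^top V*`, for `δ = |·|` it is the line of densities. -/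
def FrameLine : Submodule ℝ (Basis (Fin r) ℝ V → ℝ) where
  carrier := {ξ | ∀ e e' : Basis (Fin r) ℝ V, ξ e' = δ (e.det e') * ξ e}
  add_mem' := by
    intro ξ η hξ hη e e'
    simp only [Pi.add_apply]
    rw [hξ e e', hη e e', mul_add]
  zero_mem' := by
    intro e e'
    simp
  smul_mem' := by
    intro c ξ hξ e e'
    simp only [Pi.smul_apply, smul_eq_mul]
    rw [hξ e e']
    ring

variable {r V}

/-- The element of `FrameLine δ r V` that takes the value `1` at the frame `e`. -/
def FrameLine.gen (e : Basis (Fin r) ℝ V) : FrameLine δ r V :=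
  ⟨fun e' => δ (e.det e'), by
    intro e' e''
    rw [← map_mul, mul_comm, Basis.det_mul_det]⟩

/-- Evaluation of the elements of `FrameLine δ r V` at the frame `e`. -/
def FrameLine.eval (e : Basis (Fin r) ℝ V) : FrameLine δ r V →ₗ[ℝ] ℝ :=
  (LinearMap.proj e).comp (FrameLine δ r V).subtype

end FrameLines

/-- In a one-dimensional space, the quotient `u / v` of a vector `u` by a vector `v ≠ 0`: the
number `c` with `u = c • v`. -/
def lineRatio {L : Type*} [AddCommGroup L] [Module ℝ L] (u v : L) : ℝ :=
  Classical.epsilon fun c : ℝ => u = c • v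

/-! ### Lie groupoids -/

/-- A Lie groupoid with manifold of objects `M` (modelled on `E`) and manifold of arrows `G`
(modelled on `F`). An arrow `g` goes from `src g` to `tgt g`, and the product `mul g h = gh` is
the composition, meaningful when `src g = tgt h`; the values of `mul` on other pairs are
irrelevant: no axiom mentions them. The manifold of objects will always be Hausdorff and second
countable, the manifold of arrows need not be, but the fibres of the source map are Hausdorff.
Smoothness of the product on the fibred product `{(g, h) | src g = tgt h}`, an embedded
submanifold of `G × G`, is expressed as smoothness on this subset of `G × G`. -/
structure LieGroupoid (E F M G : Type*)
    [NormedAddCommGroup E] [NormedSpace ℝ E] [NormedAddCommGroup F] [NormedSpace ℝ F]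
    [TopologicalSpace M] [ChartedSpace E M] [TopologicalSpace G] [ChartedSpace F G] where
  src : G → M
  tgt : G → M
  one : M → G
  inv : G → G
  mul : G → G → G
  src_one : ∀ x, src (one x) = x
  tgt_one : ∀ x, tgt (one x) = x
  src_mul : ∀ g h, src g = tgt h → src (mul g h) = src h
  tgt_mul : ∀ g h, src g = tgt h → tgt (mul g h) = tgt g
  mul_assoc : ∀ g h k, src g = tgt h → src h = tgt k → mul (mul g h) k = mul g (mul h k)
  one_mul : ∀ g, mul (one (tgt g)) g = g
  mul_one : ∀ g, mul g (one (src g)) = g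
  src_inv : ∀ g, src (inv g) = tgt g
  tgt_inv : ∀ g, tgt (inv g) = src g
  inv_mul : ∀ g, mul (inv g) g = one (src g)
  mul_inv : ∀ g, mul g (inv g) = one (tgt g)
  isSubmersion_src : Manifold.IsSubmersion 𝓘(ℝ, F) 𝓘(ℝ, E) ∞ src
  contMDiff_tgt : ContMDiff 𝓘(ℝ, F) 𝓘(ℝ, E) ∞ tgt
  contMDiff_one : ContMDiff 𝓘(ℝ, E) 𝓘(ℝ, F) ∞ one
  contMDiff_inv : ContMDiff 𝓘(ℝ, F) 𝓘(ℝ, F) ∞ inv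
  contMDiffOn_mul : ContMDiffOn (𝓘(ℝ, F).prod 𝓘(ℝ, F)) 𝓘(ℝ, F) ∞
    (fun p : G × G => mul p.1 p.2) {p | src p.1 = tgt p.2}
  t2_src_fiber : ∀ x, T2Space (src ⁻¹' {x})

/-- A manifold viewed as a Lie groupoid with unit arrows only. -/
def unitGroupoid (E M : Type*) [NormedAddCommGroup E] [NormedSpace ℝ E]
    [TopologicalSpace M] [ChartedSpace E M] [IsManifold 𝓘(ℝ, E) ∞ M] [T2Space M] :
    LieGroupoid E E M M where
  src := id
  tgt := id
  one := id
  inv := id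
  mul g _ := g
  src_one _ := rfl
  tgt_one _ := rfl
  src_mul _ _ h := h
  tgt_mul _ _ _ := rfl
  mul_assoc _ _ _ _ _ := rfl
  one_mul _ := rfl
  mul_one _ := rfl
  src_inv _ := rfl
  tgt_inv _ := rfl
  inv_mul _ := rfl
  mul_inv _ := rfl
  isSubmersion_src :=
    (Manifold.IsSubmersionOfComplement.id :
      Manifold.IsSubmersionOfComplement PUnit.{1} 𝓘(ℝ, E) 𝓘(ℝ, E) ∞ (id : M → M)).isSubmersion
  contMDiff_tgt := contMDiff_id
  contMDiff_one := contMDiff_id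
  contMDiff_inv := contMDiff_id
  contMDiffOn_mul := contMDiff_fst.contMDiffOn
  t2_src_fiber _ := inferInstance

/-- A manifold is orientable if it is covered by charts of its smooth structure whose transition
maps have positive Jacobian determinant. -/
def IsOrientableManifold (E M : Type*) [NormedAddCommGroup E] [NormedSpace ℝ E]
    [TopologicalSpace M] [ChartedSpace E M] : Prop :=
  ∃ 𝒜 ⊆ IsManifold.maximalAtlas 𝓘(ℝ, E) ∞ M,
    (∀ x : M, ∃ φ ∈ 𝒜, x ∈ φ.source) ∧
    ∀ φ ∈ 𝒜, ∀ ψ ∈ 𝒜, ∀ u ∈ (φ.symm.trans ψ).source,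
      0 < (fderiv ℝ (φ.symm.trans ψ) u).det

namespace LieGroupoid

variable {E F M G : Type*}
  [NormedAddCommGroup E] [NormedSpace ℝ E] [NormedAddCommGroup F] [NormedSpace ℝ F]
  [TopologicalSpace M] [ChartedSpace E M] [TopologicalSpace G] [ChartedSpace F G]

/-! ### Differentiable cohomology in degree one -/

/-- The differentiable `1`-cocycles: smooth functions `c` on the arrows with
`c (gh) = c g + c h` for composable `g`, `h`. -/
def cocycles (𝒢 : LieGroupoid E F M G) : Submodule ℝ C^∞⟮𝓘(ℝ, F), G; 𝓘(ℝ, ℝ), ℝ⟯ where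
  carrier := {c | ∀ g h, 𝒢.src g = 𝒢.tgt h → c (𝒢.mul g h) = c g + c h}
  add_mem' := by
    intro a b ha hb g h hgh
    simp only [ContMDiffMap.coe_add, Pi.add_apply]
    rw [ha g h hgh, hb g h hgh]
    ring
  zero_mem' := by
    intro g h _
    simp
  smul_mem' := by
    intro r a ha g h hgh
    simp only [ContMDiffMap.coe_smul, Pi.smul_apply, smul_eq_mul]
    rw [ha g h hgh]
    ring

/-- The differentiable `1`-coboundaries `δ f : g ↦ f (src g) - f (tgt g)`, for `f` a smooth
function on the objects. -/
def coboundaries (𝒢 : LieGroupoid E F M G) : Submodule ℝ C^∞⟮𝓘(ℝ, F), G; 𝓘(ℝ, ℝ), ℝ⟯ where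
  carrier := {c | ∃ f : C^∞⟮𝓘(ℝ, E), M; 𝓘(ℝ, ℝ), ℝ⟯, ∀ g, c g = f (𝒢.src g) - f (𝒢.tgt g)}
  add_mem' := by
    rintro a b ⟨f, hf⟩ ⟨f', hf'⟩
    refine ⟨f + f', fun g => ?_⟩
    simp only [ContMDiffMap.coe_add, Pi.add_apply]
    rw [hf, hf']
    ring
  zero_mem' := ⟨0, fun g => by simp⟩
  smul_mem' := by
    rintro r a ⟨f, hf⟩
    refine ⟨r • f, fun g => ?_⟩
    simp only [ContMDiffMap.coe_smul, Pi.smul_apply, smul_eq_mul]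
    rw [hf]
    ring

/-- The first differentiable cohomology `H¹_diff(𝒢)`: cocycles modulo coboundaries. -/
abbrev H1 (𝒢 : LieGroupoid E F M G) : Type _ :=
  𝒢.cocycles ⧸ 𝒢.coboundaries.submoduleOf 𝒢.cocycles

/-- The cohomology class of a cocycle. -/
def cohomologyClass (𝒢 : LieGroupoid E F M G) (c : 𝒢.cocycles) : 𝒢.H1 :=
  Submodule.Quotient.mk c

/-! ### One-dimensional representations -/

/-- The data of a one-dimensional representation: a family of vector spaces over the objects, a
set of local frames (pairs of a set and of a section whose values on that set matter) and an
action of the arrows. The axioms are in `LineRepData.IsRepresentation`. -/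
structure LineRepData (𝒢 : LieGroupoid E F M G) where
  fiber : M → Type*
  [addCommGroup : ∀ x, AddCommGroup (fiber x)]
  [module : ∀ x, Module ℝ (fiber x)]
  frames : Set (Set M × (∀ x, fiber x))
  act : ∀ g : G, fiber (𝒢.src g) →ₗ[ℝ] fiber (𝒢.tgt g)

attribute [instance] LineRepData.addCommGroup LineRepData.module

namespace LineRepData

variable {𝒢 : LieGroupoid E F M G}

/-- The axioms of a one-dimensional representation of `𝒢`: the fibres are lines, the local frames
make them into a smooth line bundle over the objects, and the arrows act smoothly, with
`1_x · v = v` and `(gh) · v = g · (h · v)`. In the last two axioms the vectors are given as values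
of arbitrary (set-theoretic) sections. -/
structure IsRepresentation (L : LineRepData 𝒢) : Prop where
  finrank_fiber : ∀ x, finrank ℝ (L.fiber x) = 1
  isOpen_frame : ∀ e ∈ L.frames, IsOpen e.1
  frame_ne_zero : ∀ e ∈ L.frames, ∀ x ∈ e.1, e.2 x ≠ 0
  frames_cover : ∀ x, ∃ e ∈ L.frames, x ∈ e.1
  contMDiffOn_transition : ∀ e ∈ L.frames, ∀ e' ∈ L.frames, ∀ c : M → ℝ,
    (∀ x ∈ e.1 ∩ e'.1, e'.2 x = c x • e.2 x) →
      ContMDiffOn 𝓘(ℝ, E) 𝓘(ℝ, ℝ) ∞ c (e.1 ∩ e'.1)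
  contMDiffOn_act : ∀ e ∈ L.frames, ∀ e' ∈ L.frames, ∀ c : G → ℝ,
    (∀ g ∈ 𝒢.src ⁻¹' e.1 ∩ 𝒢.tgt ⁻¹' e'.1, L.act g (e.2 (𝒢.src g)) = c g • e'.2 (𝒢.tgt g)) →
      ContMDiffOn 𝓘(ℝ, F) 𝓘(ℝ, ℝ) ∞ c (𝒢.src ⁻¹' e.1 ∩ 𝒢.tgt ⁻¹' e'.1)
  act_one : ∀ (x : M) (σ : ∀ x, L.fiber x),
    L.act (𝒢.one x) (σ (𝒢.src (𝒢.one x))) = σ (𝒢.tgt (𝒢.one x))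
  act_mul : ∀ (g h : G), 𝒢.src g = 𝒢.tgt h → ∀ σ τ ρ : ∀ x, L.fiber x,
    L.act h (σ (𝒢.src h)) = τ (𝒢.tgt h) → L.act g (τ (𝒢.src g)) = ρ (𝒢.tgt g) →
      L.act (𝒢.mul g h) (σ (𝒢.src (𝒢.mul g h))) = ρ (𝒢.tgt (𝒢.mul g h))

/-- A section is smooth if its coefficients with respect to all local frames are smooth. -/
def IsSmoothSection (L : LineRepData 𝒢) (σ : ∀ x, L.fiber x) : Prop :=
  ∀ e ∈ L.frames, ∀ c : M → ℝ, (∀ x ∈ e.1, σ x = c x • e.2 x) →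
    ContMDiffOn 𝓘(ℝ, E) 𝓘(ℝ, ℝ) ∞ c e.1

/-- A section `σ` is invariant if `g · σ(x) = σ(y)` for every arrow `g : x → y`. -/
def IsInvariantSection (L : LineRepData 𝒢) (σ : ∀ x, L.fiber x) : Prop :=
  ∀ g, L.act g (σ (𝒢.src g)) = σ (𝒢.tgt g)

/-- The tensor square `L ⊗ L` with the diagonal action. -/
def tensorSquare (L : LineRepData 𝒢) : LineRepData 𝒢 where
  fiber x := L.fiber x ⊗[ℝ] L.fiber x
  frames := (fun e => (e.1, fun x => e.2 x ⊗ₜ[ℝ] e.2 x)) '' L.frames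
  act g := TensorProduct.map (L.act g) (L.act g)

/-- For `L` trivializable as a vector bundle, the class `θ(L)` is the cohomology class `κ` of the
cocycle `c_σ = ln |c̃_σ|` defined by `σ(y) = c̃_σ(g) (g · σ(x))` for `g : x → y`, for any nowhere
vanishing smooth section `σ` of `L`. -/
def IsTrivialCharClass (L : LineRepData 𝒢) (κ : 𝒢.H1) : Prop :=
  (∃ σ, L.IsSmoothSection σ ∧ ∀ x, σ x ≠ 0) ∧
  ∀ σ, L.IsSmoothSection σ → (∀ x, σ x ≠ 0) →
    ∃ c : 𝒢.cocycles,
      (∀ g, c.1 g = Real.log |lineRatio (σ (𝒢.tgt g)) (L.act g (σ (𝒢.src g)))|) ∧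
      𝒢.cohomologyClass c = κ

/-- `θ(L)` for `L` trivializable as a vector bundle. -/
def trivialCharClass (L : LineRepData 𝒢) : 𝒢.H1 :=
  Classical.epsilon L.IsTrivialCharClass

/-- The characteristic class `θ(L) = ½ θ(L ⊗ L)` of a one-dimensional representation. -/
def charClass (L : LineRepData 𝒢) : 𝒢.H1 :=
  (1 / 2 : ℝ) • L.tensorSquare.trivialCharClass

end LineRepData

/-! ### The Lie algebroid and the exact sequences -/

/-- The fibre `A_x = ker (d src)_{1_x}` of the Lie algebroid of `𝒢`. -/
def algebroidFiber (𝒢 : LieGroupoid E F M G) (x : M) :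
    Submodule ℝ (TangentSpace 𝓘(ℝ, F) (𝒢.one x)) :=
  (mfderiv 𝓘(ℝ, F) 𝓘(ℝ, E) 𝒢.src (𝒢.one x)).ker

/-- The rank of the Lie algebroid of `𝒢`. -/
def rank (_𝒢 : LieGroupoid E F M G) : ℕ := finrank ℝ F - finrank ℝ E

/-- The differential at `1_y` of the right translation `h ↦ hg`, for `g` an arrow with target `y`.
Right translation by `g` is defined on the fibre `src⁻¹(y)`, so that its differential is only
defined (and only used) on `A_y`, the tangent space of that fibre: `mfderivWithin` is some
extension of it to `T_{1_y} G`. The value lies in the tangent space at `1_y g = g`. -/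
def rightTranslation (𝒢 : LieGroupoid E F M G) (y : M) (g : G) :
    TangentSpace 𝓘(ℝ, F) (𝒢.one y) →L[ℝ] TangentSpace 𝓘(ℝ, F) g :=
  (mfderivWithin 𝓘(ℝ, F) 𝓘(ℝ, F) (fun h => 𝒢.mul h g) (𝒢.src ⁻¹' {y}) (𝒢.one y) :)

/-- Some vector in `T_g G` that is mapped to `w` by `d src`, for `w` in the tangent space at
`x = src g`. -/
def srcLift (𝒢 : LieGroupoid E F M G) (g : G) {x : M} (w : TangentSpace 𝓘(ℝ, E) x) :
    TangentSpace 𝓘(ℝ, F) g :=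
  Function.invFun (mfderiv 𝓘(ℝ, F) 𝓘(ℝ, E) 𝒢.src g) w

/-- For `g : x → y`, the frame of `T_g G` that a frame `b` of `A_y` and a frame `f` of `T_x M`
induce through the exact sequence `0 → A_y → T_g G → T_x M → 0`. -/
def adaptedFrame (𝒢 : LieGroupoid E F M G) (g : G) {x y : M} {k n : ℕ}
    (b : Fin k → 𝒢.algebroidFiber y) (f : Fin n → TangentSpace 𝓘(ℝ, E) x) :
    Fin k ⊕ Fin n → TangentSpace 𝓘(ℝ, F) g :=
  Sum.elim (fun i => 𝒢.rightTranslation y g (b i)) (fun j => 𝒢.srcLift g (f j))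

lemma surjective_mfderiv_src [IsManifold 𝓘(ℝ, E) ∞ M] [IsManifold 𝓘(ℝ, F) ∞ G]
    (𝒢 : LieGroupoid E F M G) (g : G) :
    Function.Surjective (mfderiv 𝓘(ℝ, F) 𝓘(ℝ, E) 𝒢.src g) := by
  have hs := 𝒢.isSubmersion_src.isSubmersionAt g
  have hφ := hs.domChart_mem_maximalAtlas
  have hψ := hs.codChart_mem_maximalAtlas
  have hg := hs.mem_domChart_source
  have hsg := hs.mem_codChart_source
  have hmaps := hs.source_subset_preimage_source
  have hwr := hs.writtenInCharts
  revert hφ hψ hg hsg hmaps hwr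
  generalize hs.domChart = φ
  generalize hs.codChart = ψ
  generalize hs.equiv = l
  intro hφ hψ hg hsg hmaps hwr
  set v := (l (φ g)).2 with hv
  let τ : M → F := fun m => l.symm (ψ m, v)
  have hτg : τ (𝒢.src g) = φ g := by
    have h1 := hwr (show φ g ∈ (φ.extend 𝓘(ℝ, F)).target by simpa using φ.map_source hg)
    simp only [Function.comp_apply, OpenPartialHomeomorph.extend, mfld_simps, φ.left_inv hg] at h1
    simp only [τ, h1, hv, Prod.mk.eta, ContinuousLinearEquiv.symm_apply_apply]
  have hτ : ContMDiffAt 𝓘(ℝ, E) 𝓘(ℝ, F) ∞ τ (𝒢.src g) := by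
    have h1 : ContMDiffAt 𝓘(ℝ, E) 𝓘(ℝ, E) ∞ ψ (𝒢.src g) :=
      contMDiffAt_of_mem_maximalAtlas hψ hsg
    have h2 : ContDiff ℝ ∞ (fun u : E => l.symm (u, v)) :=
      l.symm.contDiff.comp (contDiff_id.prodMk contDiff_const)
    exact h2.contMDiff.contMDiffAt.comp _ h1
  have hφs : ContMDiffAt 𝓘(ℝ, F) 𝓘(ℝ, F) ∞ φ.symm (τ (𝒢.src g)) := by
    rw [hτg]
    exact contMDiffAt_symm_of_mem_maximalAtlas hφ (φ.map_source hg)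
  have hpt : φ.symm (τ (𝒢.src g)) = g := by rw [hτg, φ.left_inv hg]
  have hcomp : MDifferentiableAt 𝓘(ℝ, E) 𝓘(ℝ, F) (φ.symm ∘ τ) (𝒢.src g) :=
    (hφs.comp _ hτ).mdifferentiableAt (by simp)
  have hsrc : MDifferentiableAt 𝓘(ℝ, F) 𝓘(ℝ, E) 𝒢.src ((φ.symm ∘ τ) (𝒢.src g)) :=
    (𝒢.isSubmersion_src.isSubmersionAt _).contMDiffAt.mdifferentiableAt (by simp)
  have hid : 𝒢.src ∘ (φ.symm ∘ τ) =ᶠ[nhds (𝒢.src g)] id := by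
    have h1 : ∀ᶠ m in nhds (𝒢.src g), τ m ∈ φ.target :=
      hτ.continuousAt.eventually
        (φ.open_target.mem_nhds (by rw [hτg]; exact φ.map_source hg))
    filter_upwards [h1, ψ.open_source.mem_nhds hsg] with m hm hm'
    have h2 := hwr (show τ m ∈ (φ.extend 𝓘(ℝ, F)).target by simpa using hm)
    have h3 : 𝒢.src (φ.symm (τ m)) ∈ ψ.source := hmaps (φ.map_target hm)
    simp only [Function.comp_apply, OpenPartialHomeomorph.extend, mfld_simps] at h2
    refine ψ.injOn h3 hm' (h2.trans ?_)
    simp [τ]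
  have hd := mfderiv_comp (𝒢.src g) hsrc hcomp
  rw [hid.mfderiv_eq, mfderiv_id] at hd
  intro w
  have hgen : ∀ p, p = g → ∀ u : F, (mfderiv 𝓘(ℝ, F) 𝓘(ℝ, E) 𝒢.src p : F → E) u = w →
      ∃ u : F, (mfderiv 𝓘(ℝ, F) 𝓘(ℝ, E) 𝒢.src g : F → E) u = w := by
    rintro p rfl u hu
    exact ⟨u, hu⟩
  exact hgen _ hpt _ (DFunLike.congr_fun hd w).symm

variable [FiniteDimensional ℝ E] [FiniteDimensional ℝ F]

lemma finrank_tangentSpace_arrow [IsManifold 𝓘(ℝ, E) ∞ M] [IsManifold 𝓘(ℝ, F) ∞ G]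
    (𝒢 : LieGroupoid E F M G) (g : G) :
    finrank ℝ (TangentSpace 𝓘(ℝ, F) g) = 𝒢.rank + finrank ℝ E := by
  have : FiniteDimensional ℝ (TangentSpace 𝓘(ℝ, F) g) :=
    inferInstanceAs (FiniteDimensional ℝ F)
  have : FiniteDimensional ℝ (TangentSpace 𝓘(ℝ, E) (𝒢.src g)) :=
    inferInstanceAs (FiniteDimensional ℝ E)
  have h : finrank ℝ E ≤ finrank ℝ F :=
    LinearMap.finrank_le_finrank_of_surjective
      (f := (mfderiv 𝓘(ℝ, F) 𝓘(ℝ, E) 𝒢.src g).toLinearMap)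
      (𝒢.surjective_mfderiv_src g)
  have h' : finrank ℝ (TangentSpace 𝓘(ℝ, F) g) = finrank ℝ F := rfl
  unfold rank
  omega

lemma finrank_algebroidFiber [IsManifold 𝓘(ℝ, E) ∞ M] [IsManifold 𝓘(ℝ, F) ∞ G]
    (𝒢 : LieGroupoid E F M G) (x : M) :
    finrank ℝ (𝒢.algebroidFiber x) = 𝒢.rank := by
  have : FiniteDimensional ℝ (TangentSpace 𝓘(ℝ, F) (𝒢.one x)) :=
    inferInstanceAs (FiniteDimensional ℝ F)
  have h1 := LinearMap.finrank_range_add_finrank_ker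
    (mfderiv 𝓘(ℝ, F) 𝓘(ℝ, E) 𝒢.src (𝒢.one x)).toLinearMap
  have h2 : (mfderiv 𝓘(ℝ, F) 𝓘(ℝ, E) 𝒢.src (𝒢.one x)).toLinearMap.range = ⊤ :=
    LinearMap.range_eq_top.mpr (𝒢.surjective_mfderiv_src (𝒢.one x))
  rw [h2, finrank_top] at h1
  have h3 : finrank ℝ (𝒢.algebroidFiber x) =
    finrank ℝ (mfderiv 𝓘(ℝ, F) 𝓘(ℝ, E) 𝒢.src (𝒢.one x)).toLinearMap.ker := rfl
  have h4 : finrank ℝ (TangentSpace 𝓘(ℝ, E) (𝒢.src (𝒢.one x))) = finrank ℝ E := rfl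
  have h5 : finrank ℝ (TangentSpace 𝓘(ℝ, F) (𝒢.one x)) = finrank ℝ F := rfl
  rw [h3]
  unfold rank
  omega

variable [IsManifold 𝓘(ℝ, E) ∞ M] [IsManifold 𝓘(ℝ, F) ∞ G]

/-- Some frame of the fibre `A_x` of the Lie algebroid. -/
def someAlgebroidFrame (𝒢 : LieGroupoid E F M G) (x : M) :
    Basis (Fin 𝒢.rank) ℝ (𝒢.algebroidFiber x) :=
  haveI : FiniteDimensional ℝ (TangentSpace 𝓘(ℝ, F) (𝒢.one x)) :=
    inferInstanceAs (FiniteDimensional ℝ F)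
  finBasisOfFinrankEq ℝ _ (𝒢.finrank_algebroidFiber x)

/-- Some frame of the tangent space `T_x M`. -/
def someObjectFrame (_𝒢 : LieGroupoid E F M G) (x : M) :
    Basis (Fin (finrank ℝ E)) ℝ (TangentSpace 𝓘(ℝ, E) x) :=
  haveI : FiniteDimensional ℝ (TangentSpace 𝓘(ℝ, E) x) := inferInstanceAs (FiniteDimensional ℝ E)
  finBasisOfFinrankEq ℝ _ rfl

/-- Some frame of the tangent space `T_g G`. -/
def someArrowFrame (𝒢 : LieGroupoid E F M G) (g : G) :
    Basis (Fin 𝒢.rank ⊕ Fin (finrank ℝ E)) ℝ (TangentSpace 𝓘(ℝ, F) g) :=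
  haveI : FiniteDimensional ℝ (TangentSpace 𝓘(ℝ, F) g) := inferInstanceAs (FiniteDimensional ℝ F)
  (finBasisOfFinrankEq ℝ _ (𝒢.finrank_tangentSpace_arrow g)).reindex finSumFinEquiv.symm

/-! ### The transverse volume and density bundles -/

/-- For `g : x → y`, frames `a`, `f` of `A_x`, `T_x M` and `b`, `h` of `A_y`, `T_y M`: the
determinant of the matrix `C` with `Ψ = Φ · C`, where `Φ` is the frame of `T_g G` induced by
`0 → A_y → T_g G → T_x M → 0` and `(b, f)`, and `Ψ` is the frame of `T_g G` obtained through the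
differential of the inversion from the frame of `T_{g⁻¹} G` induced by
`0 → A_x → T_{g⁻¹} G → T_y M → 0` and `(a, h)`. (It is computed through an auxiliary frame of
`T_g G`, on which it does not depend.) -/
def exchangeDet (𝒢 : LieGroupoid E F M G) (g : G)
    (a : Basis (Fin 𝒢.rank) ℝ (𝒢.algebroidFiber (𝒢.src g)))
    (f : Basis (Fin (finrank ℝ E)) ℝ (TangentSpace 𝓘(ℝ, E) (𝒢.src g)))
    (b : Basis (Fin 𝒢.rank) ℝ (𝒢.algebroidFiber (𝒢.tgt g)))
    (h : Basis (Fin (finrank ℝ E)) ℝ (TangentSpace 𝓘(ℝ, E) (𝒢.tgt g))) : ℝ :=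
  (𝒢.someArrowFrame g).det (fun i =>
      (mfderiv 𝓘(ℝ, F) 𝓘(ℝ, F) 𝒢.inv (𝒢.inv g) (𝒢.adaptedFrame (𝒢.inv g) a h i) : F)) /
    (𝒢.someArrowFrame g).det (𝒢.adaptedFrame g b f)

variable (δ : ℝ →*₀ ℝ)

/-- The fibre `F(A_x*) ⊗ F(T_x M)`, where `F = FrameLine δ`. -/
abbrev TransverseFiber (𝒢 : LieGroupoid E F M G) (x : M) : Type _ :=
  FrameLine δ 𝒢.rank (Dual ℝ (𝒢.algebroidFiber x)) ⊗[ℝ]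
    FrameLine δ (finrank ℝ E) (TangentSpace 𝓘(ℝ, E) x)

/-- The element of `F(A_x*) ⊗ F(T_x M)` determined by a frame of `A_x*` and one of `T_x M`. -/
def transverseGen (𝒢 : LieGroupoid E F M G) {x : M}
    (α : Basis (Fin 𝒢.rank) ℝ (Dual ℝ (𝒢.algebroidFiber x)))
    (f : Basis (Fin (finrank ℝ E)) ℝ (TangentSpace 𝓘(ℝ, E) x)) : 𝒢.TransverseFiber δ x :=
  FrameLine.gen δ α ⊗ₜ[ℝ] FrameLine.gen δ f

/-- Evaluation of the elements of `F(A_x*) ⊗ F(T_x M)` at a frame of `A_x*` and one of `T_x M`. -/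
def transverseEval (𝒢 : LieGroupoid E F M G) {x : M}
    (α : Basis (Fin 𝒢.rank) ℝ (Dual ℝ (𝒢.algebroidFiber x)))
    (f : Basis (Fin (finrank ℝ E)) ℝ (TangentSpace 𝓘(ℝ, E) x)) :
    𝒢.TransverseFiber δ x →ₗ[ℝ] ℝ :=
  LinearMap.mul' ℝ ℝ ∘ₗ TensorProduct.map (FrameLine.eval δ α) (FrameLine.eval δ f)

/-- The action of `g : x → y` on the transverse bundle of `F = FrameLine δ`. The isomorphisms
`F(A_y) ⊗ F(T_x M) ≅ F(T_g G) ≅ F(T_{g⁻¹} G) ≅ F(A_x) ⊗ F(T_y M)`, given by the two exact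
sequences and the differential of the inversion, map the generator of the frame `(b, f)` to
`δ(det C)` times that of `(a, h)`, with `det C` as in `exchangeDet`. Moving `F(A_y)` and `F(A_x)`
to the other sides, one gets `F(A_x*) ⊗ F(T_x M) → F(A_y*) ⊗ F(T_y M)`, which maps the generator
of `(a*, f)` to `δ((-1)^k det C)` times that of `(b*, h)`, where `k` is the rank of `A`. The Koszul
sign `(-1)^k`, from interchanging the lines of `A_x` and `A_y`, both of degree `k`, plays no role
for densities; it compensates the determinant of the differential of the inversion, which acts as
`-1` along the isotropy, and is what makes units act trivially also for volumes. The map does not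
depend on the frames `a, f, b, h`. -/
def transverseActOn (𝒢 : LieGroupoid E F M G) (g : G)
    (a : Basis (Fin 𝒢.rank) ℝ (𝒢.algebroidFiber (𝒢.src g)))
    (f : Basis (Fin (finrank ℝ E)) ℝ (TangentSpace 𝓘(ℝ, E) (𝒢.src g)))
    (b : Basis (Fin 𝒢.rank) ℝ (𝒢.algebroidFiber (𝒢.tgt g)))
    (h : Basis (Fin (finrank ℝ E)) ℝ (TangentSpace 𝓘(ℝ, E) (𝒢.tgt g))) :
    𝒢.TransverseFiber δ (𝒢.src g) →ₗ[ℝ] 𝒢.TransverseFiber δ (𝒢.tgt g) :=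
  (𝒢.transverseEval δ a.dualBasis f).smulRight
    (δ ((-1) ^ 𝒢.rank * 𝒢.exchangeDet g a f b h) • 𝒢.transverseGen δ b.dualBasis h)

/-- The transverse bundle `F(A*) ⊗ F(TM)`, `F = FrameLine δ`. Its local frames are induced by the
local smooth frames of `A` (as a subbundle of the restriction of `TG` to the units) and of `TM`. -/
def transverseBundle (𝒢 : LieGroupoid E F M G) : LineRepData 𝒢 where
  fiber x := 𝒢.TransverseFiber δ x
  frames := {e | IsOpen e.1 ∧
    ∃ (a : ∀ x, Basis (Fin 𝒢.rank) ℝ (𝒢.algebroidFiber x))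
      (f : ∀ x, Basis (Fin (finrank ℝ E)) ℝ (TangentSpace 𝓘(ℝ, E) x)),
      (∀ i, ContMDiffOn 𝓘(ℝ, E) 𝓘(ℝ, F).tangent ∞
        (fun x => (⟨𝒢.one x, a x i⟩ : TangentBundle 𝓘(ℝ, F) G)) e.1) ∧
      (∀ j, ContMDiffOn 𝓘(ℝ, E) 𝓘(ℝ, E).tangent ∞
        (fun x => (⟨x, f x j⟩ : TangentBundle 𝓘(ℝ, E) M)) e.1) ∧
      ∀ x ∈ e.1, e.2 x = 𝒢.transverseGen δ (a x).dualBasis (f x)}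
  act g := 𝒢.transverseActOn δ g (𝒢.someAlgebroidFrame _) (𝒢.someObjectFrame _)
    (𝒢.someAlgebroidFrame _) (𝒢.someObjectFrame _)

/-- The transverse volume bundle `V_A^tr = Λ^top A ⊗ Λ^top T*M`. -/
def transverseVolume (𝒢 : LieGroupoid E F M G) : LineRepData 𝒢 :=
  𝒢.transverseBundle (MonoidWithZeroHom.id ℝ)

/-- The transverse density bundle `D_A^tr = D_{A*} ⊗ D_{TM}`. -/
def transverseDensity (𝒢 : LieGroupoid E F M G) : LineRepData 𝒢 :=
  𝒢.transverseBundle absHom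

/-- A transverse volume form: a nowhere vanishing invariant smooth section of `V_A^tr`. -/
def IsTransverseVolumeForm (𝒢 : LieGroupoid E F M G) (σ : ∀ x, 𝒢.transverseVolume.fiber x) :
    Prop :=
  𝒢.transverseVolume.IsSmoothSection σ ∧ (∀ x, σ x ≠ 0) ∧
    𝒢.transverseVolume.IsInvariantSection σ

/-- A section of `D_A^tr` is strictly positive if its values at all frames are. -/
def IsPositiveSection (𝒢 : LieGroupoid E F M G) (σ : ∀ x, 𝒢.transverseDensity.fiber x) : Prop :=
  ∀ x α f, 0 < 𝒢.transverseEval absHom α f (σ x)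

/-! ### The modular class -/

/-- The modular class is the cohomology class `κ` of the cocycle `c_σ = ln (σ(y) / (g · σ(x)))`,
`g : x → y`, for any strictly positive smooth section `σ` of the transverse density bundle. -/
def IsModularClass (𝒢 : LieGroupoid E F M G) (κ : 𝒢.H1) : Prop :=
  (∃ σ, 𝒢.transverseDensity.IsSmoothSection σ ∧ 𝒢.IsPositiveSection σ) ∧
  ∀ σ, 𝒢.transverseDensity.IsSmoothSection σ → 𝒢.IsPositiveSection σ →
    ∃ c : 𝒢.cocycles,
      (∀ g, c.1 g =
        Real.log (lineRatio (σ (𝒢.tgt g)) (𝒢.transverseDensity.act g (σ (𝒢.src g))))) ∧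
      𝒢.cohomologyClass c = κ

/-- The modular class `mod(𝒢)`. -/
def modularClass (𝒢 : LieGroupoid E F M G) : 𝒢.H1 :=
  Classical.epsilon 𝒢.IsModularClass

end LieGroupoid

end

/-!
An arrow `g : x → y` gives two frames of `T_g G` out of frames of `A_x`, `T_x M`, `A_y` and `T_y M`:
one from the right translates of `A_y` and lifts of `T_x M` along the source map, the other from
the inverted translates of `A_x` and lifts of `T_y M` along the target map. In such frames `g` acts
on transverse volumes by `signedDet`, the determinant of the change between the two, times the
Koszul sign `(-1)^k`, and on transverse densities by the absolute value of `signedDet`. Both bundles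
are treated at once, as the bundle of a character `δ` of `ℝ` that is smooth away from zero
(`LieGroupoid.isRepresentation_transverseBundle`).

*Functoriality.* Since the source and target maps of `G` are submersions between the same spaces,
their differentials have a common right inverse up to isomorphism (`LinearMap.exists_common_lift`),
so for suitable frames of `T_y M` one family `w` of vectors lifts the frames of `T_x M` and
`T_y M` simultaneously. With common lifts, the determinant becomes that of the matrix `C` expressing
the vectors `g a⁻¹` through the vectors `b g` modulo `w` (`LieGroupoid.exchangeDetAt_eq_det`).
Lifts over `g` and `h` that agree over the middle point multiply to common lifts over `g h`, and the
differential of `(g b⁻¹) (b h) = g h` turns the matrices `C'` and `C` into `-C' C`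
(`LieGroupoid.exchangeDetAt_mul_of_lifts`). The sign `(-1)^k` of its determinant is what the Koszul
sign absorbs, so `signedDet` is multiplicative; at a unit it is a nonzero idempotent, hence `1`.
The differential of the product is only defined on composable pairs of tangent vectors, so it is
computed on velocities of composable curves, which exist because the source map is a submersion
(`LieGroupoid.exists_lift_velocity`).

*Smoothness.* In charts in which the source map is a linear projection the two frames are block
triangular, and `signedDet` is a quotient of products of determinants of smooth matrices
(`LieGroupoid.exchangeDetAt_eq_charts`, `LieGroupoid.contMDiffAt_signedDet`).

*The two classes.* A partition of unity gives a positive smooth transverse density `σ`. Its square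
is a nowhere vanishing section of the tensor square of the transverse volume bundle, because the
square of a determinant does not see its sign. An arrow acting on `σ` by a factor `r` acts on the
square by `r²`, so the cocycle of the square is twice that of `σ`
(`LieGroupoid.modularClass_eq_charClass`).

*The counterexamples.* If all arrows are units, every cocycle satisfies `c(g) = c(g) + c(g)`, so
the modular class vanishes, whereas a transverse volume form is a volume form of the manifold and
yields an oriented atlas (`isOrientableManifold_of_frameFunction`). The Möbius band has two charts
with connected domains whose transition map `(m, b) ↦ (1/m, b/m)` has Jacobian `-1/m³`, of both
signs, so it is not orientable (`MoebiusBand.not_isOrientableManifold`).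
-/

set_option linter.unusedSectionVars false

noncomputable section

/-! ### Linear algebra -/

section LinearAlgebra

/-- If a linear map kills the first part of a basis and maps the second part to a basis `ε`, the
determinant of a family whose first part is also killed splits as a product. -/
lemma Module.Basis.det_sumElim_of_ker {ι κ V U : Type*} [Fintype ι] [Fintype κ] [DecidableEq ι]
    [DecidableEq κ] [AddCommGroup V] [Module ℝ V] [AddCommGroup U] [Module ℝ U]
    (B : Basis (ι ⊕ κ) ℝ V) (L : V →ₗ[ℝ] U) (ε : Basis κ ℝ U)
    (h₁ : ∀ i, L (B (Sum.inl i)) = 0) (h₂ : ∀ j, L (B (Sum.inr j)) = ε j)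
    (u : ι → V) (hu : ∀ i, L (u i) = 0) (w : κ → V) :
    B.det (Sum.elim u w) =
      (Matrix.of fun i i' => B.repr (u i') (Sum.inl i)).det * ε.det (fun j => L (w j)) := by
  have hL : ∀ (v : V) (j : κ), ε.repr (L v) j = B.repr v (Sum.inr j) := by
    intro v j
    have : L v = ∑ j, B.repr v (Sum.inr j) • ε j := by
      conv_lhs => rw [← B.sum_repr v, map_sum, Fintype.sum_sum_type]
      simp only [map_smul, h₁, h₂, smul_zero, Finset.sum_const_zero, zero_add]
    rw [this, ε.repr_sum_self]
  have hM : B.toMatrix (Sum.elim u w) =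
      Matrix.fromBlocks (Matrix.of fun i i' => B.repr (u i') (Sum.inl i))
        (Matrix.of fun i j => B.repr (w j) (Sum.inl i)) 0
        (ε.toMatrix fun j => L (w j)) := by
    ext (i | i) (j | j)
    · simp [Basis.toMatrix_apply]
    · simp [Basis.toMatrix_apply]
    · simp [Basis.toMatrix_apply, ← hL, hu]
    · simp [Basis.toMatrix_apply, hL]
  rw [Basis.det_apply, hM, Matrix.det_fromBlocks_zero₂₁, Basis.det_apply]

/-- Two surjections of the same finite-dimensional spaces admit a subspace on which both restrict
to isomorphisms: their kernels have a common complement. -/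
lemma LinearMap.exists_common_lift {V U : Type*} [AddCommGroup V] [Module ℝ V]
    [AddCommGroup U] [Module ℝ U] [FiniteDimensional ℝ U]
    (S T : V →ₗ[ℝ] U) (hS : Function.Surjective S) (hT : Function.Surjective T) :
    ∃ w : U →ₗ[ℝ] V, Function.Bijective (S ∘ₗ w) ∧ Function.Bijective (T ∘ₗ w) := by
  obtain ⟨p, hp⟩ := S.exists_rightInverse_of_surjective (LinearMap.range_eq_top.2 hS)
  obtain ⟨q, hq⟩ := T.exists_rightInverse_of_surjective (LinearMap.range_eq_top.2 hT)
  -- `p + τ • q` works unless `-1/τ` is an eigenvalue of `S q` or `-τ` is one of `T p`.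
  have h₁ := (Module.End.finite_spectrum (S ∘ₗ q : Module.End ℝ U))
  have h₂ := (Module.End.finite_spectrum (T ∘ₗ p : Module.End ℝ U))
  have h₃ : ({0} ∪ (fun x : ℝ => -x⁻¹) ⁻¹' spectrum ℝ (S ∘ₗ q : Module.End ℝ U) ∪
      (fun x : ℝ => -x) ⁻¹' spectrum ℝ (T ∘ₗ p : Module.End ℝ U)).Finite := by
    refine ((Set.finite_singleton _).union (h₁.preimage ?_)).union (h₂.preimage ?_)
    · exact (neg_injective.comp inv_injective).injOn
    · exact neg_injective.injOn
  obtain ⟨τ, hτ⟩ := h₃.infinite_compl.nonempty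
  simp only [Set.mem_compl_iff, Set.mem_union, Set.mem_singleton_iff, Set.mem_preimage,
    not_or] at hτ
  obtain ⟨⟨hτ0, hτ1⟩, hτ2⟩ := hτ
  refine ⟨p + τ • q, ?_, ?_⟩
  · rw [spectrum.notMem_iff] at hτ1
    rw [← Module.End.isUnit_iff]
    have : S ∘ₗ (p + τ • q) = (-τ) • (algebraMap ℝ (Module.End ℝ U) (-τ⁻¹) - S ∘ₗ q) := by
      ext x
      have := DFunLike.congr_fun hp x
      simp only [LinearMap.comp_apply, LinearMap.id_apply] at this
      simp [this, smul_sub, smul_smul, hτ0, Module.algebraMap_end_apply]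
    rw [this]
    exact hτ1.smul (Units.mk0 (-τ) (by simpa using hτ0))
  · rw [spectrum.notMem_iff] at hτ2
    rw [← Module.End.isUnit_iff]
    have : T ∘ₗ (p + τ • q) = -(algebraMap ℝ (Module.End ℝ U) (-τ) - T ∘ₗ p) := by
      ext x
      have := DFunLike.congr_fun hq x
      simp only [LinearMap.comp_apply, LinearMap.id_apply] at this
      simp [this, Module.algebraMap_end_apply, add_comm]
    rw [this]
    exact hτ2.neg

lemma Module.Basis.det_dualBasis {ι V : Type*} [Fintype ι] [DecidableEq ι]
    [AddCommGroup V] [Module ℝ V] (a a' : Basis ι ℝ V) :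
    a.dualBasis.det a'.dualBasis = a'.det a := by
  rw [Basis.det_apply, Basis.det_apply, ← Matrix.det_transpose]
  congr 1
  ext i j
  simp [Basis.toMatrix_apply]

lemma Module.Basis.det_swap {ι V : Type*} [Fintype ι] [DecidableEq ι]
    [AddCommGroup V] [Module ℝ V] (a a' : Basis ι ℝ V) : a'.det a = (a.det a')⁻¹ := by
  refine eq_inv_of_mul_eq_one_left ?_
  rw [Basis.det_mul_det, Basis.det_self]

end LinearAlgebra

/-! ### Frame lines -/

section FrameLine

variable (δ : ℝ →*₀ ℝ) {r : ℕ} {V : Type*} [AddCommGroup V] [Module ℝ V]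

lemma FrameLine.eval_gen (e : Basis (Fin r) ℝ V) :
    FrameLine.eval δ e (FrameLine.gen δ e) = 1 := by
  change δ (e.det e) = 1
  rw [e.det_self, map_one]

lemma FrameLine.eval_change (e e' : Basis (Fin r) ℝ V) (ξ : FrameLine δ r V) :
    FrameLine.eval δ e' ξ = δ (e.det e') * FrameLine.eval δ e ξ := ξ.2 e e'

lemma FrameLine.eval_smul_gen (e : Basis (Fin r) ℝ V) (ξ : FrameLine δ r V) :
    FrameLine.eval δ e ξ • FrameLine.gen δ e = ξ := by
  ext e'
  change ξ.1 e * δ (e.det e') = ξ.1 e'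
  rw [ξ.2 e e', mul_comm]

end FrameLine

namespace LieGroupoid

variable {E F M G : Type*}
  [NormedAddCommGroup E] [NormedSpace ℝ E] [NormedAddCommGroup F] [NormedSpace ℝ F]
  [TopologicalSpace M] [ChartedSpace E M] [TopologicalSpace G] [ChartedSpace F G]
  [FiniteDimensional ℝ E] [FiniteDimensional ℝ F]
  [IsManifold 𝓘(ℝ, E) ∞ M] [IsManifold 𝓘(ℝ, F) ∞ G] (δ : ℝ →*₀ ℝ) (𝒢 : LieGroupoid E F M G)

lemma transverseEval_gen {x : M}
    (α : Basis (Fin 𝒢.rank) ℝ (Dual ℝ (𝒢.algebroidFiber x)))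
    (f : Basis (Fin (finrank ℝ E)) ℝ (TangentSpace 𝓘(ℝ, E) x)) :
    𝒢.transverseEval δ α f (𝒢.transverseGen δ α f) = 1 := by
  simp [transverseEval, transverseGen, FrameLine.eval_gen]

lemma transverseEval_smul_gen {x : M}
    (α : Basis (Fin 𝒢.rank) ℝ (Dual ℝ (𝒢.algebroidFiber x)))
    (f : Basis (Fin (finrank ℝ E)) ℝ (TangentSpace 𝓘(ℝ, E) x)) (ξ : 𝒢.TransverseFiber δ x) :
    𝒢.transverseEval δ α f ξ • 𝒢.transverseGen δ α f = ξ := by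
  induction ξ using TensorProduct.induction_on with
  | zero => simp
  | add ξ η hξ hη => rw [map_add, add_smul, hξ, hη]
  | tmul ξ η =>
    simp only [transverseEval, transverseGen, LinearMap.comp_apply, TensorProduct.map_tmul,
      LinearMap.mul'_apply]
    rw [← TensorProduct.smul_tmul_smul, FrameLine.eval_smul_gen, FrameLine.eval_smul_gen]

lemma transverseEval_change {x : M}
    (α α' : Basis (Fin 𝒢.rank) ℝ (Dual ℝ (𝒢.algebroidFiber x)))
    (f f' : Basis (Fin (finrank ℝ E)) ℝ (TangentSpace 𝓘(ℝ, E) x)) (ξ : 𝒢.TransverseFiber δ x) :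
    𝒢.transverseEval δ α' f' ξ = δ (α.det α' * f.det f') * 𝒢.transverseEval δ α f ξ := by
  induction ξ using TensorProduct.induction_on with
  | zero => simp
  | add ξ η hξ hη => rw [map_add, map_add, mul_add, hξ, hη]
  | tmul ξ η =>
    simp only [transverseEval, LinearMap.comp_apply, TensorProduct.map_tmul,
      LinearMap.mul'_apply, FrameLine.eval_change δ α α', FrameLine.eval_change δ f f', map_mul]
    ring

lemma transverseEval_gen_change {x : M}
    (a a' : Basis (Fin 𝒢.rank) ℝ (𝒢.algebroidFiber x))
    (f f' : Basis (Fin (finrank ℝ E)) ℝ (TangentSpace 𝓘(ℝ, E) x)) :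
    𝒢.transverseEval δ a.dualBasis f (𝒢.transverseGen δ a'.dualBasis f') =
      δ (a.det a' * f'.det f) := by
  rw [𝒢.transverseEval_change δ a'.dualBasis a.dualBasis f' f, 𝒢.transverseEval_gen,
    Basis.det_dualBasis, _root_.mul_one]

/-- Each fibre is spanned by the generator attached to any pair of frames. -/
lemma finrank_transverseFiber (x : M) : finrank ℝ (𝒢.TransverseFiber δ x) = 1 := by
  have e := 𝒢.someAlgebroidFrame x
  have f := 𝒢.someObjectFrame x
  refine finrank_eq_one (𝒢.transverseGen δ e.dualBasis f) ?_ fun ξ =>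
    ⟨_, 𝒢.transverseEval_smul_gen δ e.dualBasis f ξ⟩
  intro h
  have := 𝒢.transverseEval_gen δ e.dualBasis f
  simp [h] at this

end LieGroupoid

/-! ### Cocycles attached to sections of one-dimensional representations -/

/-- The characterization of `lineRatio`, which is chosen by a global choice operator. -/
lemma lineRatio_eq {L : Type*} [AddCommGroup L] [Module ℝ L] {u v : L} {c : ℝ} (hv : v ≠ 0)
    (h : u = c • v) : lineRatio u v = c := by
  have h' : u = lineRatio u v • v := Classical.epsilon_spec (p := fun c : ℝ => u = c • v) ⟨c, h⟩
  exact smul_left_injective ℝ hv (h'.symm.trans h)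

lemma tmul_self_ne_zero {L : Type*} [AddCommGroup L] [Module ℝ L] {v : L} (hv : v ≠ 0) :
    v ⊗ₜ[ℝ] v ≠ 0 := by
  obtain ⟨f, hf⟩ := not_forall.1 fun h => hv ((Module.forall_dual_apply_eq_zero_iff ℝ v).1 h)
  intro h
  have := congrArg (LinearMap.mul' ℝ ℝ ∘ₗ TensorProduct.map f f) h
  simp [hf] at this

namespace LieGroupoid

variable {E F M G : Type*}
  [NormedAddCommGroup E] [NormedSpace ℝ E] [NormedAddCommGroup F] [NormedSpace ℝ F]
  [TopologicalSpace M] [ChartedSpace E M] [TopologicalSpace G] [ChartedSpace F G]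

lemma contMDiff_src (𝒢 : LieGroupoid E F M G) : ContMDiff 𝓘(ℝ, F) 𝓘(ℝ, E) ∞ 𝒢.src :=
  fun g => (𝒢.isSubmersion_src.isSubmersionAt g).contMDiffAt

variable {𝒢 : LieGroupoid E F M G}

lemma cohomologyClass_eq_iff {c c' : 𝒢.cocycles} :
    𝒢.cohomologyClass c = 𝒢.cohomologyClass c' ↔
      ∃ f : C^∞⟮𝓘(ℝ, E), M; 𝓘(ℝ, ℝ), ℝ⟯,
        ∀ g, c.1 g - c'.1 g = f (𝒢.src g) - f (𝒢.tgt g) := by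
  unfold cohomologyClass
  rw [Submodule.Quotient.eq]
  rfl

namespace LineRepData

variable {L : LineRepData 𝒢}

namespace IsRepresentation

lemma exists_smul_eq (hL : L.IsRepresentation) {x : M} {v : L.fiber x} (hv : v ≠ 0)
    (u : L.fiber x) : ∃ c : ℝ, u = c • v := by
  obtain ⟨c, hc⟩ := exists_smul_eq_of_finrank_eq_one (hL.finrank_fiber x) hv u
  exact ⟨c, hc.symm⟩

lemma exists_ne_zero_section (hL : L.IsRepresentation) : ∃ σ : ∀ x, L.fiber x, ∀ x, σ x ≠ 0 := by
  choose e he hx using hL.frames_cover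
  exact ⟨fun x => (e x).2 x, fun x => hL.frame_ne_zero _ (he x) x (hx x)⟩

lemma act_section_ne_zero (hL : L.IsRepresentation) {σ : ∀ x, L.fiber x} (hσ : ∀ x, σ x ≠ 0)
    (g : G) : L.act g (σ (𝒢.src g)) ≠ 0 := by
  -- If `g · σ(x) = 0`, then `σ(x) = g⁻¹ · (g · σ(x)) = 0`.
  intro h
  have h₁ := hL.act_mul (𝒢.inv g) g (𝒢.src_inv g) σ 0 0 h (by simp)
  have h₂ : ∀ k, k = 𝒢.one (𝒢.src g) → L.act k (σ (𝒢.src k)) ≠ 0 := by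
    rintro k rfl
    rw [hL.act_one]
    exact hσ _
  exact h₂ _ (𝒢.inv_mul g) h₁

/-- The factors `r` with `g · σ(x) = r(g) σ(y)`, for `σ` a nowhere vanishing section. -/
lemma exists_factor (hL : L.IsRepresentation) {σ : ∀ x, L.fiber x} (hσ : ∀ x, σ x ≠ 0) :
    ∃ r : G → ℝ, (∀ g, L.act g (σ (𝒢.src g)) = r g • σ (𝒢.tgt g)) ∧ (∀ g, r g ≠ 0) ∧
      (∀ x, r (𝒢.one x) = 1) ∧
      ∀ g h, 𝒢.src g = 𝒢.tgt h → r (𝒢.mul g h) = r g * r h := by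
  choose r hr using fun g => hL.exists_smul_eq (hσ (𝒢.tgt g)) (L.act g (σ (𝒢.src g)))
  refine ⟨r, hr, fun g hg => ?_, fun x => ?_, fun g h hgh => ?_⟩
  · apply hL.act_section_ne_zero hσ g
    rw [hr, hg, zero_smul]
  · apply smul_left_injective ℝ (hσ _)
    exact (hr _).symm.trans ((hL.act_one x σ).trans (one_smul ℝ _).symm)
  · apply smul_left_injective ℝ (hσ _)
    refine (hr _).symm.trans ?_
    exact hL.act_mul g h hgh σ (r h • σ) ((r g * r h) • σ) (hr h) (by
      simp only [Pi.smul_apply, map_smul, hr g, smul_smul, mul_comm])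

/-- The coefficient of one smooth section with respect to another, nowhere vanishing one. -/
lemma exists_contMDiff_coeff (hL : L.IsRepresentation) {σ τ : ∀ x, L.fiber x}
    (hσ : L.IsSmoothSection σ) (hσ0 : ∀ x, σ x ≠ 0) (hτ : L.IsSmoothSection τ) :
    ∃ u : M → ℝ, ContMDiff 𝓘(ℝ, E) 𝓘(ℝ, ℝ) ∞ u ∧ ∀ x, τ x = u x • σ x := by
  choose u hu using fun x => hL.exists_smul_eq (hσ0 x) (τ x)
  refine ⟨u, fun x => ?_, hu⟩
  obtain ⟨e, he, hx⟩ := hL.frames_cover x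
  have hfr : ∀ y, ∃ c : ℝ × ℝ, y ∈ e.1 → σ y = c.1 • e.2 y ∧ τ y = c.2 • e.2 y := by
    intro y
    by_cases hy : y ∈ e.1
    · obtain ⟨c, hc⟩ := hL.exists_smul_eq (hL.frame_ne_zero e he y hy) (σ y)
      obtain ⟨d, hd⟩ := hL.exists_smul_eq (hL.frame_ne_zero e he y hy) (τ y)
      exact ⟨(c, d), fun _ => ⟨hc, hd⟩⟩
    · exact ⟨0, fun h => absurd h hy⟩
  choose c hc using hfr
  have h₁ := hσ e he (fun y => (c y).1) fun y hy => (hc y hy).1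
  have h₂ := hτ e he (fun y => (c y).2) fun y hy => (hc y hy).2
  have hc0 : ∀ y ∈ e.1, (c y).1 ≠ 0 := by
    intro y hy h
    apply hσ0 y
    rw [(hc y hy).1, h, zero_smul]
  have h₃ : ContMDiffOn 𝓘(ℝ, E) 𝓘(ℝ, ℝ) ∞ u e.1 := by
    refine (h₂.div₀ h₁ hc0).congr fun y hy => ?_
    rw [Pi.div_apply, eq_div_iff (hc0 y hy)]
    apply smul_left_injective ℝ (hL.frame_ne_zero e he y hy)
    change (u y * (c y).1) • e.2 y = (c y).2 • e.2 y
    rw [mul_smul, ← (hc y hy).1, ← (hc y hy).2, ← hu]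
  exact h₃.contMDiffAt ((hL.isOpen_frame e he).mem_nhds hx)

/-- The coefficient of a section in a local frame, extended arbitrarily outside of its domain. -/
lemma exists_local_coeff (hL : L.IsRepresentation) (σ : ∀ x, L.fiber x) {e} (he : e ∈ L.frames) :
    ∃ c : M → ℝ, ∀ x ∈ e.1, σ x = c x • e.2 x := by
  have : ∀ x, ∃ c : ℝ, x ∈ e.1 → σ x = c • e.2 x := by
    intro x
    by_cases hx : x ∈ e.1
    · obtain ⟨c, hc⟩ := hL.exists_smul_eq (hL.frame_ne_zero e he x hx) (σ x)
      exact ⟨c, fun _ => hc⟩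
    · exact ⟨0, fun h => absurd h hx⟩
  choose c hc using this
  exact ⟨c, hc⟩

/-- The factors `r` with `g · σ(x) = r(g) σ(y)` are smooth when `σ` is. -/
lemma contMDiff_factor (hL : L.IsRepresentation) {σ : ∀ x, L.fiber x}
    (hσ : L.IsSmoothSection σ) (hσ0 : ∀ x, σ x ≠ 0) {r : G → ℝ}
    (hr : ∀ g, L.act g (σ (𝒢.src g)) = r g • σ (𝒢.tgt g)) :
    ContMDiff 𝓘(ℝ, F) 𝓘(ℝ, ℝ) ∞ r := by
  intro g
  obtain ⟨e, he, hx⟩ := hL.frames_cover (𝒢.src g)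
  obtain ⟨e', he', hy⟩ := hL.frames_cover (𝒢.tgt g)
  obtain ⟨u, hu⟩ := hL.exists_local_coeff σ he
  obtain ⟨u', hu'⟩ := hL.exists_local_coeff σ he'
  set U : Set G := 𝒢.src ⁻¹' e.1 ∩ 𝒢.tgt ⁻¹' e'.1
  have hUo : IsOpen U := ((hL.isOpen_frame e he).preimage 𝒢.contMDiff_src.continuous).inter
    ((hL.isOpen_frame e' he').preimage 𝒢.contMDiff_tgt.continuous)
  have hu0 : ∀ y ∈ e.1, u y ≠ 0 := by
    intro y hy h
    apply hσ0 y
    rw [hu y hy, h, zero_smul]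
  have hs : ContMDiffOn 𝓘(ℝ, F) 𝓘(ℝ, ℝ) ∞ (fun g => u (𝒢.src g)) U :=
    (hσ e he u hu).comp 𝒢.contMDiff_src.contMDiffOn fun g hg => hg.1
  have ht : ContMDiffOn 𝓘(ℝ, F) 𝓘(ℝ, ℝ) ∞ (fun g => u' (𝒢.tgt g)) U :=
    (hσ e' he' u' hu').comp 𝒢.contMDiff_tgt.contMDiffOn fun g hg => hg.2
  have hc := hL.contMDiffOn_act e he e' he' (fun g => r g * u' (𝒢.tgt g) / u (𝒢.src g)) (by
    intro g hg
    have h1 := hr g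
    rw [hu _ hg.1, hu' _ hg.2, map_smul] at h1
    rw [div_eq_inv_mul, mul_smul, mul_smul, ← h1, smul_smul, inv_mul_cancel₀ (hu0 _ hg.1),
      one_smul])
  have hu0' : ∀ y ∈ e'.1, u' y ≠ 0 := by
    intro y hy h
    apply hσ0 y
    rw [hu' y hy, h, zero_smul]
  have h₃ : ContMDiffOn 𝓘(ℝ, F) 𝓘(ℝ, ℝ) ∞ r U := by
    refine ((hc.mul hs).div₀ ht fun g hg => hu0' _ hg.2).congr fun g hg => ?_
    have h1 := hu0 _ hg.1
    have h2 := hu0' _ hg.2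
    simp only [Pi.div_apply, Pi.mul_apply]
    field_simp
  exact h₃.contMDiffAt (hUo.mem_nhds ⟨hx, hy⟩)

/-- The ratio `σ(y) / (g · σ(x))` that enters the cocycle of `σ` is the inverse of the factor `r`
with `g · σ(x) = r σ(y)`. -/
lemma lineRatio_eq_inv (hL : L.IsRepresentation) {σ : ∀ x, L.fiber x} (hσ0 : ∀ x, σ x ≠ 0)
    {g : G} {r : ℝ} (hr : L.act g (σ (𝒢.src g)) = r • σ (𝒢.tgt g)) :
    lineRatio (σ (𝒢.tgt g)) (L.act g (σ (𝒢.src g))) = r⁻¹ := by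
  have h0 := hL.act_section_ne_zero hσ0 g
  refine lineRatio_eq h0 ?_
  have hr0 : r ≠ 0 := by
    rintro rfl
    exact h0 (by rw [hr, zero_smul])
  rw [hr, smul_smul, inv_mul_cancel₀ hr0, one_smul]

/-- The function `ln |σ(y) / (g · σ(x))|` attached to a nowhere vanishing smooth section `σ` is a
smooth cocycle. -/
lemma exists_cocycle (hL : L.IsRepresentation) {σ : ∀ x, L.fiber x}
    (hσ : L.IsSmoothSection σ) (hσ0 : ∀ x, σ x ≠ 0) :
    ∃ c : 𝒢.cocycles,
      ∀ g, c.1 g = Real.log |lineRatio (σ (𝒢.tgt g)) (L.act g (σ (𝒢.src g)))| := by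
  obtain ⟨r, hr, hr0, -, hmul⟩ := hL.exists_factor hσ0
  have hsm := hL.contMDiff_factor hσ hσ0 hr
  have hlog : ContMDiff 𝓘(ℝ, F) 𝓘(ℝ, ℝ) ∞ (fun g => -Real.log (r g)) := by
    intro g
    exact ((Real.contDiffAt_log.2 (hr0 g)).neg.contMDiffAt).comp g (hsm g)
  refine ⟨⟨⟨_, hlog⟩, fun g h hgh => ?_⟩, fun g => ?_⟩
  · change -Real.log (r _) = -Real.log (r g) + -Real.log (r h)
    rw [hmul g h hgh, Real.log_mul (hr0 g) (hr0 h)]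
    ring
  · change -Real.log (r g) = _
    rw [hL.lineRatio_eq_inv hσ0 (hr g), Real.log_abs, Real.log_inv]

/-- The cocycles of two nowhere vanishing smooth sections `σ` and `u σ` differ by the coboundary of
`ln |u|`. -/
lemma cohomologyClass_eq (hL : L.IsRepresentation) {σ σ' : ∀ x, L.fiber x}
    (hσ : L.IsSmoothSection σ) (hσ0 : ∀ x, σ x ≠ 0)
    (hσ' : L.IsSmoothSection σ') (hσ0' : ∀ x, σ' x ≠ 0) {c c' : 𝒢.cocycles}
    (hc : ∀ g, c.1 g = Real.log |lineRatio (σ (𝒢.tgt g)) (L.act g (σ (𝒢.src g)))|)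
    (hc' : ∀ g, c'.1 g = Real.log |lineRatio (σ' (𝒢.tgt g)) (L.act g (σ' (𝒢.src g)))|) :
    𝒢.cohomologyClass c = 𝒢.cohomologyClass c' := by
  obtain ⟨r, hr, hr0, -, -⟩ := hL.exists_factor hσ0
  obtain ⟨r', hr', hr0', -, -⟩ := hL.exists_factor hσ0'
  obtain ⟨u, hu, hu'⟩ := hL.exists_contMDiff_coeff hσ hσ0 hσ'
  have hu0 : ∀ x, u x ≠ 0 := fun x h => hσ0' x (by rw [hu' x, h, zero_smul])
  have hlog : ContMDiff 𝓘(ℝ, E) 𝓘(ℝ, ℝ) ∞ (fun x => Real.log (u x)) := by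
    intro x
    exact ((Real.contDiffAt_log.2 (hu0 x)).contMDiffAt).comp x (hu x)
  refine cohomologyClass_eq_iff.2 ⟨⟨_, hlog⟩, fun g => ?_⟩
  change _ = Real.log (u (𝒢.src g)) - Real.log (u (𝒢.tgt g))
  rw [hc, hc', hL.lineRatio_eq_inv hσ0 (hr g), hL.lineRatio_eq_inv hσ0' (hr' g), Real.log_abs,
    Real.log_abs, Real.log_inv, Real.log_inv]
  have h : r' g * u (𝒢.tgt g) = u (𝒢.src g) * r g := by
    apply smul_left_injective ℝ (hσ0 (𝒢.tgt g))
    have := hr' g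
    rw [hu', hu', map_smul, hr, smul_smul, smul_smul] at this
    exact this.symm
  have h' := congrArg Real.log h
  rw [Real.log_mul (hr0' g) (hu0 _), Real.log_mul (hu0 _) (hr0 g)] at h'
  linarith

/-- A nowhere vanishing smooth section computes the class of a trivializable representation. -/
lemma isTrivialCharClass (hL : L.IsRepresentation) {σ : ∀ x, L.fiber x}
    (hσ : L.IsSmoothSection σ) (hσ0 : ∀ x, σ x ≠ 0) {c : 𝒢.cocycles}
    (hc : ∀ g, c.1 g = Real.log |lineRatio (σ (𝒢.tgt g)) (L.act g (σ (𝒢.src g)))|) :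
    L.IsTrivialCharClass (𝒢.cohomologyClass c) := by
  refine ⟨⟨σ, hσ, hσ0⟩, fun σ' hσ' hσ0' => ?_⟩
  obtain ⟨c', hc'⟩ := hL.exists_cocycle hσ' hσ0'
  exact ⟨c', hc', hL.cohomologyClass_eq hσ' hσ0' hσ hσ0 hc' hc⟩

end IsRepresentation

lemma IsTrivialCharClass.unique {κ κ' : 𝒢.H1} (h : L.IsTrivialCharClass κ)
    (h' : L.IsTrivialCharClass κ') : κ = κ' := by
  obtain ⟨⟨σ, hσ, hσ0⟩, h⟩ := h
  obtain ⟨c, hc, rfl⟩ := h σ hσ hσ0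
  obtain ⟨c', hc', rfl⟩ := h'.2 σ hσ hσ0
  congr 1
  ext g
  rw [hc, hc']

/-! ### The tensor square of a one-dimensional representation -/

/-- The axioms reduce to identities between coefficients with respect to `s ⊗ s`, where `s` is a
nowhere vanishing section, not assumed continuous: an arrow that acts on `s` by a factor `r` acts
on `s ⊗ s` by `r²`. -/
lemma IsRepresentation.tensorSquare (hL : L.IsRepresentation) :
    L.tensorSquare.IsRepresentation := by
  obtain ⟨s, hs⟩ := hL.exists_ne_zero_section
  obtain ⟨r, hr, -, hr1, hmul⟩ := hL.exists_factor hs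
  have hss : ∀ x, s x ⊗ₜ[ℝ] s x ≠ 0 := fun x => tmul_self_ne_zero (hs x)
  obtain ⟨t, ht⟩ : ∃ t : ∀ x, L.tensorSquare.fiber x, ∀ x, t x = s x ⊗ₜ[ℝ] s x :=
    ⟨fun x => s x ⊗ₜ[ℝ] s x, fun x => rfl⟩
  have ht0 : ∀ x, t x ≠ 0 := fun x => (ht x).symm ▸ hss x
  have hact : ∀ g, L.tensorSquare.act g (t (𝒢.src g)) = (r g * r g) • t (𝒢.tgt g) := by
    intro g
    rw [ht, ht]
    change L.act g (s (𝒢.src g)) ⊗ₜ[ℝ] L.act g (s (𝒢.src g)) = _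
    rw [hr, TensorProduct.smul_tmul_smul]
    rfl
  have hfin : ∀ x, finrank ℝ (L.tensorSquare.fiber x) = 1 := by
    intro x
    exact (finrank_tensorProduct (R := ℝ) (S := ℝ)).trans (by rw [hL.finrank_fiber])
  have hco : ∀ ξ : ∀ x, L.tensorSquare.fiber x, ∃ u : M → ℝ, ∀ x, ξ x = u x • t x := by
    intro ξ
    choose u hu using fun x => exists_smul_eq_of_finrank_eq_one (hfin x) (ht0 x) (ξ x)
    exact ⟨u, fun x => (hu x).symm⟩
  refine ⟨hfin, ?_, ?_, ?_, ?_, ?_, ?_, ?_⟩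
  · rintro _ ⟨e, he, rfl⟩
    exact hL.isOpen_frame e he
  · rintro _ ⟨e, he, rfl⟩ x hx
    exact tmul_self_ne_zero (hL.frame_ne_zero e he x hx)
  · intro x
    obtain ⟨e, he, hx⟩ := hL.frames_cover x
    exact ⟨_, ⟨e, he, rfl⟩, hx⟩
  · rintro _ ⟨e, he, rfl⟩ _ ⟨e', he', rfl⟩ c hc
    obtain ⟨d, hd⟩ := hL.exists_local_coeff e'.2 he
    have hd' := hL.contMDiffOn_transition e he e' he' d fun x hx => hd x hx.1
    refine (hd'.mul hd').congr fun x hx => ?_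
    apply smul_left_injective ℝ (tmul_self_ne_zero (hL.frame_ne_zero e he x hx.1))
    refine (hc x hx).symm.trans ?_
    simp only [Pi.mul_apply]
    rw [hd x hx.1, TensorProduct.smul_tmul_smul]
  · rintro _ ⟨e, he, rfl⟩ _ ⟨e', he', rfl⟩ c hc
    have : ∀ g, ∃ d : ℝ, 𝒢.tgt g ∈ e'.1 → L.act g (e.2 (𝒢.src g)) = d • e'.2 (𝒢.tgt g) := by
      intro g
      by_cases hg : 𝒢.tgt g ∈ e'.1
      · obtain ⟨d, hd⟩ := hL.exists_smul_eq (hL.frame_ne_zero e' he' _ hg) (L.act g (e.2 (𝒢.src g)))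
        exact ⟨d, fun _ => hd⟩
      · exact ⟨0, fun h => absurd h hg⟩
    choose d hd using this
    have hd' := hL.contMDiffOn_act e he e' he' d fun g hg => hd g hg.2
    refine (hd'.mul hd').congr fun g hg => ?_
    apply smul_left_injective ℝ (tmul_self_ne_zero (hL.frame_ne_zero e' he' _ hg.2))
    refine (hc g hg).symm.trans ?_
    change L.act g (e.2 (𝒢.src g)) ⊗ₜ[ℝ] L.act g (e.2 (𝒢.src g)) = _
    rw [hd g hg.2, TensorProduct.smul_tmul_smul]
    rfl
  · intro x σ
    obtain ⟨u, hu⟩ := hco σ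
    rw [hu, hu, map_smul, hact, hr1, 𝒢.src_one, 𝒢.tgt_one, _root_.mul_one, one_smul]
  · intro g h hgh σ τ ρ h₁ h₂
    obtain ⟨u, hu⟩ := hco σ
    obtain ⟨v, hv⟩ := hco τ
    obtain ⟨w, hw⟩ := hco ρ
    rw [hu, hv, map_smul, hact, smul_smul] at h₁
    rw [hv, hw, map_smul, hact, smul_smul] at h₂
    have h₁' : u (𝒢.src h) * (r h * r h) = v (𝒢.tgt h) := smul_left_injective ℝ (ht0 _) h₁
    have h₂' : v (𝒢.src g) * (r g * r g) = w (𝒢.tgt g) := smul_left_injective ℝ (ht0 _) h₂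
    rw [hu, hw, map_smul, hact, smul_smul, hmul g h hgh, 𝒢.src_mul g h hgh, 𝒢.tgt_mul g h hgh,
      ← h₂', hgh, ← h₁']
    congr 1
    ring

end LineRepData

end LieGroupoid

/-! ### Differentials and velocities -/

section Velocity

variable {H H' H'' N N' N'' : Type*}
  [NormedAddCommGroup H] [NormedSpace ℝ H] [NormedAddCommGroup H'] [NormedSpace ℝ H']
  [NormedAddCommGroup H''] [NormedSpace ℝ H'']
  [TopologicalSpace N] [ChartedSpace H N] [TopologicalSpace N'] [ChartedSpace H' N']
  [TopologicalSpace N''] [ChartedSpace H'' N'']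

variable (H H') in
/-- The differential of `f` at `p`, as a linear map between the model spaces. The tangent spaces are
definitionally equal to the model space, and naming the latter allows the differentials at points
that are only propositionally equal to be compared. -/
def mdiff (f : N → N') (p : N) : H →L[ℝ] H' := mfderiv 𝓘(ℝ, H) 𝓘(ℝ, H') f p

lemma mdiff_comp {f : N → N'} {f' : N' → N''} {p : N}
    (hf' : MDifferentiableAt 𝓘(ℝ, H') 𝓘(ℝ, H'') f' (f p))
    (hf : MDifferentiableAt 𝓘(ℝ, H) 𝓘(ℝ, H') f p) :
    mdiff H H'' (f' ∘ f) p = (mdiff H' H'' f' (f p)).comp (mdiff H H' f p) :=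
  mfderiv_comp p hf' hf

lemma mdiff_congr {f f' : N → N'} {p : N} (h : f =ᶠ[nhds p] f') :
    mdiff H H' f p = mdiff H H' f' p := h.mfderiv_eq

lemma mdiff_eq_fderiv {f : H → H'} {p : H} : mdiff H H' f p = fderiv ℝ f p := mfderiv_eq_fderiv

variable (H H') in
/-- The differential of `f` at `p` within `s`, as a linear map between the model spaces. -/
def mdiffWithin (f : N → N') (s : Set N) (p : N) : H →L[ℝ] H' :=
  mfderivWithin 𝓘(ℝ, H) 𝓘(ℝ, H') f s p

/-- The curve `γ` passes through `p` at time `0`, with velocity `u`. -/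
def HasVelocity (γ : ℝ → N) (p : N) (u : H) : Prop :=
  γ 0 = p ∧ MDifferentiableAt 𝓘(ℝ, ℝ) 𝓘(ℝ, H) γ 0 ∧ mdiff ℝ H γ 0 1 = u

namespace HasVelocity

variable {γ γ' : ℝ → N} {p p' : N} {u u' : H}

lemma unique (h : HasVelocity γ p u) (h' : HasVelocity γ p' u') : u = u' :=
  h.2.2.symm.trans h'.2.2

lemma congr (h : HasVelocity γ p u) (hγ : γ' =ᶠ[nhds 0] γ) : HasVelocity γ' p u :=
  ⟨hγ.self_of_nhds.trans h.1, h.2.1.congr_of_eventuallyEq hγ, by rw [mdiff_congr hγ, h.2.2]⟩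

lemma const (p : N) : HasVelocity (fun _ => p) p (0 : H) := by
  refine ⟨rfl, mdifferentiableAt_const, ?_⟩
  have : mdiff ℝ H (fun _ : ℝ => p) 0 = 0 := mfderiv_const
  rw [this]
  rfl

lemma comp (h : HasVelocity γ p u) {f : N → N'}
    (hf : MDifferentiableAt 𝓘(ℝ, H) 𝓘(ℝ, H') f p) :
    HasVelocity (fun t => f (γ t)) (f p) (mdiff H H' f p u) := by
  obtain ⟨rfl, h, rfl⟩ := h
  exact ⟨rfl, hf.comp 0 h, by
    rw [show (fun t => f (γ t)) = f ∘ γ from rfl, mdiff_comp hf h]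
    rfl⟩

/-- The chain rule for a map that is only differentiable within a set `s`: although differentials
within `s` are in general not unique, all of them agree on velocities of curves in `s`. -/
lemma comp_within (h : HasVelocity γ p u) {f : N → N'} {s : Set N}
    (hf : MDifferentiableWithinAt 𝓘(ℝ, H) 𝓘(ℝ, H') f s p) (hs : ∀ t, γ t ∈ s) :
    HasVelocity (fun t => f (γ t)) (f p) (mdiffWithin H H' f s p u) := by
  obtain ⟨rfl, h, rfl⟩ := h
  have h2 := mfderivWithin_comp (0 : ℝ) hf h.mdifferentiableWithinAt
    (fun t (_ : t ∈ Set.univ) => hs t) (uniqueMDiffWithinAt_univ _)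
  rw [mfderivWithin_univ, mfderivWithin_univ] at h2
  refine ⟨rfl, mdifferentiableWithinAt_univ.1
    (hf.comp 0 h.mdifferentiableWithinAt fun t _ => hs t), ?_⟩
  exact DFunLike.congr_fun h2 (1 : ℝ)

lemma continuousAt (h : HasVelocity γ p u) : ContinuousAt γ 0 := h.2.1.continuousAt

lemma of_hasDerivAt {γ : ℝ → H} {p u : H} (h0 : γ 0 = p) (h : HasDerivAt γ u 0) :
    HasVelocity γ p u :=
  ⟨h0, h.differentiableAt.mdifferentiableAt, by
    rw [mdiff_eq_fderiv, h.hasFDerivAt.fderiv]; simp⟩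

lemma hasDerivAt {γ : ℝ → H} {p u : H} (h : HasVelocity γ p u) : HasDerivAt γ u 0 := by
  obtain ⟨-, h1, h2⟩ := h
  rw [mdiff_eq_fderiv] at h2
  rw [← h2]
  exact h1.differentiableAt.hasDerivAt

lemma prodMk (h : HasVelocity γ p u) {η : ℝ → N'} {q : N'} {v : H'} (h' : HasVelocity η q v) :
    γ 0 = p ∧ η 0 = q ∧ MDifferentiableAt 𝓘(ℝ, ℝ) (𝓘(ℝ, H).prod 𝓘(ℝ, H')) (fun t => (γ t, η t)) 0 ∧
    (mfderiv 𝓘(ℝ, ℝ) (𝓘(ℝ, H).prod 𝓘(ℝ, H')) (fun t => (γ t, η t)) 0 : ℝ → H × H') 1 = (u, v) := by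
  refine ⟨h.1, h'.1, h.2.1.prodMk h'.2.1, ?_⟩
  rw [mfderiv_prodMk h.2.1 h'.2.1, ← h.2.2, ← h'.2.2]
  rfl

end HasVelocity

end Velocity

section Charts

variable {N H : Type*} [NormedAddCommGroup H] [NormedSpace ℝ H] [TopologicalSpace N]
  [ChartedSpace H N] [IsManifold 𝓘(ℝ, H) ∞ N] {φ : OpenPartialHomeomorph N H}

lemma mdifferentiableAt_chart (hφ : φ ∈ IsManifold.maximalAtlas 𝓘(ℝ, H) ∞ N) {p : N}
    (hp : p ∈ φ.source) : MDifferentiableAt 𝓘(ℝ, H) 𝓘(ℝ, H) φ p :=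
  (contMDiffAt_of_mem_maximalAtlas hφ hp).mdifferentiableAt (by simp)

lemma mdifferentiableAt_chart_symm (hφ : φ ∈ IsManifold.maximalAtlas 𝓘(ℝ, H) ∞ N) {u : H}
    (hu : u ∈ φ.target) : MDifferentiableAt 𝓘(ℝ, H) 𝓘(ℝ, H) φ.symm u :=
  (contMDiffAt_symm_of_mem_maximalAtlas hφ hu).mdifferentiableAt (by simp)

/-- The differentials of a chart and of its inverse are inverse to each other. -/
lemma mdiff_symm_mdiff (hφ : φ ∈ IsManifold.maximalAtlas 𝓘(ℝ, H) ∞ N) {p : N}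
    (hp : p ∈ φ.source) (u : H) :
    mdiff H H φ.symm (φ p) (mdiff H H φ p u) = u := by
  have h := mdiff_comp (f := φ) (mdifferentiableAt_chart_symm hφ (φ.map_source hp))
    (mdifferentiableAt_chart hφ hp)
  have hev : φ.symm ∘ φ =ᶠ[nhds p] id := by
    filter_upwards [φ.open_source.mem_nhds hp] with q hq
    exact φ.left_inv hq
  rw [mdiff_congr hev] at h
  have hid : mdiff H H (id : N → N) p = ContinuousLinearMap.id ℝ H := mfderiv_id
  rw [hid] at h
  exact (DFunLike.congr_fun h u).symm

lemma mdiff_mdiff_symm (hφ : φ ∈ IsManifold.maximalAtlas 𝓘(ℝ, H) ∞ N) {p : N}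
    (hp : p ∈ φ.source) (u : H) :
    mdiff H H φ p (mdiff H H φ.symm (φ p) u) = u := by
  have h := mdiff_comp (f := φ.symm) (f' := φ) (p := φ p)
    (by rw [φ.left_inv hp]; exact mdifferentiableAt_chart hφ hp)
    (mdifferentiableAt_chart_symm hφ (φ.map_source hp))
  have hev : φ ∘ φ.symm =ᶠ[nhds (φ p)] id := by
    filter_upwards [φ.open_target.mem_nhds (φ.map_source hp)] with q hq
    exact φ.right_inv hq
  rw [mdiff_congr hev, φ.left_inv hp, mdiff_eq_fderiv, fderiv_id] at h
  exact (DFunLike.congr_fun h u).symm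

end Charts

/-! ### Adapted charts -/

namespace LieGroupoid

variable {E F M G : Type*}
  [NormedAddCommGroup E] [NormedSpace ℝ E] [NormedAddCommGroup F] [NormedSpace ℝ F]
  [TopologicalSpace M] [ChartedSpace E M] [TopologicalSpace G] [ChartedSpace F G]

/-- A chart of the arrows and a chart of the objects in which the source map is a linear
projection. -/
structure AdaptedChart (𝒢 : LieGroupoid E F M G) where
  /-- The chart of the manifold of arrows. -/
  dom : OpenPartialHomeomorph G F
  /-- The chart of the manifold of objects. -/
  cod : OpenPartialHomeomorph M E
  /-- The splitting of the model space into the directions of `M` and those of the fibres. -/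
  equiv : F ≃L[ℝ] E × (Fin 𝒢.rank → ℝ)
  dom_mem : dom ∈ IsManifold.maximalAtlas 𝓘(ℝ, F) ∞ G
  cod_mem : cod ∈ IsManifold.maximalAtlas 𝓘(ℝ, E) ∞ M
  src_mem : ∀ p ∈ dom.source, 𝒢.src p ∈ cod.source
  fst_equiv : ∀ p ∈ dom.source, (equiv (dom p)).1 = cod (𝒢.src p)

/-- The normal form of the submersion `s`, with the complement of dimension `k` identified with
`ℝ^k`. -/
lemma exists_adaptedChart [FiniteDimensional ℝ E] [FiniteDimensional ℝ F]
    (𝒢 : LieGroupoid E F M G) (g : G) :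
    ∃ χ : 𝒢.AdaptedChart, g ∈ χ.dom.source := by
  obtain ⟨C, _, _, hs⟩ := 𝒢.isSubmersion_src.isSubmersionAt g
  have : FiniteDimensional ℝ C :=
    Module.Finite.of_surjective
      ((LinearMap.snd ℝ E C) ∘ₗ (hs.equiv.toLinearEquiv : F →ₗ[ℝ] E × C))
      (Prod.snd_surjective.comp hs.equiv.surjective)
  have hrank : finrank ℝ C = finrank ℝ (Fin 𝒢.rank → ℝ) := by
    have := hs.equiv.toLinearEquiv.finrank_eq
    rw [finrank_prod] at this
    rw [finrank_fin_fun, rank, this]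
    omega
  refine ⟨⟨hs.domChart, hs.codChart,
    hs.equiv.trans ((ContinuousLinearEquiv.refl ℝ E).prodCongr
      (ContinuousLinearEquiv.ofFinrankEq hrank)),
    hs.domChart_mem_maximalAtlas, hs.codChart_mem_maximalAtlas,
    hs.source_subset_preimage_source, fun p hp => ?_⟩, hs.mem_domChart_source⟩
  have h1 := hs.writtenInCharts
    (show hs.domChart p ∈ (hs.domChart.extend 𝓘(ℝ, F)).target by
      simpa using hs.domChart.map_source hp)
  simp only [Function.comp_apply, OpenPartialHomeomorph.extend, mfld_simps,
    hs.domChart.left_inv hp] at h1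
  exact h1.symm

namespace AdaptedChart

variable {𝒢 : LieGroupoid E F M G} (χ : 𝒢.AdaptedChart)

/-- The coordinates along the fibres of the source map. -/
def vert (p : G) : Fin 𝒢.rank → ℝ := (χ.equiv (χ.dom p)).2

/-- The arrow with given source and given coordinates along the fibres of the source map. -/
def point (y : M) (v : Fin 𝒢.rank → ℝ) : G := χ.dom.symm (χ.equiv.symm (χ.cod y, v))

lemma equiv_dom {p : G} (hp : p ∈ χ.dom.source) :
    χ.equiv (χ.dom p) = (χ.cod (𝒢.src p), χ.vert p) :=
  Prod.ext (χ.fst_equiv p hp) rfl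

lemma point_src_vert {p : G} (hp : p ∈ χ.dom.source) : χ.point (𝒢.src p) (χ.vert p) = p := by
  rw [point, ← χ.equiv_dom hp, ContinuousLinearEquiv.symm_apply_apply, χ.dom.left_inv hp]

/-- Where it is defined, `point y v` is an arrow with source `y`. -/
lemma src_point {y : M} (hy : y ∈ χ.cod.source) {v : Fin 𝒢.rank → ℝ}
    (h : χ.equiv.symm (χ.cod y, v) ∈ χ.dom.target) : 𝒢.src (χ.point y v) = y := by
  have h1 : χ.point y v ∈ χ.dom.source := χ.dom.map_target h
  have h2 := χ.fst_equiv _ h1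
  rw [point, χ.dom.right_inv h, ContinuousLinearEquiv.apply_symm_apply] at h2
  exact χ.cod.injOn (χ.src_mem _ h1) hy h2.symm

variable [IsManifold 𝓘(ℝ, E) ∞ M] [IsManifold 𝓘(ℝ, F) ∞ G]

lemma contMDiffOn_dom : ContMDiffOn 𝓘(ℝ, F) 𝓘(ℝ, F) ∞ χ.dom χ.dom.source :=
  contMDiffOn_of_mem_maximalAtlas χ.dom_mem

lemma contMDiffOn_dom_symm : ContMDiffOn 𝓘(ℝ, F) 𝓘(ℝ, F) ∞ χ.dom.symm χ.dom.target :=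
  contMDiffOn_symm_of_mem_maximalAtlas χ.dom_mem

lemma contMDiffOn_cod : ContMDiffOn 𝓘(ℝ, E) 𝓘(ℝ, E) ∞ χ.cod χ.cod.source :=
  contMDiffOn_of_mem_maximalAtlas χ.cod_mem

lemma contMDiffOn_vert : ContMDiffOn 𝓘(ℝ, F) 𝓘(ℝ, Fin 𝒢.rank → ℝ) ∞ χ.vert χ.dom.source := by
  have h : ContDiff ℝ ∞ (fun u : F => (χ.equiv u).2) := contDiff_snd.comp χ.equiv.contDiff
  exact h.contMDiff.comp_contMDiffOn χ.contMDiffOn_dom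

lemma mdifferentiableAt_dom {p : G} (hp : p ∈ χ.dom.source) :
    MDifferentiableAt 𝓘(ℝ, F) 𝓘(ℝ, F) χ.dom p :=
  (χ.contMDiffOn_dom.contMDiffAt (χ.dom.open_source.mem_nhds hp)).mdifferentiableAt (by simp)

lemma mdifferentiableAt_cod {y : M} (hy : y ∈ χ.cod.source) :
    MDifferentiableAt 𝓘(ℝ, E) 𝓘(ℝ, E) χ.cod y :=
  (χ.contMDiffOn_cod.contMDiffAt (χ.cod.open_source.mem_nhds hy)).mdifferentiableAt (by simp)

lemma mdifferentiableAt_dom_symm {u : F} (hu : u ∈ χ.dom.target) :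
    MDifferentiableAt 𝓘(ℝ, F) 𝓘(ℝ, F) χ.dom.symm u :=
  (χ.contMDiffOn_dom_symm.contMDiffAt (χ.dom.open_target.mem_nhds hu)).mdifferentiableAt (by simp)

/-- In an adapted chart, the differential of the source map is a projection. -/
lemma equiv_mdiff_dom {p : G} (hp : p ∈ χ.dom.source) (u : F) :
    χ.equiv (mdiff F F χ.dom p u) =
      (mdiff E E χ.cod (𝒢.src p) (mdiff F E 𝒢.src p u),
        mdiff F (Fin 𝒢.rank → ℝ) χ.vert p u) := by
  have hd := χ.mdifferentiableAt_dom hp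
  have h1 : MDifferentiableAt 𝓘(ℝ, F) 𝓘(ℝ, E) (fun w : F => (χ.equiv w).1) (χ.dom p) :=
    (differentiableAt_fst.comp _ χ.equiv.differentiableAt).mdifferentiableAt
  have h2 : MDifferentiableAt 𝓘(ℝ, F) 𝓘(ℝ, Fin 𝒢.rank → ℝ) (fun w : F => (χ.equiv w).2)
      (χ.dom p) :=
    (differentiableAt_snd.comp _ χ.equiv.differentiableAt).mdifferentiableAt
  have e1 : mdiff F E (fun w : F => (χ.equiv w).1) (χ.dom p) =
      (ContinuousLinearMap.fst ℝ E _).comp χ.equiv.toContinuousLinearMap := by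
    rw [mdiff_eq_fderiv]
    exact ((ContinuousLinearMap.fst ℝ E _).comp χ.equiv.toContinuousLinearMap).fderiv
  have e2 : mdiff F (Fin 𝒢.rank → ℝ) (fun w : F => (χ.equiv w).2) (χ.dom p) =
      (ContinuousLinearMap.snd ℝ E _).comp χ.equiv.toContinuousLinearMap := by
    rw [mdiff_eq_fderiv]
    exact ((ContinuousLinearMap.snd ℝ E _).comp χ.equiv.toContinuousLinearMap).fderiv
  have c1 := mdiff_comp (f := χ.dom) h1 hd
  have c2 := mdiff_comp (f := χ.dom) h2 hd
  have hev : (fun w : F => (χ.equiv w).1) ∘ χ.dom =ᶠ[nhds p] χ.cod ∘ 𝒢.src := by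
    filter_upwards [χ.dom.open_source.mem_nhds hp] with q hq
    exact χ.fst_equiv q hq
  rw [mdiff_congr hev, mdiff_comp (χ.mdifferentiableAt_cod (χ.src_mem p hp))
    ((𝒢.contMDiff_src p).mdifferentiableAt (by simp)), e1] at c1
  rw [e2] at c2
  refine Prod.ext ?_ ?_
  · exact (DFunLike.congr_fun c1 u).symm
  · exact (DFunLike.congr_fun c2 u).symm

lemma mdiff_dom_symm {p : G} (hp : p ∈ χ.dom.source) (u : F) :
    mdiff F F χ.dom.symm (χ.dom p) (mdiff F F χ.dom p u) = u :=
  mdiff_symm_mdiff χ.dom_mem hp u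

end AdaptedChart

variable [FiniteDimensional ℝ E] [FiniteDimensional ℝ F]
  [IsManifold 𝓘(ℝ, E) ∞ M] [IsManifold 𝓘(ℝ, F) ∞ G] (𝒢 : LieGroupoid E F M G)

/-- Curves of objects can be lifted along the source map, with prescribed initial velocity. -/
lemma exists_lift_velocity {η : ℝ → M} {g : G} {u : F}
    (hη : HasVelocity η (𝒢.src g) (mdiff F E 𝒢.src g u)) :
    ∃ γ : ℝ → G, HasVelocity γ g u ∧ ∀ t, 𝒢.src (γ t) = η t := by
  classical
  obtain ⟨χ, hg⟩ := 𝒢.exists_adaptedChart g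
  -- In an adapted chart, lift `η` and move along the fibres of the source map with constant speed.
  set c := mdiff F (Fin 𝒢.rank → ℝ) χ.vert g u
  have hy := χ.src_mem g hg
  let β : ℝ → F := fun t => χ.equiv.symm (χ.cod (η t), χ.vert g + t • c)
  have hβ0 : β 0 = χ.dom g := by
    simp only [β, hη.1, zero_smul, add_zero, ← χ.equiv_dom hg,
      ContinuousLinearEquiv.symm_apply_apply]
  have hβ : HasVelocity β (χ.dom g) (mdiff F F χ.dom g u) := by
    apply HasVelocity.of_hasDerivAt hβ0
    have h1 := (hη.comp (χ.mdifferentiableAt_cod hy)).hasDerivAt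
    have h2 : HasDerivAt (fun t : ℝ => χ.vert g + t • c) c 0 := by
      simpa using ((hasDerivAt_id (0 : ℝ)).smul_const c).const_add (χ.vert g)
    have h3 := (χ.equiv.symm.toContinuousLinearMap.hasFDerivAt).comp_hasDerivAt (0 : ℝ)
      (h1.prodMk h2)
    rw [← χ.equiv_mdiff_dom hg] at h3
    have h4 : HasDerivAt β (χ.equiv.symm (χ.equiv (mdiff F F χ.dom g u))) 0 := h3
    rwa [ContinuousLinearEquiv.symm_apply_apply] at h4
  have hdt := χ.dom.map_source hg
  have hγ := hβ.comp (χ.mdifferentiableAt_dom_symm hdt)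
  rw [χ.dom.left_inv hg, χ.mdiff_dom_symm hg] at hγ
  let γ : ℝ → G := fun t => χ.dom.symm (β t)
  have hev : ∀ᶠ t in nhds 0, 𝒢.src (γ t) = η t := by
    have e1 : ∀ᶠ t in nhds 0, η t ∈ χ.cod.source :=
      hη.continuousAt.eventually (χ.cod.open_source.mem_nhds (by rwa [hη.1]))
    have e2 : ∀ᶠ t in nhds 0, β t ∈ χ.dom.target :=
      hβ.continuousAt.eventually (χ.dom.open_target.mem_nhds (by rwa [hβ0]))
    filter_upwards [e1, e2] with t h1 h2
    exact χ.src_point h1 h2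
  -- Away from time `0` the lift may leave the chart, and is replaced by units there.
  refine ⟨fun t => if 𝒢.src (γ t) = η t then γ t else 𝒢.one (η t), hγ.congr ?_, fun t => ?_⟩
  · filter_upwards [hev] with t ht
    rw [if_pos ht]
  · dsimp only
    split_ifs with h
    · exact h
    · exact 𝒢.src_one _

end LieGroupoid

/-! ### The linear groupoid structure of the tangent bundle -/

namespace LieGroupoid

variable {E F M G : Type*}
  [NormedAddCommGroup E] [NormedSpace ℝ E] [NormedAddCommGroup F] [NormedSpace ℝ F]
  [TopologicalSpace M] [ChartedSpace E M] [TopologicalSpace G] [ChartedSpace F G]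

section Groupoid

variable (𝒢 : LieGroupoid E F M G)

lemma mul_right_cancel {g h k : G} (h₁ : 𝒢.src g = 𝒢.tgt k) (h₂ : 𝒢.src h = 𝒢.tgt k)
    (h₃ : 𝒢.mul g k = 𝒢.mul h k) : g = h := by
  rw [← 𝒢.mul_one g, ← 𝒢.mul_one h, h₁, h₂, ← 𝒢.mul_inv,
    ← 𝒢.mul_assoc _ _ _ h₁ (𝒢.tgt_inv k).symm, h₃, 𝒢.mul_assoc _ _ _ h₂ (𝒢.tgt_inv k).symm]

lemma inv_inv (g : G) : 𝒢.inv (𝒢.inv g) = g := by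
  apply 𝒢.mul_right_cancel (k := 𝒢.inv g) (𝒢.src_inv _) (𝒢.tgt_inv g).symm
  rw [𝒢.inv_mul, 𝒢.mul_inv, 𝒢.src_inv]

lemma inv_mul_rev {g h : G} (hgh : 𝒢.src g = 𝒢.tgt h) :
    𝒢.inv (𝒢.mul g h) = 𝒢.mul (𝒢.inv h) (𝒢.inv g) := by
  have e : 𝒢.src (𝒢.inv h) = 𝒢.tgt (𝒢.inv g) := by rw [𝒢.src_inv, 𝒢.tgt_inv, hgh]
  apply 𝒢.mul_right_cancel (k := 𝒢.mul g h) (𝒢.src_inv _)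
  · rw [𝒢.src_mul _ _ e, 𝒢.src_inv, 𝒢.tgt_mul _ _ hgh]
  · rw [𝒢.inv_mul, 𝒢.src_mul _ _ hgh,
      𝒢.mul_assoc _ _ _ e (by rw [𝒢.src_inv, 𝒢.tgt_mul _ _ hgh]),
      ← 𝒢.mul_assoc (𝒢.inv g) g h (𝒢.src_inv g) hgh, 𝒢.inv_mul, hgh, 𝒢.one_mul, 𝒢.inv_mul]

end Groupoid

/-- The differential of the product at a composable pair, extended in some way from the tangent
space of the fibred product. -/
def dmul (𝒢 : LieGroupoid E F M G) (g h : G) : F × F →L[ℝ] F :=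
  mfderivWithin (𝓘(ℝ, F).prod 𝓘(ℝ, F)) 𝓘(ℝ, F) (fun p : G × G => 𝒢.mul p.1 p.2)
    {p | 𝒢.src p.1 = 𝒢.tgt p.2} (g, h)

/-- The inclusion of the fibre of the Lie algebroid at `x` into the model space of the arrows. -/
def algebroidIncl (𝒢 : LieGroupoid E F M G) (x : M) : 𝒢.algebroidFiber x →ₗ[ℝ] F :=
  (𝒢.algebroidFiber x).subtype

/-- Right translation by `g` on the fibre of the Lie algebroid at `y = tgt g`, as a linear map into
the model space. -/
def translateRight (𝒢 : LieGroupoid E F M G) (y : M) (g : G) : 𝒢.algebroidFiber y →ₗ[ℝ] F :=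
  (𝒢.rightTranslation y g).toLinearMap ∘ₗ (𝒢.algebroidFiber y).subtype

/-- The map `a ↦ g a⁻¹` on the fibre of the Lie algebroid at `x = src g`: the differential of
`p ↦ (p g⁻¹)⁻¹`. -/
def translateInv (𝒢 : LieGroupoid E F M G) (x : M) (g : G) : 𝒢.algebroidFiber x →ₗ[ℝ] F :=
  (mdiff F F 𝒢.inv (𝒢.inv g)).toLinearMap ∘ₗ 𝒢.translateRight x (𝒢.inv g)

/-- The differential of the product is determined on velocities of composable curves: the product
is only smooth on the set of composable pairs. -/
lemma _root_.HasVelocity.mul (𝒢 : LieGroupoid E F M G) {γ η : ℝ → G} {g h : G} {u v : F}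
    (hγ : HasVelocity γ g u) (hη : HasVelocity η h v) (hc : ∀ t, 𝒢.src (γ t) = 𝒢.tgt (η t)) :
    HasVelocity (fun t => 𝒢.mul (γ t) (η t)) (𝒢.mul g h) (𝒢.dmul g h (u, v)) := by
  obtain ⟨h1, h2, h3, h4⟩ := hγ.prodMk hη
  subst h1 h2
  have hm := (𝒢.contMDiffOn_mul (γ 0, η 0) (hc 0)).mdifferentiableWithinAt (by simp)
  have hS : Set.univ ⊆ (fun t => (γ t, η t)) ⁻¹' {p : G × G | 𝒢.src p.1 = 𝒢.tgt p.2} :=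
    fun t _ => hc t
  refine ⟨rfl, mdifferentiableWithinAt_univ.1
    (hm.comp (0 : ℝ) h3.mdifferentiableWithinAt hS), ?_⟩
  have h5 := mfderivWithin_comp (0 : ℝ) hm h3.mdifferentiableWithinAt hS
    (uniqueMDiffWithinAt_univ _)
  rw [mfderivWithin_univ, mfderivWithin_univ] at h5
  rw [← h4]
  exact DFunLike.congr_fun h5 (1 : ℝ)

lemma mdifferentiableAt_src (𝒢 : LieGroupoid E F M G) (g : G) :
    MDifferentiableAt 𝓘(ℝ, F) 𝓘(ℝ, E) 𝒢.src g := (𝒢.contMDiff_src g).mdifferentiableAt (by simp)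

lemma mdifferentiableAt_tgt (𝒢 : LieGroupoid E F M G) (g : G) :
    MDifferentiableAt 𝓘(ℝ, F) 𝓘(ℝ, E) 𝒢.tgt g := (𝒢.contMDiff_tgt g).mdifferentiableAt (by simp)

lemma mdifferentiableAt_inv (𝒢 : LieGroupoid E F M G) (g : G) :
    MDifferentiableAt 𝓘(ℝ, F) 𝓘(ℝ, F) 𝒢.inv g := (𝒢.contMDiff_inv g).mdifferentiableAt (by simp)

variable [FiniteDimensional ℝ E] [FiniteDimensional ℝ F]
  [IsManifold 𝓘(ℝ, E) ∞ M] [IsManifold 𝓘(ℝ, F) ∞ G] (𝒢 : LieGroupoid E F M G)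

/-- Every tangent vector is the velocity of a curve. -/
lemma exists_curve (𝒢 : LieGroupoid E F M G) (g : G) (u : F) : ∃ γ : ℝ → G, HasVelocity γ g u := by
  obtain ⟨χ, hg⟩ := 𝒢.exists_adaptedChart g
  have h1 : HasVelocity (fun t : ℝ => χ.dom g + t • mdiff F F χ.dom g u) (χ.dom g)
      (mdiff F F χ.dom g u) :=
    HasVelocity.of_hasDerivAt (by simp) (by
      simpa using ((hasDerivAt_id (0 : ℝ)).smul_const (mdiff F F χ.dom g u)).const_add (χ.dom g))
  have h2 := h1.comp (χ.mdifferentiableAt_dom_symm (χ.dom.map_source hg))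
  rw [χ.dom.left_inv hg, χ.mdiff_dom_symm hg] at h2
  exact ⟨_, h2⟩

/-- Elements of the Lie algebroid are the velocities of curves in the fibres of the source map. -/
lemma exists_algebroid_curve {x : M} (a : 𝒢.algebroidFiber x) :
    ∃ γ : ℝ → G, HasVelocity γ (𝒢.one x) (𝒢.algebroidIncl x a) ∧ ∀ t, 𝒢.src (γ t) = x := by
  have ha : mdiff F E 𝒢.src (𝒢.one x) (𝒢.algebroidIncl x a) = 0 := a.2
  have := HasVelocity.const (H := E) (𝒢.src (𝒢.one x))
  rw [← ha] at this
  obtain ⟨γ, h1, h2⟩ := 𝒢.exists_lift_velocity this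
  exact ⟨γ, h1, fun t => (h2 t).trans (𝒢.src_one x)⟩

variable {𝒢}

/-- If `a` is the velocity of `γ`, its right translate is the velocity of `γ(t) g`. -/
lemma _root_.HasVelocity.translateRight {γ : ℝ → G} {y : M} {g : G} {a : 𝒢.algebroidFiber y}
    (hγ : HasVelocity γ (𝒢.one y) (𝒢.algebroidIncl y a)) (hs : ∀ t, 𝒢.src (γ t) = y)
    (hg : 𝒢.tgt g = y) :
    HasVelocity (fun t => 𝒢.mul (γ t) g) g (𝒢.translateRight y g a) := by
  subst hg
  have hm : MDifferentiableWithinAt 𝓘(ℝ, F) 𝓘(ℝ, F) (fun h => 𝒢.mul h g) (𝒢.src ⁻¹' {𝒢.tgt g})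
      (𝒢.one (𝒢.tgt g)) := by
    have h1 := (𝒢.contMDiffOn_mul (𝒢.one (𝒢.tgt g), g)
      (𝒢.src_one _)).mdifferentiableWithinAt (by simp)
    have h2 : MDifferentiableWithinAt 𝓘(ℝ, F) (𝓘(ℝ, F).prod 𝓘(ℝ, F)) (fun h : G => (h, g))
      (𝒢.src ⁻¹' {𝒢.tgt g}) (𝒢.one (𝒢.tgt g)) :=
      mdifferentiableWithinAt_id.prodMk mdifferentiableWithinAt_const
    have hS : 𝒢.src ⁻¹' {𝒢.tgt g} ⊆ (fun h => (h, g)) ⁻¹' {p : G × G | 𝒢.src p.1 = 𝒢.tgt p.2} :=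
      fun h hh => hh
    exact h1.comp (𝒢.one (𝒢.tgt g)) h2 hS
  have := hγ.comp_within hm hs
  rw [𝒢.one_mul] at this
  exact this

/-- If `a` is the velocity of `γ`, its inverted translate is the velocity of `g γ(t)⁻¹`. -/
lemma _root_.HasVelocity.translateInv {γ : ℝ → G} {x : M} {g : G} {a : 𝒢.algebroidFiber x}
    (hγ : HasVelocity γ (𝒢.one x) (𝒢.algebroidIncl x a)) (hs : ∀ t, 𝒢.src (γ t) = x)
    (hg : 𝒢.src g = x) :
    HasVelocity (fun t => 𝒢.mul g (𝒢.inv (γ t))) g (𝒢.translateInv x g a) := by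
  have h1 := hγ.translateRight hs (g := 𝒢.inv g) (by rw [𝒢.tgt_inv, hg])
  have h2 := h1.comp (𝒢.mdifferentiableAt_inv (𝒢.inv g))
  rw [𝒢.inv_inv] at h2
  have h3 : (fun t => 𝒢.inv (𝒢.mul (γ t) (𝒢.inv g))) = fun t => 𝒢.mul g (𝒢.inv (γ t)) := by
    funext t
    rw [𝒢.inv_mul_rev (by rw [hs, 𝒢.tgt_inv, hg]), 𝒢.inv_inv]
  rw [h3] at h2
  exact h2

variable {x y z : M} {g h : G}

lemma mdiff_src_translateRight (hg : 𝒢.tgt g = y) (a : 𝒢.algebroidFiber y) :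
    mdiff F E 𝒢.src g (𝒢.translateRight y g a) = 0 := by
  obtain ⟨γ, h1, h2⟩ := 𝒢.exists_algebroid_curve a
  refine ((h1.translateRight h2 hg).comp (𝒢.mdifferentiableAt_src g)).unique
    ((HasVelocity.const (H := E) (𝒢.src g)).congr (Filter.Eventually.of_forall fun t => ?_))
  exact 𝒢.src_mul _ _ (by rw [h2, hg])

lemma mdiff_tgt_translateRight (hg : 𝒢.tgt g = y) (a : 𝒢.algebroidFiber y) :
    mdiff F E 𝒢.tgt g (𝒢.translateRight y g a) =
      mdiff F E 𝒢.tgt (𝒢.one y) (𝒢.algebroidIncl y a) := by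
  obtain ⟨γ, h1, h2⟩ := 𝒢.exists_algebroid_curve a
  have h3 := (h1.translateRight h2 hg).comp (𝒢.mdifferentiableAt_tgt g)
  have h4 := h1.comp (𝒢.mdifferentiableAt_tgt (𝒢.one y))
  refine h3.unique (h4.congr (Filter.Eventually.of_forall fun t => ?_))
  exact 𝒢.tgt_mul _ _ (by rw [h2, hg])

lemma mdiff_src_translateInv (hg : 𝒢.src g = x) (a : 𝒢.algebroidFiber x) :
    mdiff F E 𝒢.src g (𝒢.translateInv x g a) =
      mdiff F E 𝒢.tgt (𝒢.one x) (𝒢.algebroidIncl x a) := by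
  obtain ⟨γ, h1, h2⟩ := 𝒢.exists_algebroid_curve a
  have h3 := (h1.translateInv h2 hg).comp (𝒢.mdifferentiableAt_src g)
  have h4 := h1.comp (𝒢.mdifferentiableAt_tgt (𝒢.one x))
  refine h3.unique (h4.congr (Filter.Eventually.of_forall fun t => ?_))
  change 𝒢.src (𝒢.mul g (𝒢.inv (γ t))) = 𝒢.tgt (γ t)
  rw [𝒢.src_mul _ _ (by rw [𝒢.tgt_inv, h2, hg]), 𝒢.src_inv]

lemma mdiff_tgt_translateInv (hg : 𝒢.src g = x) (a : 𝒢.algebroidFiber x) :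
    mdiff F E 𝒢.tgt g (𝒢.translateInv x g a) = 0 := by
  obtain ⟨γ, h1, h2⟩ := 𝒢.exists_algebroid_curve a
  refine ((h1.translateInv h2 hg).comp (𝒢.mdifferentiableAt_tgt g)).unique
    ((HasVelocity.const (H := E) (𝒢.tgt g)).congr (Filter.Eventually.of_forall fun t => ?_))
  exact 𝒢.tgt_mul _ _ (by rw [𝒢.tgt_inv, h2, hg])

/-- The differential of `(p g) h = p (g h)` in `p`. -/
lemma dmul_translateRight_zero (hgh : 𝒢.src g = 𝒢.tgt h) (hg : 𝒢.tgt g = z)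
    (c : 𝒢.algebroidFiber z) :
    𝒢.dmul g h (𝒢.translateRight z g c, 0) = 𝒢.translateRight z (𝒢.mul g h) c := by
  obtain ⟨γ, h1, h2⟩ := 𝒢.exists_algebroid_curve c
  have e : ∀ t, 𝒢.src (γ t) = 𝒢.tgt g := fun t => by rw [h2, hg]
  have h3 := HasVelocity.mul 𝒢 (h1.translateRight h2 hg) (HasVelocity.const (H := F) h)
    fun t => by rw [𝒢.src_mul _ _ (e t), hgh]
  refine h3.unique ((h1.translateRight h2 (by rw [𝒢.tgt_mul _ _ hgh, hg])).congr
    (Filter.Eventually.of_forall fun t => ?_))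
  exact 𝒢.mul_assoc _ _ _ (e t) hgh

/-- Right translation by `g` is undone by right translation by `g⁻¹`. -/
lemma translateRight_injective (hg : 𝒢.tgt g = y) : Function.Injective (𝒢.translateRight y g) := by
  rw [← LinearMap.ker_eq_bot, LinearMap.ker_eq_bot']
  intro a ha
  have h1 := dmul_translateRight_zero (h := 𝒢.inv g) (𝒢.tgt_inv g).symm hg a
  rw [ha, 𝒢.mul_inv, hg] at h1
  have h2 : (0 : F) = 𝒢.translateRight y (𝒢.one y) a := by
    rw [← h1]
    exact (map_zero (𝒢.dmul g (𝒢.inv g))).symm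
  obtain ⟨γ, h3, h4⟩ := 𝒢.exists_algebroid_curve a
  have h5 := h3.translateRight h4 (𝒢.tgt_one y)
  rw [← h2] at h5
  have h6 : (0 : F) = 𝒢.algebroidIncl y a :=
    h5.unique (h3.congr (Filter.Eventually.of_forall fun t => by
      change 𝒢.mul (γ t) (𝒢.one y) = γ t
      rw [← h4 t, 𝒢.mul_one]))
  exact Subtype.ext h6.symm

/-- The differential of `g (h p⁻¹) = (g h) p⁻¹` in `p`. -/
lemma dmul_zero_translateInv (hgh : 𝒢.src g = 𝒢.tgt h) (hh : 𝒢.src h = x)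
    (a : 𝒢.algebroidFiber x) :
    𝒢.dmul g h (0, 𝒢.translateInv x h a) = 𝒢.translateInv x (𝒢.mul g h) a := by
  obtain ⟨γ, h1, h2⟩ := 𝒢.exists_algebroid_curve a
  have e : ∀ t, 𝒢.src h = 𝒢.tgt (𝒢.inv (γ t)) := fun t => by rw [𝒢.tgt_inv, h2, hh]
  have h3 := HasVelocity.mul 𝒢 (HasVelocity.const (H := F) g) (h1.translateInv h2 hh)
    fun t => by rw [𝒢.tgt_mul _ _ (e t), hgh]
  refine h3.unique ((h1.translateInv h2 (by rw [𝒢.src_mul _ _ hgh, hh])).congr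
    (Filter.Eventually.of_forall fun t => ?_))
  exact (𝒢.mul_assoc _ _ _ hgh (e t)).symm

/-- The differential of `(g p⁻¹) (p h) = g h` in `p`. -/
lemma dmul_translateInv_translateRight (hg : 𝒢.src g = y) (hh : 𝒢.tgt h = y)
    (b : 𝒢.algebroidFiber y) :
    𝒢.dmul g h (𝒢.translateInv y g b, 𝒢.translateRight y h b) = 0 := by
  obtain ⟨γ, h1, h2⟩ := 𝒢.exists_algebroid_curve b
  have e1 : ∀ t, 𝒢.src g = 𝒢.tgt (𝒢.inv (γ t)) := fun t => by rw [𝒢.tgt_inv, h2, hg]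
  have e2 : ∀ t, 𝒢.src (γ t) = 𝒢.tgt h := fun t => by rw [h2, hh]
  have h3 := HasVelocity.mul 𝒢 (h1.translateInv h2 hg) (h1.translateRight h2 hh)
    fun t => by rw [𝒢.src_mul _ _ (e1 t), 𝒢.tgt_mul _ _ (e2 t), 𝒢.src_inv]
  refine h3.unique ((HasVelocity.const (H := F) (𝒢.mul g h)).congr
    (Filter.Eventually.of_forall fun t => ?_))
  change 𝒢.mul (𝒢.mul g (𝒢.inv (γ t))) (𝒢.mul (γ t) h) = 𝒢.mul g h
  rw [𝒢.mul_assoc _ _ _ (e1 t) (by rw [𝒢.src_inv, 𝒢.tgt_mul _ _ (e2 t)]),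
    ← 𝒢.mul_assoc _ _ _ (𝒢.src_inv _) (e2 t), 𝒢.inv_mul, e2, 𝒢.one_mul]

/-- Every composable pair of tangent vectors is the velocity of a composable pair of curves. -/
lemma exists_composable_curves (hgh : 𝒢.src g = 𝒢.tgt h) {v w : F}
    (hvw : mdiff F E 𝒢.src g v = mdiff F E 𝒢.tgt h w) :
    ∃ γ η : ℝ → G, HasVelocity γ g v ∧ HasVelocity η h w ∧ ∀ t, 𝒢.src (γ t) = 𝒢.tgt (η t) := by
  obtain ⟨η, hη⟩ := 𝒢.exists_curve h w
  have h1 := hη.comp (𝒢.mdifferentiableAt_tgt h)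
  rw [← hvw, ← hgh] at h1
  obtain ⟨γ, h2, h3⟩ := 𝒢.exists_lift_velocity h1
  exact ⟨γ, η, h2, hη, h3⟩

lemma mdiff_src_dmul (hgh : 𝒢.src g = 𝒢.tgt h) {v w : F}
    (hvw : mdiff F E 𝒢.src g v = mdiff F E 𝒢.tgt h w) :
    mdiff F E 𝒢.src (𝒢.mul g h) (𝒢.dmul g h (v, w)) = mdiff F E 𝒢.src h w := by
  obtain ⟨γ, η, h1, h2, h3⟩ := exists_composable_curves hgh hvw
  have h4 := (HasVelocity.mul 𝒢 h1 h2 h3).comp (𝒢.mdifferentiableAt_src _)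
  refine h4.unique ((h2.comp (𝒢.mdifferentiableAt_src h)).congr
    (Filter.Eventually.of_forall fun t => 𝒢.src_mul _ _ (h3 t)))

lemma mdiff_tgt_dmul (hgh : 𝒢.src g = 𝒢.tgt h) {v w : F}
    (hvw : mdiff F E 𝒢.src g v = mdiff F E 𝒢.tgt h w) :
    mdiff F E 𝒢.tgt (𝒢.mul g h) (𝒢.dmul g h (v, w)) = mdiff F E 𝒢.tgt g v := by
  obtain ⟨γ, η, h1, h2, h3⟩ := exists_composable_curves hgh hvw
  have h4 := (HasVelocity.mul 𝒢 h1 h2 h3).comp (𝒢.mdifferentiableAt_tgt _)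
  refine h4.unique ((h1.comp (𝒢.mdifferentiableAt_tgt g)).congr
    (Filter.Eventually.of_forall fun t => 𝒢.tgt_mul _ _ (h3 t)))

end LieGroupoid

/-! ### Determinants of frames adapted to an exact sequence -/

section AdaptedFrames

variable {ι κ V U K : Type*} [Fintype ι] [Fintype κ] [DecidableEq ι] [DecidableEq κ]
  [AddCommGroup V] [Module ℝ V] [AddCommGroup U] [Module ℝ U] [AddCommGroup K] [Module ℝ K]
  (A : Basis (ι ⊕ κ) ℝ V) {R : K →ₗ[ℝ] V} {L : V →ₗ[ℝ] U}

/-- For an exact sequence `0 → K → V → U → 0`, a basis of `K` and lifts of a basis of `U` form a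
basis of `V`. The basis `A` only ensures that the dimensions match, that is, exactness at `V`. -/
lemma Module.Basis.exists_basis_sumElim (A : Basis (ι ⊕ κ) ℝ V) (hR : Function.Injective R)
    (hLR : ∀ a, L (R a) = 0) (b : Basis ι ℝ K) (ε : Basis κ ℝ U) {w : κ → V}
    (hw : ∀ j, L (w j) = ε j) :
    ∃ B : Basis (ι ⊕ κ) ℝ V, ⇑B = Sum.elim (fun i => R (b i)) w := by
  have hli : LinearIndependent ℝ (Sum.elim (fun i => R (b i)) w) := by
    rw [Fintype.linearIndependent_iff]
    intro c hc
    rw [Fintype.sum_sum_type] at hc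
    simp only [Sum.elim_inl, Sum.elim_inr] at hc
    have h1 := congrArg L hc
    simp only [map_add, map_sum, map_smul, hLR, smul_zero, Finset.sum_const_zero, zero_add, hw,
      map_zero] at h1
    have h2 := Fintype.linearIndependent_iff.1 ε.linearIndependent _ h1
    simp only [h2, zero_smul, Finset.sum_const_zero, add_zero] at hc
    have h3 : R (∑ i, c (Sum.inl i) • b i) = R 0 := by simpa using hc
    have h4 := Fintype.linearIndependent_iff.1 b.linearIndependent _ (hR h3)
    rintro (i | j)
    · exact h4 i
    · exact h2 j
  have : FiniteDimensional ℝ V := Module.Finite.of_basis A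
  exact ⟨basisOfLinearIndependentOfCardEqFinrank' _ hli (finrank_eq_card_basis A).symm,
    coe_basisOfLinearIndependentOfCardEqFinrank' _ hli _⟩

/-- For an exact sequence `0 → K → V → U → 0`, the determinant of the frame of `V` induced by
frames of `K` and `U` does not depend on the lifts, and transforms by the product of the
determinants. -/
lemma Module.Basis.det_sumElim_change (hR : Function.Injective R) (hLR : ∀ a, L (R a) = 0)
    (b b' : Basis ι ℝ K) (ε ε' : Basis κ ℝ U) {w w' : κ → V} (hw : ∀ j, L (w j) = ε j)
    (hw' : ∀ j, L (w' j) = ε' j) :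
    A.det (Sum.elim (fun i => R (b' i)) w') =
      A.det (Sum.elim (fun i => R (b i)) w) * (b.det b' * ε.det ε') := by
  obtain ⟨B, hB⟩ := A.exists_basis_sumElim hR hLR b ε hw
  have hl : ∀ i, B (Sum.inl i) = R (b i) := fun i => by rw [hB]; rfl
  have hr : ∀ j, B (Sum.inr j) = w j := fun j => by rw [hB]; rfl
  have h1 := B.det_sumElim_of_ker L ε (fun i => by rw [hl, hLR]) (fun j => by rw [hr, hw])
    (fun i => R (b' i)) (fun i => hLR _) w'
  have h2 : A.det (Sum.elim (fun i => R (b' i)) w') =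
      A.det B * B.det (Sum.elim (fun i => R (b' i)) w') :=
    DFunLike.congr_fun (AlternatingMap.eq_smul_basis_det B A.det) _
  have h3 : (Matrix.of fun i i' => B.repr (R (b' i')) (Sum.inl i)) = b.toMatrix b' := by
    ext i i'
    rw [Matrix.of_apply, Basis.toMatrix_apply]
    have : R (b' i') = ∑ i, b.repr (b' i') i • B (Sum.inl i) := by
      conv_lhs => rw [← b.sum_repr (b' i')]
      simp only [map_sum, map_smul, hl]
    rw [this]
    simp [Finsupp.single_apply]
  rw [h2, hB, h1, h3, b.det_apply]
  simp only [hw']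

lemma Module.Basis.det_sumElim_ne_zero (hR : Function.Injective R) (hLR : ∀ a, L (R a) = 0)
    (b : Basis ι ℝ K) (ε : Basis κ ℝ U) {w : κ → V} (hw : ∀ j, L (w j) = ε j) :
    A.det (Sum.elim (fun i => R (b i)) w) ≠ 0 := by
  obtain ⟨B, hB⟩ := A.exists_basis_sumElim hR hLR b ε hw
  rw [← hB]
  exact (A.isUnit_det B).ne_zero

/-- The determinant of a family that agrees with a basis in its second part is the determinant of
the coefficients of its first part, by block triangularity. -/
lemma Module.Basis.det_sumElim_right (B : Basis (ι ⊕ κ) ℝ V) {u : ι → V} {w : κ → V}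
    (hw : ∀ j, B (Sum.inr j) = w j) (C : Matrix ι ι ℝ) (D : κ → ι → ℝ)
    (hu : ∀ i, u i = ∑ j, C j i • B (Sum.inl j) + ∑ l, D l i • B (Sum.inr l)) :
    B.det (Sum.elim u w) = C.det := by
  have hM : B.toMatrix (Sum.elim u w) =
      Matrix.fromBlocks C 0 (Matrix.of D) 1 := by
    ext (i | i) (j | j)
    · simp [Basis.toMatrix_apply, hu, Finsupp.single_apply]
    · simp [Basis.toMatrix_apply, ← hw]
    · simp [Basis.toMatrix_apply, hu, Finsupp.single_apply]
    · simp [Basis.toMatrix_apply, ← hw, Matrix.one_apply, Finsupp.single_apply, eq_comm]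
  rw [Basis.det_apply, hM, Matrix.det_fromBlocks_zero₁₂, Matrix.det_one, mul_one]

end AdaptedFrames

/-! ### The exchange determinant -/

namespace LieGroupoid

variable {E F M G : Type*}
  [NormedAddCommGroup E] [NormedSpace ℝ E] [NormedAddCommGroup F] [NormedSpace ℝ F]
  [TopologicalSpace M] [ChartedSpace E M] [TopologicalSpace G] [ChartedSpace F G]
  [FiniteDimensional ℝ E] [FiniteDimensional ℝ F]
  [IsManifold 𝓘(ℝ, E) ∞ M] [IsManifold 𝓘(ℝ, F) ∞ G] (𝒢 : LieGroupoid E F M G)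

/-- The determinant `exchangeDet`, for frames at points `x` and `y` that are the source and the
target of `g` only up to a propositional equality. -/
def exchangeDetAt (g : G) {x y : M}
    (a : Basis (Fin 𝒢.rank) ℝ (𝒢.algebroidFiber x))
    (f : Basis (Fin (finrank ℝ E)) ℝ (TangentSpace 𝓘(ℝ, E) x))
    (b : Basis (Fin 𝒢.rank) ℝ (𝒢.algebroidFiber y))
    (h : Basis (Fin (finrank ℝ E)) ℝ (TangentSpace 𝓘(ℝ, E) y)) : ℝ :=
  (𝒢.someArrowFrame g).det (fun i =>
      (mfderiv 𝓘(ℝ, F) 𝓘(ℝ, F) 𝒢.inv (𝒢.inv g) (𝒢.adaptedFrame (𝒢.inv g) a h i) : F)) /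
    (𝒢.someArrowFrame g).det (𝒢.adaptedFrame g b f)

/-- A frame of `T_x M`, as a basis of the model space. -/
def modelFrame {x : M} (f : Basis (Fin (finrank ℝ E)) ℝ (TangentSpace 𝓘(ℝ, E) x)) :
    Basis (Fin (finrank ℝ E)) ℝ E := f

/-- An auxiliary frame of `T_g G`, as a basis of the model space. -/
def arrowFrame (g : G) : Basis (Fin 𝒢.rank ⊕ Fin (finrank ℝ E)) ℝ F := 𝒢.someArrowFrame g

variable {𝒢} {x y z : M} {g h : G}

lemma mdiff_tgt_mdiff_inv (g : G) (u : F) :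
    mdiff F E 𝒢.tgt g (mdiff F F 𝒢.inv (𝒢.inv g) u) = mdiff F E 𝒢.src (𝒢.inv g) u := by
  have h1 := mdiff_comp (f := 𝒢.inv) (p := 𝒢.inv g) (𝒢.mdifferentiableAt_tgt _)
    (𝒢.mdifferentiableAt_inv _)
  rw [𝒢.inv_inv, show 𝒢.tgt ∘ 𝒢.inv = 𝒢.src from funext fun g => 𝒢.tgt_inv g] at h1
  exact (DFunLike.congr_fun h1 u).symm

lemma mdiff_inv_mdiff_inv (g : G) (u : F) :
    mdiff F F 𝒢.inv g (mdiff F F 𝒢.inv (𝒢.inv g) u) = u := by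
  have h1 := mdiff_comp (f := 𝒢.inv) (p := 𝒢.inv g) (𝒢.mdifferentiableAt_inv _)
    (𝒢.mdifferentiableAt_inv _)
  rw [𝒢.inv_inv, show 𝒢.inv ∘ 𝒢.inv = id from funext fun g => 𝒢.inv_inv g] at h1
  have hid : mdiff F F (id : G → G) (𝒢.inv g) = ContinuousLinearMap.id ℝ F := mfderiv_id
  rw [hid] at h1
  exact (DFunLike.congr_fun h1 u).symm

lemma translateInv_injective (hg : 𝒢.src g = x) : Function.Injective (𝒢.translateInv x g) := by
  have h1 : Function.Injective (mdiff F F 𝒢.inv (𝒢.inv g)) :=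
    Function.LeftInverse.injective (mdiff_inv_mdiff_inv g)
  exact h1.comp (translateRight_injective (by rw [𝒢.tgt_inv, hg]))

lemma mdiff_src_srcLift (g : G) (w : E) :
    mdiff F E 𝒢.src g (𝒢.srcLift g (x := x) w : F) = w :=
  Function.invFun_eq (𝒢.surjective_mfderiv_src g w)

lemma mdiff_src_surjective (g : G) : Function.Surjective (mdiff F E 𝒢.src g) :=
  𝒢.surjective_mfderiv_src g

lemma mdiff_tgt_surjective (g : G) : Function.Surjective (mdiff F E 𝒢.tgt g) := by
  intro w
  obtain ⟨u, hu⟩ := mdiff_src_surjective (𝒢 := 𝒢) (𝒢.inv g) w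
  exact ⟨_, (mdiff_tgt_mdiff_inv g u).trans hu⟩

/-- The exchange determinant can be computed with arbitrary lifts. -/
lemma exchangeDetAt_eq_div (hx : 𝒢.src g = x) (hy : 𝒢.tgt g = y)
    (A : Basis (Fin 𝒢.rank ⊕ Fin (finrank ℝ E)) ℝ F)
    (a : Basis (Fin 𝒢.rank) ℝ (𝒢.algebroidFiber x))
    (f : Basis (Fin (finrank ℝ E)) ℝ (TangentSpace 𝓘(ℝ, E) x))
    (b : Basis (Fin 𝒢.rank) ℝ (𝒢.algebroidFiber y))
    (h : Basis (Fin (finrank ℝ E)) ℝ (TangentSpace 𝓘(ℝ, E) y))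
    {w w' : Fin (finrank ℝ E) → F} (hw : ∀ j, mdiff F E 𝒢.src g (w j) = modelFrame f j)
    (hw' : ∀ j, mdiff F E 𝒢.tgt g (w' j) = modelFrame h j) :
    𝒢.exchangeDetAt g a f b h = A.det (Sum.elim (fun i => 𝒢.translateInv x g (a i)) w') /
      A.det (Sum.elim (fun i => 𝒢.translateRight y g (b i)) w) := by
  have e1 : (fun i => (mfderiv 𝓘(ℝ, F) 𝓘(ℝ, F) 𝒢.inv (𝒢.inv g)
      (𝒢.adaptedFrame (𝒢.inv g) a h i) : F)) =
      Sum.elim (fun i => 𝒢.translateInv x g (a i)) (fun j => mdiff F F 𝒢.inv (𝒢.inv g)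
        (𝒢.srcLift (𝒢.inv g) (x := y) (modelFrame h j))) := by
    funext i
    rcases i with i | j <;> rfl
  have e2 : 𝒢.adaptedFrame g b f = Sum.elim (fun i => 𝒢.translateRight y g (b i))
      (fun j => (𝒢.srcLift g (x := x) (modelFrame f j) : F)) := rfl
  have h1 := (𝒢.arrowFrame g).det_sumElim_change (L := (mdiff F E 𝒢.tgt g).toLinearMap)
    (translateInv_injective hx) (mdiff_tgt_translateInv hx) a a (modelFrame h) (modelFrame h) hw'
    (w' := fun j => mdiff F F 𝒢.inv (𝒢.inv g) (𝒢.srcLift (𝒢.inv g) (x := y) (modelFrame h j)))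
    (fun j => (mdiff_tgt_mdiff_inv g _).trans (mdiff_src_srcLift _ _))
  have h2 := (𝒢.arrowFrame g).det_sumElim_change (L := (mdiff F E 𝒢.src g).toLinearMap)
    (translateRight_injective hy) (mdiff_src_translateRight hy) b b (modelFrame f) (modelFrame f) hw
    (w' := fun j => (𝒢.srcLift g (x := x) (modelFrame f j) : F))
    (fun j => mdiff_src_srcLift _ _)
  rw [Basis.det_self, Basis.det_self, _root_.mul_one, _root_.mul_one] at h1 h2
  have h3 := A.det_sumElim_ne_zero (L := (mdiff F E 𝒢.src g).toLinearMap)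
    (translateRight_injective hy) (mdiff_src_translateRight hy) b (modelFrame f) hw
  have h4 := (𝒢.arrowFrame g).det_sumElim_ne_zero (L := (mdiff F E 𝒢.src g).toLinearMap)
    (translateRight_injective hy) (mdiff_src_translateRight hy) b (modelFrame f) hw
  have key : 𝒢.exchangeDetAt g a f b h =
      (𝒢.arrowFrame g).det (Sum.elim (fun i => 𝒢.translateInv x g (a i)) w') /
      (𝒢.arrowFrame g).det (Sum.elim (fun i => 𝒢.translateRight y g (b i)) w) := by
    rw [← h1, ← h2, ← e1]
    rfl
  rw [key, AlternatingMap.eq_smul_basis_det A (𝒢.arrowFrame g).det, AlternatingMap.smul_apply,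
    AlternatingMap.smul_apply, smul_eq_mul, smul_eq_mul, mul_div_mul_left]
  exact ((𝒢.arrowFrame g).isUnit_det A).ne_zero

lemma exists_lift_src (g : G) (v : Fin (finrank ℝ E) → E) :
    ∃ w : Fin (finrank ℝ E) → F, ∀ j, mdiff F E 𝒢.src g (w j) = v j :=
  ⟨fun j => (mdiff_src_surjective g (v j)).choose,
    fun j => (mdiff_src_surjective g (v j)).choose_spec⟩

lemma exists_lift_tgt (g : G) (v : Fin (finrank ℝ E) → E) :
    ∃ w : Fin (finrank ℝ E) → F, ∀ j, mdiff F E 𝒢.tgt g (w j) = v j :=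
  ⟨fun j => (mdiff_tgt_surjective g (v j)).choose,
    fun j => (mdiff_tgt_surjective g (v j)).choose_spec⟩

lemma exchangeDetAt_change (hx : 𝒢.src g = x) (hy : 𝒢.tgt g = y)
    (a a' : Basis (Fin 𝒢.rank) ℝ (𝒢.algebroidFiber x))
    (f f' : Basis (Fin (finrank ℝ E)) ℝ (TangentSpace 𝓘(ℝ, E) x))
    (b b' : Basis (Fin 𝒢.rank) ℝ (𝒢.algebroidFiber y))
    (h h' : Basis (Fin (finrank ℝ E)) ℝ (TangentSpace 𝓘(ℝ, E) y)) :
    𝒢.exchangeDetAt g a' f' b' h' =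
      𝒢.exchangeDetAt g a f b h * (a.det a' * h.det h') / (b.det b' * f.det f') := by
  obtain ⟨w, hw⟩ := exists_lift_src (𝒢 := 𝒢) g (modelFrame f)
  obtain ⟨w₁, hw₁⟩ := exists_lift_src (𝒢 := 𝒢) g (modelFrame f')
  obtain ⟨w', hw'⟩ := exists_lift_tgt (𝒢 := 𝒢) g (modelFrame h)
  obtain ⟨w₁', hw₁'⟩ := exists_lift_tgt (𝒢 := 𝒢) g (modelFrame h')
  rw [exchangeDetAt_eq_div hx hy (𝒢.arrowFrame g) a f b h hw hw',
    exchangeDetAt_eq_div hx hy (𝒢.arrowFrame g) a' f' b' h' hw₁ hw₁',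
    (𝒢.arrowFrame g).det_sumElim_change (L := (mdiff F E 𝒢.tgt g).toLinearMap)
      (translateInv_injective hx) (mdiff_tgt_translateInv hx) a a' (modelFrame h) (modelFrame h')
      hw' hw₁',
    (𝒢.arrowFrame g).det_sumElim_change (L := (mdiff F E 𝒢.src g).toLinearMap)
      (translateRight_injective hy) (mdiff_src_translateRight hy) b b' (modelFrame f)
      (modelFrame f') hw hw₁, mul_div_mul_comm, ← mul_div_assoc]
  rfl

lemma exchangeDetAt_ne_zero (hx : 𝒢.src g = x) (hy : 𝒢.tgt g = y)
    (a : Basis (Fin 𝒢.rank) ℝ (𝒢.algebroidFiber x))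
    (f : Basis (Fin (finrank ℝ E)) ℝ (TangentSpace 𝓘(ℝ, E) x))
    (b : Basis (Fin 𝒢.rank) ℝ (𝒢.algebroidFiber y))
    (h : Basis (Fin (finrank ℝ E)) ℝ (TangentSpace 𝓘(ℝ, E) y)) :
    𝒢.exchangeDetAt g a f b h ≠ 0 := by
  obtain ⟨w, hw⟩ := exists_lift_src (𝒢 := 𝒢) g (modelFrame f)
  obtain ⟨w', hw'⟩ := exists_lift_tgt (𝒢 := 𝒢) g (modelFrame h)
  rw [exchangeDetAt_eq_div hx hy (𝒢.arrowFrame g) a f b h hw hw']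
  refine div_ne_zero ?_ ?_
  · exact (𝒢.arrowFrame g).det_sumElim_ne_zero (L := (mdiff F E 𝒢.tgt g).toLinearMap)
      (translateInv_injective hx) (mdiff_tgt_translateInv hx) a (modelFrame h) hw'
  · exact (𝒢.arrowFrame g).det_sumElim_ne_zero (L := (mdiff F E 𝒢.src g).toLinearMap)
      (translateRight_injective hy) (mdiff_src_translateRight hy) b (modelFrame f) hw

/-- With common lifts `w` of the frames of `T_x M` and `T_y M`, the exchange determinant is the
determinant of the matrix expressing `g a⁻¹` through `b g`, modulo `w`. -/
lemma exchangeDetAt_eq_det (hx : 𝒢.src g = x) (hy : 𝒢.tgt g = y)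
    (a : Basis (Fin 𝒢.rank) ℝ (𝒢.algebroidFiber x))
    (f : Basis (Fin (finrank ℝ E)) ℝ (TangentSpace 𝓘(ℝ, E) x))
    (b : Basis (Fin 𝒢.rank) ℝ (𝒢.algebroidFiber y))
    (h : Basis (Fin (finrank ℝ E)) ℝ (TangentSpace 𝓘(ℝ, E) y))
    {w : Fin (finrank ℝ E) → F} (hw : ∀ j, mdiff F E 𝒢.src g (w j) = modelFrame f j)
    (hw' : ∀ j, mdiff F E 𝒢.tgt g (w j) = modelFrame h j)
    (C : Matrix (Fin 𝒢.rank) (Fin 𝒢.rank) ℝ) (D : Fin (finrank ℝ E) → Fin 𝒢.rank → ℝ)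
    (hC : ∀ i, 𝒢.translateInv x g (a i) =
      ∑ j, C j i • 𝒢.translateRight y g (b j) + ∑ l, D l i • w l) :
    𝒢.exchangeDetAt g a f b h = C.det := by
  obtain ⟨B, hB⟩ := (𝒢.arrowFrame g).exists_basis_sumElim
    (L := (mdiff F E 𝒢.src g).toLinearMap) (translateRight_injective hy)
    (mdiff_src_translateRight hy) b (modelFrame f) hw
  have hl : ∀ i, B (Sum.inl i) = 𝒢.translateRight y g (b i) := fun i => by rw [hB]; rfl
  have hr : ∀ j, B (Sum.inr j) = w j := fun j => by rw [hB]; rfl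
  rw [exchangeDetAt_eq_div hx hy B a f b h hw hw', ← hB, B.det_self, div_one]
  exact B.det_sumElim_right hr C D fun i => by simp only [hl, hr, hC]

/-- Common lifts exist for some frames of `T_x M` and `T_y M`, and `g a⁻¹` can then be expressed
through `b g` and these lifts. -/
lemma exists_common_lift_frame (g : G) (hy : 𝒢.tgt g = y)
    (b : Basis (Fin 𝒢.rank) ℝ (𝒢.algebroidFiber y)) (f : Basis (Fin (finrank ℝ E)) ℝ E) :
    ∃ (h : Basis (Fin (finrank ℝ E)) ℝ E) (w : Fin (finrank ℝ E) → F),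
      (∀ j, mdiff F E 𝒢.src g (w j) = f j) ∧ (∀ j, mdiff F E 𝒢.tgt g (w j) = h j) ∧
      ∀ {κ : Type} (u : κ → F), ∃ (C : Fin 𝒢.rank → κ → ℝ) (D : Fin (finrank ℝ E) → κ → ℝ),
        ∀ i, u i = ∑ j, C j i • 𝒢.translateRight y g (b j) + ∑ l, D l i • w l := by
  obtain ⟨q, hq₁, hq₂⟩ := LinearMap.exists_common_lift (mdiff F E 𝒢.src g).toLinearMap
    (mdiff F E 𝒢.tgt g).toLinearMap (mdiff_src_surjective g) (mdiff_tgt_surjective g)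
  let e₁ := LinearEquiv.ofBijective _ hq₁
  let e₂ := LinearEquiv.ofBijective _ hq₂
  have hw : ∀ j, mdiff F E 𝒢.src g (q (e₁.symm (f j))) = f j := fun j => e₁.apply_symm_apply _
  obtain ⟨B, hB⟩ := (𝒢.arrowFrame g).exists_basis_sumElim
    (L := (mdiff F E 𝒢.src g).toLinearMap) (translateRight_injective hy)
    (mdiff_src_translateRight hy) b f hw
  refine ⟨(f.map e₁.symm).map e₂, fun j => q (e₁.symm (f j)), hw, fun j => rfl, fun u => ?_⟩
  refine ⟨fun j i => B.repr (u i) (Sum.inl j), fun l i => B.repr (u i) (Sum.inr l), fun i => ?_⟩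
  conv_lhs => rw [← B.sum_repr (u i), Fintype.sum_sum_type, hB]
  rfl

/-- The product of the exchange determinants of `g` and `h`, when common lifts `w` over `h` of the
frames at `x` and `y` and common lifts `v` over `g` of the frames at `y` and `z` are given. The
products of `v` and `w` are then common lifts over `g h`, and if the matrices for `g` and `h` are
`C'` and `C`, the matrix for `g h` is `-C' C`, whence the sign. -/
lemma exchangeDetAt_mul_of_lifts (hg : 𝒢.src g = y) (hg' : 𝒢.tgt g = z) (hh : 𝒢.src h = x)
    (hh' : 𝒢.tgt h = y)
    (a : Basis (Fin 𝒢.rank) ℝ (𝒢.algebroidFiber x))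
    (f : Basis (Fin (finrank ℝ E)) ℝ (TangentSpace 𝓘(ℝ, E) x))
    (b : Basis (Fin 𝒢.rank) ℝ (𝒢.algebroidFiber y))
    (f' : Basis (Fin (finrank ℝ E)) ℝ (TangentSpace 𝓘(ℝ, E) y))
    (c : Basis (Fin 𝒢.rank) ℝ (𝒢.algebroidFiber z))
    (f'' : Basis (Fin (finrank ℝ E)) ℝ (TangentSpace 𝓘(ℝ, E) z))
    {v w : Fin (finrank ℝ E) → F}
    (hw : ∀ j, mdiff F E 𝒢.src h (w j) = modelFrame f j)
    (hw' : ∀ j, mdiff F E 𝒢.tgt h (w j) = modelFrame f' j)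
    (hv : ∀ j, mdiff F E 𝒢.src g (v j) = modelFrame f' j)
    (hv' : ∀ j, mdiff F E 𝒢.tgt g (v j) = modelFrame f'' j)
    (C : Matrix (Fin 𝒢.rank) (Fin 𝒢.rank) ℝ) (D : Fin (finrank ℝ E) → Fin 𝒢.rank → ℝ)
    (hC : ∀ i, 𝒢.translateInv x h (a i) =
      ∑ j, C j i • 𝒢.translateRight y h (b j) + ∑ l, D l i • w l)
    (C' : Matrix (Fin 𝒢.rank) (Fin 𝒢.rank) ℝ) (D' : Fin (finrank ℝ E) → Fin 𝒢.rank → ℝ)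
    (hC' : ∀ i, 𝒢.translateInv y g (b i) =
      ∑ j, C' j i • 𝒢.translateRight z g (c j) + ∑ l, D' l i • v l) :
    𝒢.exchangeDetAt (𝒢.mul g h) a f c f'' =
      (-1) ^ 𝒢.rank * (𝒢.exchangeDetAt g b f' c f'' * 𝒢.exchangeDetAt h a f b f') := by
  have hgh : 𝒢.src g = 𝒢.tgt h := hg.trans hh'.symm
  rw [exchangeDetAt_eq_det hg hg' b f' c f'' hv hv' C' D' hC',
    exchangeDetAt_eq_det hh hh' a f b f' hw hw' C D hC]
  -- The relation `∑ⱼ Cⱼᵢ (g bⱼ⁻¹)ᵥ + ∑ₗ Dₗᵢ vₗ = 0`, where `(⬝)ᵥ` is the part along `v`.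
  have hD : ∀ i l, ∑ j, C j i * D' l j + D l i = 0 := by
    intro i
    have h1 : ∑ j, C j i • mdiff F E 𝒢.tgt (𝒢.one y) (𝒢.algebroidIncl y (b j)) +
        ∑ l, D l i • modelFrame f' l = 0 := by
      have := congrArg (mdiff F E 𝒢.tgt h) (hC i)
      rw [mdiff_tgt_translateInv hh] at this
      simp only [map_add, map_sum, map_smul, mdiff_tgt_translateRight hh', hw'] at this
      exact this.symm
    have h2 : ∀ j, mdiff F E 𝒢.tgt (𝒢.one y) (𝒢.algebroidIncl y (b j)) =
        ∑ l, D' l j • modelFrame f' l := by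
      intro j
      have := congrArg (mdiff F E 𝒢.src g) (hC' j)
      rw [mdiff_src_translateInv hg] at this
      simpa only [map_add, map_sum, map_smul, mdiff_src_translateRight hg', hv, smul_zero,
        Finset.sum_const_zero, zero_add] using this
    simp only [h2, Finset.smul_sum, smul_smul] at h1
    rw [Finset.sum_comm, ← Finset.sum_add_distrib] at h1
    simp only [← Finset.sum_smul, ← add_smul] at h1
    exact Fintype.linearIndependent_iff.1 (modelFrame f').linearIndependent _ h1
  have hsrc : ∀ l, mdiff F E 𝒢.src g (v l) = mdiff F E 𝒢.tgt h (w l) := fun l => by rw [hv, hw']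
  have key : ∀ i, 𝒢.translateInv x (𝒢.mul g h) (a i) =
      ∑ k, (-(C' * C)) k i • 𝒢.translateRight z (𝒢.mul g h) (c k) +
        ∑ l, D l i • 𝒢.dmul g h (v l, w l) := by
    intro i
    -- `(0, h aᵢ⁻¹)` is a combination of the composable pairs
    -- `(g bⱼ⁻¹ - ∑ₖ C'ₖⱼ cₖ g, bⱼ h)` and `(vₗ, wₗ)`.
    have h1 : ((0 : F), 𝒢.translateInv x h (a i)) =
        ∑ j, C j i • ((𝒢.translateInv y g (b j), 𝒢.translateRight y h (b j)) -
          ∑ k, C' k j • (𝒢.translateRight z g (c k), (0 : F))) + ∑ l, D l i • (v l, w l) := by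
      refine Prod.ext ?_ ?_
      · simp only [Prod.fst_add, Prod.fst_sum, Prod.smul_fst, Prod.fst_sub]
        have : ∀ j, 𝒢.translateInv y g (b j) - ∑ k, C' k j • 𝒢.translateRight z g (c k) =
            ∑ l, D' l j • v l := fun j => by rw [hC', add_sub_cancel_left]
        simp only [this, Finset.smul_sum, smul_smul]
        rw [Finset.sum_comm, ← Finset.sum_add_distrib]
        simp only [← Finset.sum_smul, ← add_smul, hD, zero_smul, Finset.sum_const_zero]
      · simp only [Prod.snd_add, Prod.snd_sum, Prod.smul_snd, Prod.snd_sub, smul_zero,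
          Finset.sum_const_zero, sub_zero]
        exact hC i
    rw [← dmul_zero_translateInv hgh hh, h1]
    simp only [map_add, map_sum, map_smul, map_sub, dmul_translateInv_translateRight hg hh',
      dmul_translateRight_zero hgh hg', zero_sub]
    congr 1
    simp only [← Finset.sum_neg_distrib, Finset.smul_sum, Matrix.neg_apply, Matrix.mul_apply]
    rw [Finset.sum_comm]
    refine Finset.sum_congr rfl fun k _ => ?_
    rw [Finset.sum_smul]
    refine Finset.sum_congr rfl fun j _ => ?_
    rw [smul_neg, smul_smul, neg_smul, mul_comm]
  rw [exchangeDetAt_eq_det (by rw [𝒢.src_mul _ _ hgh, hh]) (by rw [𝒢.tgt_mul _ _ hgh, hg'])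
    a f c f'' (w := fun l => 𝒢.dmul g h (v l, w l))
    (fun l => by rw [mdiff_src_dmul hgh (hsrc l), hw])
    (fun l => by rw [mdiff_tgt_dmul hgh (hsrc l), hv']) _ D key, Matrix.det_neg, Matrix.det_mul,
    Fintype.card_fin]

/-- The exchange determinant with the Koszul sign. -/
def signedDet (𝒢 : LieGroupoid E F M G) (g : G) {x y : M}
    (a : Basis (Fin 𝒢.rank) ℝ (𝒢.algebroidFiber x))
    (f : Basis (Fin (finrank ℝ E)) ℝ (TangentSpace 𝓘(ℝ, E) x))
    (b : Basis (Fin 𝒢.rank) ℝ (𝒢.algebroidFiber y))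
    (h : Basis (Fin (finrank ℝ E)) ℝ (TangentSpace 𝓘(ℝ, E) y)) : ℝ :=
  (-1) ^ 𝒢.rank * 𝒢.exchangeDetAt g a f b h

lemma signedDet_change (hx : 𝒢.src g = x) (hy : 𝒢.tgt g = y)
    (a a' : Basis (Fin 𝒢.rank) ℝ (𝒢.algebroidFiber x))
    (f f' : Basis (Fin (finrank ℝ E)) ℝ (TangentSpace 𝓘(ℝ, E) x))
    (b b' : Basis (Fin 𝒢.rank) ℝ (𝒢.algebroidFiber y))
    (h h' : Basis (Fin (finrank ℝ E)) ℝ (TangentSpace 𝓘(ℝ, E) y)) :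
    𝒢.signedDet g a' f' b' h' =
      𝒢.signedDet g a f b h * (a.det a' * h.det h') / (b.det b' * f.det f') := by
  rw [signedDet, signedDet, exchangeDetAt_change hx hy a a' f f' b b' h h']
  ring

lemma signedDet_ne_zero (hx : 𝒢.src g = x) (hy : 𝒢.tgt g = y)
    (a : Basis (Fin 𝒢.rank) ℝ (𝒢.algebroidFiber x))
    (f : Basis (Fin (finrank ℝ E)) ℝ (TangentSpace 𝓘(ℝ, E) x))
    (b : Basis (Fin 𝒢.rank) ℝ (𝒢.algebroidFiber y))
    (h : Basis (Fin (finrank ℝ E)) ℝ (TangentSpace 𝓘(ℝ, E) y)) :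
    𝒢.signedDet g a f b h ≠ 0 :=
  mul_ne_zero (by simp) (exchangeDetAt_ne_zero hx hy a f b h)

/-- The Koszul sign makes the exchange determinant multiplicative. -/
lemma signedDet_mul (hg : 𝒢.src g = y) (hg' : 𝒢.tgt g = z) (hh : 𝒢.src h = x)
    (hh' : 𝒢.tgt h = y)
    (a : Basis (Fin 𝒢.rank) ℝ (𝒢.algebroidFiber x))
    (f : Basis (Fin (finrank ℝ E)) ℝ (TangentSpace 𝓘(ℝ, E) x))
    (b : Basis (Fin 𝒢.rank) ℝ (𝒢.algebroidFiber y))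
    (f' : Basis (Fin (finrank ℝ E)) ℝ (TangentSpace 𝓘(ℝ, E) y))
    (c : Basis (Fin 𝒢.rank) ℝ (𝒢.algebroidFiber z))
    (f'' : Basis (Fin (finrank ℝ E)) ℝ (TangentSpace 𝓘(ℝ, E) z)) :
    𝒢.signedDet (𝒢.mul g h) a f c f'' = 𝒢.signedDet g b f' c f'' * 𝒢.signedDet h a f b f' := by
  have hgh : 𝒢.src g = 𝒢.tgt h := hg.trans hh'.symm
  -- It is enough to treat frames of `T_y M` and `T_z M` that have common lifts.
  obtain ⟨p, w, hw, hw', hu⟩ := exists_common_lift_frame h hh' b (modelFrame f)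
  obtain ⟨q, v, hv, hv', hu'⟩ := exists_common_lift_frame g hg' c p
  let f₁' : Basis (Fin (finrank ℝ E)) ℝ (TangentSpace 𝓘(ℝ, E) y) := p
  let f₁'' : Basis (Fin (finrank ℝ E)) ℝ (TangentSpace 𝓘(ℝ, E) z) := q
  obtain ⟨C, D, hC⟩ := hu fun i => 𝒢.translateInv x h (a i)
  obtain ⟨C', D', hC'⟩ := hu' fun i => 𝒢.translateInv y g (b i)
  have key := exchangeDetAt_mul_of_lifts hg hg' hh hh' a f b f₁' c f₁'' hw hw' hv hv' C D hC C' D'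
    hC'
  have key' : 𝒢.signedDet (𝒢.mul g h) a f c f₁'' =
      𝒢.signedDet g b f₁' c f₁'' * 𝒢.signedDet h a f b f₁' := by
    unfold signedDet
    rw [key]
    ring
  rw [signedDet_change (by rw [𝒢.src_mul _ _ hgh, hh]) (by rw [𝒢.tgt_mul _ _ hgh, hg'])
      a a f f c c f₁'' f'', key', signedDet_change hg hg' b b f₁' f' c c f₁'' f'',
    signedDet_change hh hh' a a f f b b f₁' f']
  simp only [Basis.det_self]
  have := (f₁'.isUnit_det f').ne_zero
  field_simp

/-- At a unit the determinant is idempotent by multiplicativity, and it does not vanish. -/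
lemma signedDet_one (x : M) (a : Basis (Fin 𝒢.rank) ℝ (𝒢.algebroidFiber x))
    (f : Basis (Fin (finrank ℝ E)) ℝ (TangentSpace 𝓘(ℝ, E) x)) :
    𝒢.signedDet (𝒢.one x) a f a f = 1 := by
  have h1 := signedDet_mul (𝒢.src_one x) (𝒢.tgt_one x) (𝒢.src_one x) (𝒢.tgt_one x) a f a f a f
  have h2 := signedDet_ne_zero (𝒢.src_one x) (𝒢.tgt_one x) a f a f
  have h3 : 𝒢.mul (𝒢.one x) (𝒢.one x) = 𝒢.one x := by
    have := 𝒢.one_mul (𝒢.one x)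
    rwa [𝒢.tgt_one] at this
  rw [h3] at h1
  exact mul_left_cancel₀ h2 (h1.symm.trans (_root_.mul_one _).symm)

end LieGroupoid

/-! ### Smooth families of tangent vectors -/

section SmoothFamilies

variable {H H' H'' N N' : Type*}
  [NormedAddCommGroup H] [NormedSpace ℝ H] [NormedAddCommGroup H'] [NormedSpace ℝ H']
  [NormedAddCommGroup H''] [NormedSpace ℝ H'']
  [TopologicalSpace N] [ChartedSpace H N] [TopologicalSpace N'] [ChartedSpace H' N']

/-- A smooth family of tangent vectors has smooth images under the differential of a smooth
vector-valued map. -/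
lemma ContMDiffOn.mdiff_apply [IsManifold 𝓘(ℝ, H') ∞ N'] {γ : N → N'} {w : N → H'} {s : Set N}
    (hw : ContMDiffOn 𝓘(ℝ, H) 𝓘(ℝ, H').tangent ∞
      (fun x => (⟨γ x, w x⟩ : TangentBundle 𝓘(ℝ, H') N')) s)
    {θ : N' → H''} {U : Set N'} (hU : IsOpen U) (hθ : ContMDiffOn 𝓘(ℝ, H') 𝓘(ℝ, H'') ∞ θ U) :
    ContMDiffOn 𝓘(ℝ, H) 𝓘(ℝ, H'') ∞ (fun x => mdiff H' H'' θ (γ x) (w x)) (s ∩ γ ⁻¹' U) := by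
  have : IsManifold 𝓘(ℝ, H') 1 N' := IsManifold.of_le (n := ∞) (by simp)
  have h1 := hθ.contMDiffOn_tangentMapWithin (m := ∞) (by simp) hU.uniqueMDiffOn
  have h2 : ContMDiffOn 𝓘(ℝ, H) 𝓘(ℝ, H'').tangent ∞
      (fun x => tangentMapWithin 𝓘(ℝ, H') 𝓘(ℝ, H'') θ U (⟨γ x, w x⟩ : TangentBundle 𝓘(ℝ, H') N'))
      (s ∩ γ ⁻¹' U) := h1.comp (hw.mono Set.inter_subset_left) fun x hx => hx.2
  have h3 := (contMDiff_snd_tangentBundle_modelSpace H'' 𝓘(ℝ, H'') (n := ∞)).comp_contMDiffOn h2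
  refine h3.congr fun x hx => ?_
  change mdiff H' H'' θ (γ x) (w x) = mfderivWithin 𝓘(ℝ, H') 𝓘(ℝ, H'') θ U (γ x) (w x)
  rw [mfderivWithin_of_isOpen hU hx.2]
  rfl

/-- Images of smooth families of vectors of a vector space under the differential of a smooth map
form a smooth family of tangent vectors. -/
lemma ContMDiffOn.tangent_mk [IsManifold 𝓘(ℝ, H') ∞ N'] {u : N → H''} {c : N → H''} {s : Set N}
    (hu : ContMDiffOn 𝓘(ℝ, H) 𝓘(ℝ, H'') ∞ u s) (hc : ContMDiffOn 𝓘(ℝ, H) 𝓘(ℝ, H'') ∞ c s)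
    {θ : H'' → N'} {U : Set H''} (hU : IsOpen U) (hθ : ContMDiffOn 𝓘(ℝ, H'') 𝓘(ℝ, H') ∞ θ U)
    (hs : Set.MapsTo u s U) :
    ContMDiffOn 𝓘(ℝ, H) 𝓘(ℝ, H').tangent ∞
      (fun x => (⟨θ (u x), mdiff H'' H' θ (u x) (c x)⟩ : TangentBundle 𝓘(ℝ, H') N')) s := by
  have : IsManifold 𝓘(ℝ, H') 1 N' := IsManifold.of_le (n := ∞) (by simp)
  have h1 := hθ.contMDiffOn_tangentMapWithin (m := ∞) (by simp) hU.uniqueMDiffOn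
  have h0 : ContMDiffOn 𝓘(ℝ, H) 𝓘(ℝ, H'').tangent ∞
      (fun x => (⟨u x, c x⟩ : TangentBundle 𝓘(ℝ, H'') H'')) s := by
    have hp := hu.prodMk hc
    rw [chartedSpaceSelf_prod] at hp
    exact (contMDiff_tangentBundleModelSpaceHomeomorph_symm (I := 𝓘(ℝ, H''))
      (n := ∞)).comp_contMDiffOn hp
  have h2 : ContMDiffOn 𝓘(ℝ, H) 𝓘(ℝ, H').tangent ∞
      (fun x => tangentMapWithin 𝓘(ℝ, H'') 𝓘(ℝ, H') θ U (⟨u x, c x⟩ : TangentBundle 𝓘(ℝ, H'') H''))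
      s := h1.comp h0 fun x hx => hs hx
  refine h2.congr fun x hx => ?_
  change (⟨θ (u x), mdiff H'' H' θ (u x) (c x)⟩ : TangentBundle 𝓘(ℝ, H') N') =
    ⟨θ (u x), mfderivWithin 𝓘(ℝ, H'') 𝓘(ℝ, H') θ U (u x) (c x)⟩
  rw [mfderivWithin_of_isOpen hU (hs hx)]
  rfl

lemma ContMDiffAt.matrix_det {ι : Type*} [Fintype ι] [DecidableEq ι] {A : N → Matrix ι ι ℝ} {x : N}
    (h : ∀ i j, ContMDiffAt 𝓘(ℝ, H) 𝓘(ℝ, ℝ) ∞ (fun y => A y i j) x) :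
    ContMDiffAt 𝓘(ℝ, H) 𝓘(ℝ, ℝ) ∞ (fun y => (A y).det) x := by
  simp only [Matrix.det_apply']
  exact ContMDiffAt.sum fun σ _ => contMDiffAt_const.mul (contMDiffAt_finsetProd fun i _ => h _ _)

lemma ContMDiffAt.basis_det [FiniteDimensional ℝ H''] {ι : Type*} [Fintype ι] [DecidableEq ι]
    (B : Basis ι ℝ H'') {v : N → ι → H''} {x : N}
    (h : ∀ i, ContMDiffAt 𝓘(ℝ, H) 𝓘(ℝ, H'') ∞ (fun y => v y i) x) :
    ContMDiffAt 𝓘(ℝ, H) 𝓘(ℝ, ℝ) ∞ (fun y => B.det (v y)) x := by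
  simp only [Basis.det_apply]
  refine ContMDiffAt.matrix_det fun i j => ?_
  have : ContDiff ℝ ∞ (fun u : H'' => B.repr u i) :=
    (LinearMap.toContinuousLinearMap (B.coord i)).contDiff
  exact (this.contMDiff _).comp x (h j)

end SmoothFamilies

/-! ### Smoothness of the exchange determinant -/

namespace LieGroupoid

variable {E F M G : Type*}
  [NormedAddCommGroup E] [NormedSpace ℝ E] [NormedAddCommGroup F] [NormedSpace ℝ F]
  [TopologicalSpace M] [ChartedSpace E M] [TopologicalSpace G] [ChartedSpace F G]
  [FiniteDimensional ℝ E] [FiniteDimensional ℝ F]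
  [IsManifold 𝓘(ℝ, E) ∞ M] [IsManifold 𝓘(ℝ, F) ∞ G] {𝒢 : LieGroupoid E F M G}

namespace AdaptedChart

variable (χ : 𝒢.AdaptedChart)

/-- The basis of the model space of the arrows given by the splitting in an adapted chart. -/
def modelBasis : Basis (Fin 𝒢.rank ⊕ Fin (finrank ℝ E)) ℝ F :=
  ((Pi.basisFun ℝ (Fin 𝒢.rank)).prod (finBasis ℝ E)).map
    ((LinearEquiv.prodComm ℝ _ _).trans χ.equiv.symm.toLinearEquiv)

lemma modelBasis_repr_inl (u : F) (i : Fin 𝒢.rank) :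
    χ.modelBasis.repr u (Sum.inl i) = (χ.equiv u).2 i := by
  simp [modelBasis]

lemma equiv_modelBasis_inl (i : Fin 𝒢.rank) : (χ.equiv (χ.modelBasis (Sum.inl i))).1 = 0 := by
  simp [modelBasis]

lemma equiv_modelBasis_inr (j : Fin (finrank ℝ E)) :
    (χ.equiv (χ.modelBasis (Sum.inr j))).1 = finBasis ℝ E j := by
  simp [modelBasis]

/-- In an adapted chart, the determinant of a frame of the tangent space that begins with vectors
tangent to the fibre of the source map is a product of two determinants. -/
lemma det_mdiff_dom {p : G} (hp : p ∈ χ.dom.source) (u : Fin 𝒢.rank → F)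
    (hu : ∀ i, mdiff F E 𝒢.src p (u i) = 0) (w : Fin (finrank ℝ E) → F) :
    χ.modelBasis.det (fun i => mdiff F F χ.dom p (Sum.elim u w i)) =
      (Matrix.of fun i i' => mdiff F (Fin 𝒢.rank → ℝ) χ.vert p (u i') i).det *
        (finBasis ℝ E).det
          (fun j => mdiff E E χ.cod (𝒢.src p) (mdiff F E 𝒢.src p (w j))) := by
  have h1 : (fun i => mdiff F F χ.dom p (Sum.elim u w i)) =
      Sum.elim (fun i => mdiff F F χ.dom p (u i)) (fun j => mdiff F F χ.dom p (w j)) := by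
    funext i
    rcases i with i | j <;> rfl
  rw [h1, χ.modelBasis.det_sumElim_of_ker
    ((LinearMap.fst ℝ E _) ∘ₗ (χ.equiv.toLinearEquiv : F →ₗ[ℝ] E × (Fin 𝒢.rank → ℝ)))
    (finBasis ℝ E) χ.equiv_modelBasis_inl χ.equiv_modelBasis_inr]
  · congr 2
    · ext i i'
      simp only [Matrix.of_apply]
      rw [χ.modelBasis_repr_inl, χ.equiv_mdiff_dom hp]
    · funext j
      exact congrArg Prod.fst (χ.equiv_mdiff_dom hp (w j))
  · intro i
    refine (congrArg Prod.fst (χ.equiv_mdiff_dom hp (u i))).trans ?_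
    rw [hu, map_zero]

/-- The differential of the chart of the arrows. -/
def tangentEquiv {p : G} (hp : p ∈ χ.dom.source) : F ≃ₗ[ℝ] F :=
  LinearEquiv.ofLinearMap (mdiff F F χ.dom p).toLinearMap
    (mdiff F F χ.dom.symm (χ.dom p)).toLinearMap
    (LinearMap.ext fun u => mdiff_mdiff_symm χ.dom_mem hp u)
    (LinearMap.ext fun u => χ.mdiff_dom_symm hp u)

/-- The frame of the tangent space given by an adapted chart. -/
def frameAt {p : G} (hp : p ∈ χ.dom.source) : Basis (Fin 𝒢.rank ⊕ Fin (finrank ℝ E)) ℝ F :=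
  χ.modelBasis.map (χ.tangentEquiv hp).symm

lemma frameAt_apply {p : G} (hp : p ∈ χ.dom.source) (i) :
    χ.frameAt hp i = mdiff F F χ.dom.symm (χ.dom p) (χ.modelBasis i) := rfl

lemma det_frameAt {p : G} (hp : p ∈ χ.dom.source) (v : Fin 𝒢.rank ⊕ Fin (finrank ℝ E) → F) :
    (χ.frameAt hp).det v = χ.modelBasis.det (fun i => mdiff F F χ.dom p (v i)) := by
  rw [frameAt, Basis.det_map]
  rfl

end AdaptedChart

/-- The matrix of the coordinates, along the fibres of the source map, of the right translates of
a frame of the Lie algebroid. -/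
def vertMatrix (χ : 𝒢.AdaptedChart) {y : M} (g : G)
    (b : Basis (Fin 𝒢.rank) ℝ (𝒢.algebroidFiber y)) : Matrix (Fin 𝒢.rank) (Fin 𝒢.rank) ℝ :=
  Matrix.of fun i i' => mdiff F (Fin 𝒢.rank → ℝ) χ.vert g (𝒢.translateRight y g (b i')) i

/-- The determinant of the coordinates of a frame of `T_x M`, in the chart of the objects of an
adapted chart. -/
def codDet (χ : 𝒢.AdaptedChart) {x : M}
    (f : Basis (Fin (finrank ℝ E)) ℝ (TangentSpace 𝓘(ℝ, E) x)) : ℝ :=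
  (finBasis ℝ E).det (fun j => mdiff E E χ.cod x (modelFrame f j))

/-- The inversion, in two charts. -/
def invChart (χ χ' : 𝒢.AdaptedChart) (u : F) : F := χ.dom (𝒢.inv (χ'.dom.symm u))

/-- The Jacobian of the inversion in two adapted charts, computed at `g⁻¹`. -/
def invJacobian (χ χ' : 𝒢.AdaptedChart) (g : G) : ℝ :=
  χ.modelBasis.det fun i => fderiv ℝ (invChart χ χ') (χ'.dom (𝒢.inv g)) (χ'.modelBasis i)

lemma det_translateRight (χ : 𝒢.AdaptedChart) {g : G} (hg : g ∈ χ.dom.source) {x y : M}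
    (hx : 𝒢.src g = x) (hy : 𝒢.tgt g = y) (b : Basis (Fin 𝒢.rank) ℝ (𝒢.algebroidFiber y))
    (f : Basis (Fin (finrank ℝ E)) ℝ (TangentSpace 𝓘(ℝ, E) x)) {w : Fin (finrank ℝ E) → F}
    (hw : ∀ j, mdiff F E 𝒢.src g (w j) = modelFrame f j) :
    (χ.frameAt hg).det (Sum.elim (fun i => 𝒢.translateRight y g (b i)) w) =
      (vertMatrix χ g b).det * codDet χ f := by
  rw [χ.det_frameAt, χ.det_mdiff_dom hg _ (fun i => mdiff_src_translateRight hy _)]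
  simp only [hw, hx]
  rfl

/-- The exchange determinant in adapted charts at `g` and at `g⁻¹`. -/
lemma exchangeDetAt_eq_charts (χ χ' : 𝒢.AdaptedChart) {g : G} (hg : g ∈ χ.dom.source)
    (hg' : 𝒢.inv g ∈ χ'.dom.source) {x y : M} (hx : 𝒢.src g = x) (hy : 𝒢.tgt g = y)
    (a : Basis (Fin 𝒢.rank) ℝ (𝒢.algebroidFiber x))
    (f : Basis (Fin (finrank ℝ E)) ℝ (TangentSpace 𝓘(ℝ, E) x))
    (b : Basis (Fin 𝒢.rank) ℝ (𝒢.algebroidFiber y))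
    (h : Basis (Fin (finrank ℝ E)) ℝ (TangentSpace 𝓘(ℝ, E) y)) :
    𝒢.exchangeDetAt g a f b h =
      invJacobian χ χ' g * ((vertMatrix χ' (𝒢.inv g) a).det * codDet χ' h) /
        ((vertMatrix χ g b).det * codDet χ f) := by
  obtain ⟨w, hw⟩ := exists_lift_src (𝒢 := 𝒢) g (modelFrame f)
  obtain ⟨w', hw'⟩ := exists_lift_src (𝒢 := 𝒢) (𝒢.inv g) (modelFrame h)
  have hx' : 𝒢.tgt (𝒢.inv g) = x := by rw [𝒢.tgt_inv, hx]
  have hy' : 𝒢.src (𝒢.inv g) = y := by rw [𝒢.src_inv, hy]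
  rw [exchangeDetAt_eq_div hx hy (χ.frameAt hg) a f b h hw
    (w' := fun j => mdiff F F 𝒢.inv (𝒢.inv g) (w' j))
    (fun j => (mdiff_tgt_mdiff_inv g _).trans (hw' j)),
    det_translateRight χ hg hx hy b f hw, ← det_translateRight χ' hg' hy' hx' a h hw']
  congr 1
  -- Change the frame at `g⁻¹` before applying the differential of the inversion.
  set v : Fin 𝒢.rank ⊕ Fin (finrank ℝ E) → F :=
    Sum.elim (fun i => 𝒢.translateRight x (𝒢.inv g) (a i)) w' with hv
  have e1 : Sum.elim (fun i => 𝒢.translateInv x g (a i))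
      (fun j => mdiff F F 𝒢.inv (𝒢.inv g) (w' j)) = fun i => mdiff F F 𝒢.inv (𝒢.inv g) (v i) := by
    funext i
    rcases i with i | j <;> rfl
  have e2 : ∀ v : Fin 𝒢.rank ⊕ Fin (finrank ℝ E) → F,
      (χ.frameAt hg).det (fun i => mdiff F F 𝒢.inv (𝒢.inv g) (v i)) =
      (χ.frameAt hg).det (fun i => mdiff F F 𝒢.inv (𝒢.inv g) (χ'.frameAt hg' i)) *
        (χ'.frameAt hg').det v := fun v =>
    DFunLike.congr_fun (AlternatingMap.eq_smul_basis_det (χ'.frameAt hg')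
      ((χ.frameAt hg).det.compLinearMap (mdiff F F 𝒢.inv (𝒢.inv g)).toLinearMap)) v
  rw [e1, e2]
  congr 1
  rw [χ.det_frameAt, invJacobian]
  congr 1
  funext i
  rw [χ'.frameAt_apply]
  have hsy := χ'.mdifferentiableAt_dom_symm (χ'.dom.map_source hg')
  have hi : MDifferentiableAt 𝓘(ℝ, F) 𝓘(ℝ, F) 𝒢.inv (χ'.dom.symm (χ'.dom (𝒢.inv g))) :=
    𝒢.mdifferentiableAt_inv _
  have hd : MDifferentiableAt 𝓘(ℝ, F) 𝓘(ℝ, F) χ.dom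
      ((𝒢.inv ∘ χ'.dom.symm) (χ'.dom (𝒢.inv g))) := by
    rw [Function.comp_apply, χ'.dom.left_inv hg', 𝒢.inv_inv]
    exact χ.mdifferentiableAt_dom hg
  have c1 := mdiff_comp hd (hi.comp _ hsy)
  rw [mdiff_comp hi hsy, Function.comp_apply, χ'.dom.left_inv hg', 𝒢.inv_inv,
    mdiff_eq_fderiv] at c1
  exact (DFunLike.congr_fun c1 (χ'.modelBasis i)).symm

/-! #### Smoothness of the constituents -/

/-- The Jacobian of the inversion is smooth, as the derivative of the inversion in charts is. -/
lemma contMDiffAt_invJacobian (χ χ' : 𝒢.AdaptedChart) {g : G} (hg : g ∈ χ.dom.source)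
    (hg' : 𝒢.inv g ∈ χ'.dom.source) :
    ContMDiffAt 𝓘(ℝ, F) 𝓘(ℝ, ℝ) ∞ (invJacobian χ χ') g := by
  refine ContMDiffAt.basis_det _ fun i => ?_
  have h1 : ContMDiffAt 𝓘(ℝ, F) 𝓘(ℝ, F) ∞ (fun g => χ'.dom (𝒢.inv g)) g :=
    (χ'.contMDiffOn_dom.contMDiffAt (χ'.dom.open_source.mem_nhds hg')).comp g (𝒢.contMDiff_inv g)
  have h2 : ContMDiffAt 𝓘(ℝ, F) 𝓘(ℝ, F) ∞ (invChart χ χ') (χ'.dom (𝒢.inv g)) := by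
    have a1 := χ'.contMDiffOn_dom_symm.contMDiffAt
      (χ'.dom.open_target.mem_nhds (χ'.dom.map_source hg'))
    have a2 := (𝒢.contMDiff_inv (χ'.dom.symm (χ'.dom (𝒢.inv g)))).comp _ a1
    refine ContMDiffAt.comp (χ'.dom (𝒢.inv g)) (g := χ.dom) ?_ a2
    rw [χ'.dom.left_inv hg', 𝒢.inv_inv]
    exact χ.contMDiffOn_dom.contMDiffAt (χ.dom.open_source.mem_nhds hg)
  have h3 : ContDiffAt ℝ ∞ (fun u => fderiv ℝ (invChart χ χ') u (χ'.modelBasis i))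
      (χ'.dom (𝒢.inv g)) :=
    (h2.contDiffAt.fderiv_right (m := ∞) (by simp)).clm_apply contDiffAt_const
  exact h3.contMDiffAt.comp g h1

/-- The product of an arrow with a nearby arrow of the fibre of the source map, in charts. -/
def prodChart (χ χ₁ : 𝒢.AdaptedChart) (q : F × (Fin 𝒢.rank → ℝ)) : Fin 𝒢.rank → ℝ :=
  χ.vert (𝒢.mul (χ₁.point (𝒢.tgt (χ.dom.symm q.1)) q.2) (χ.dom.symm q.1))

/-- The product in charts is smooth on an open set of a vector space: composability has been solved
for, using that the source map is a projection in the adapted chart `χ₁` at the unit. -/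
lemma contDiffAt_prodChart (χ χ₁ : 𝒢.AdaptedChart) {g : G} (hg : g ∈ χ.dom.source)
    (hg₁ : 𝒢.one (𝒢.tgt g) ∈ χ₁.dom.source) :
    ContDiffAt ℝ ∞ (prodChart χ χ₁) (χ.dom g, χ₁.vert (𝒢.one (𝒢.tgt g))) := by
  set q₀ : F × (Fin 𝒢.rank → ℝ) := (χ.dom g, χ₁.vert (𝒢.one (𝒢.tgt g))) with hq₀
  have hp₀ : χ.dom.symm q₀.1 = g := χ.dom.left_inv hg
  have ht₀ : 𝒢.tgt (χ.dom.symm q₀.1) = 𝒢.tgt g := by rw [hp₀]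
  have hp : ContMDiffAt 𝓘(ℝ, F × (Fin 𝒢.rank → ℝ)) 𝓘(ℝ, F) ∞
      (fun q : F × (Fin 𝒢.rank → ℝ) => χ.dom.symm q.1) q₀ :=
    (χ.contMDiffOn_dom_symm.contMDiffAt (χ.dom.open_target.mem_nhds (χ.dom.map_source hg))).comp q₀
      (contDiff_fst.contMDiff q₀)
  have ht : ContMDiffAt 𝓘(ℝ, F × (Fin 𝒢.rank → ℝ)) 𝓘(ℝ, E) ∞
      (fun q : F × (Fin 𝒢.rank → ℝ) => 𝒢.tgt (χ.dom.symm q.1)) q₀ :=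
    (𝒢.contMDiff_tgt _).comp q₀ hp
  have hs₁ : 𝒢.tgt g ∈ χ₁.cod.source := by
    have := χ₁.src_mem _ hg₁
    rwa [𝒢.src_one] at this
  have hc : ContMDiffAt 𝓘(ℝ, F × (Fin 𝒢.rank → ℝ)) 𝓘(ℝ, E) ∞
      (fun q : F × (Fin 𝒢.rank → ℝ) => χ₁.cod (𝒢.tgt (χ.dom.symm q.1))) q₀ := by
    refine ContMDiffAt.comp q₀ (g := χ₁.cod) ?_ ht
    rw [ht₀]
    exact χ₁.contMDiffOn_cod.contMDiffAt (χ₁.cod.open_source.mem_nhds hs₁)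
  have hl : ContMDiffAt 𝓘(ℝ, F × (Fin 𝒢.rank → ℝ)) 𝓘(ℝ, F) ∞
      (fun q : F × (Fin 𝒢.rank → ℝ) =>
        χ₁.equiv.symm (χ₁.cod (𝒢.tgt (χ.dom.symm q.1)), q.2)) q₀ :=
    (χ₁.equiv.symm.contDiff.contDiffAt.comp q₀
      (hc.contDiffAt.prodMk contDiffAt_snd)).contMDiffAt
  have hl₀ : χ₁.equiv.symm (χ₁.cod (𝒢.tgt (χ.dom.symm q₀.1)), q₀.2) =
      χ₁.dom (𝒢.one (𝒢.tgt g)) := by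
    have := χ₁.equiv_dom hg₁
    rw [𝒢.src_one] at this
    rw [ht₀, hq₀, ← this, ContinuousLinearEquiv.symm_apply_apply]
  have hP₀ : χ₁.point (𝒢.tgt (χ.dom.symm q₀.1)) q₀.2 = 𝒢.one (𝒢.tgt g) := by
    rw [AdaptedChart.point, hl₀, χ₁.dom.left_inv hg₁]
  have hP : ContMDiffAt 𝓘(ℝ, F × (Fin 𝒢.rank → ℝ)) 𝓘(ℝ, F) ∞
      (fun q : F × (Fin 𝒢.rank → ℝ) => χ₁.point (𝒢.tgt (χ.dom.symm q.1)) q.2) q₀ := by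
    refine ContMDiffAt.comp q₀ (g := χ₁.dom.symm) ?_ hl
    rw [hl₀]
    exact χ₁.contMDiffOn_dom_symm.contMDiffAt
      (χ₁.dom.open_target.mem_nhds (χ₁.dom.map_source hg₁))
  have hev : ∀ᶠ q in nhds q₀, 𝒢.src (χ₁.point (𝒢.tgt (χ.dom.symm q.1)) q.2) =
      𝒢.tgt (χ.dom.symm q.1) := by
    have e1 : ∀ᶠ q in nhds q₀, 𝒢.tgt (χ.dom.symm q.1) ∈ χ₁.cod.source :=
      ht.continuousAt.eventually (χ₁.cod.open_source.mem_nhds (by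
        change 𝒢.tgt (χ.dom.symm q₀.1) ∈ _
        rwa [ht₀]))
    have e2 : ∀ᶠ q in nhds q₀, χ₁.equiv.symm (χ₁.cod (𝒢.tgt (χ.dom.symm q.1)), q.2) ∈
        χ₁.dom.target :=
      hl.continuousAt.eventually (χ₁.dom.open_target.mem_nhds (by
        change χ₁.equiv.symm (χ₁.cod (𝒢.tgt (χ.dom.symm q₀.1)), q₀.2) ∈ _
        rw [hl₀]
        exact χ₁.dom.map_source hg₁))
    filter_upwards [e1, e2] with q h1 h2
    exact χ₁.src_point h1 h2
  have hm : ContMDiffAt 𝓘(ℝ, F × (Fin 𝒢.rank → ℝ)) 𝓘(ℝ, F) ∞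
      (fun q : F × (Fin 𝒢.rank → ℝ) =>
        𝒢.mul (χ₁.point (𝒢.tgt (χ.dom.symm q.1)) q.2) (χ.dom.symm q.1)) q₀ := by
    have m1 := 𝒢.contMDiffOn_mul (χ₁.point (𝒢.tgt (χ.dom.symm q₀.1)) q₀.2, χ.dom.symm q₀.1)
      hev.self_of_nhds
    have m2 := (hP.prodMk hp).contMDiffWithinAt
      (s := {q | 𝒢.src (χ₁.point (𝒢.tgt (χ.dom.symm q.1)) q.2) = 𝒢.tgt (χ.dom.symm q.1)})
    exact (m1.comp q₀ m2 fun q hq => hq).contMDiffAt hev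
  have hm₀ : 𝒢.mul (χ₁.point (𝒢.tgt (χ.dom.symm q₀.1)) q₀.2) (χ.dom.symm q₀.1) = g := by
    rw [hP₀, hp₀, 𝒢.one_mul]
  have : ContMDiffAt 𝓘(ℝ, F × (Fin 𝒢.rank → ℝ)) 𝓘(ℝ, Fin 𝒢.rank → ℝ) ∞ (prodChart χ χ₁) q₀ := by
    refine ContMDiffAt.comp q₀ (g := χ.vert) ?_ hm
    rw [hm₀]
    exact χ.contMDiffOn_vert.contMDiffAt (χ.dom.open_source.mem_nhds hg)
  exact this.contDiffAt

/-- The right translate of an element of the Lie algebroid, through the product in charts. -/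
lemma mdiff_vert_translateRight (χ χ₁ : 𝒢.AdaptedChart) {g : G} (hg : g ∈ χ.dom.source)
    (hg₁ : 𝒢.one (𝒢.tgt g) ∈ χ₁.dom.source) (b : 𝒢.algebroidFiber (𝒢.tgt g)) :
    mdiff F (Fin 𝒢.rank → ℝ) χ.vert g (𝒢.translateRight (𝒢.tgt g) g b) =
      fderiv ℝ (prodChart χ χ₁) (χ.dom g, χ₁.vert (𝒢.one (𝒢.tgt g)))
        (0, mdiff F (Fin 𝒢.rank → ℝ) χ₁.vert (𝒢.one (𝒢.tgt g)) (𝒢.algebroidIncl _ b)) := by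
  obtain ⟨γ, h1, h2⟩ := 𝒢.exists_algebroid_curve b
  have hv : MDifferentiableAt 𝓘(ℝ, F) 𝓘(ℝ, Fin 𝒢.rank → ℝ) χ.vert g :=
    (χ.contMDiffOn_vert.contMDiffAt (χ.dom.open_source.mem_nhds hg)).mdifferentiableAt (by simp)
  have hv₁ : MDifferentiableAt 𝓘(ℝ, F) 𝓘(ℝ, Fin 𝒢.rank → ℝ) χ₁.vert (𝒢.one (𝒢.tgt g)) :=
    (χ₁.contMDiffOn_vert.contMDiffAt (χ₁.dom.open_source.mem_nhds hg₁)).mdifferentiableAt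
      (by simp)
  have h3 := (h1.translateRight h2 rfl).comp hv
  have h4 := (h1.comp hv₁).hasDerivAt
  have h5 := ((contDiffAt_prodChart χ χ₁ hg hg₁).differentiableAt (by simp)).hasFDerivAt
  have h4' : HasDerivAt (fun t => (χ.dom g, χ₁.vert (γ t)))
      (0, mdiff F (Fin 𝒢.rank → ℝ) χ₁.vert (𝒢.one (𝒢.tgt g)) (𝒢.algebroidIncl _ b)) 0 :=
    (hasDerivAt_const (0 : ℝ) (χ.dom g)).prodMk h4
  have h6 := HasFDerivAt.comp_hasDerivAt_of_eq (l := prodChart χ χ₁) (0 : ℝ) h5 h4'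
    (by rw [h1.1])
  refine h3.unique ((HasVelocity.of_hasDerivAt rfl h6).congr ?_)
  have hev : ∀ᶠ t in nhds 0, γ t ∈ χ₁.dom.source :=
    h1.continuousAt.eventually (χ₁.dom.open_source.mem_nhds (by rwa [h1.1]))
  filter_upwards [hev] with t ht
  have h7 := χ₁.point_src_vert ht
  rw [h2] at h7
  change χ.vert (𝒢.mul (γ t) g) = χ.vert (𝒢.mul (χ₁.point (𝒢.tgt (χ.dom.symm (χ.dom g)))
    (χ₁.vert (γ t))) (χ.dom.symm (χ.dom g)))
  rw [χ.dom.left_inv hg, h7]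

/-- Smooth frames of the Lie algebroid over `U`: the elements of the frames form smooth families of
tangent vectors of the manifold of arrows, at the units. -/
def IsSmoothAlgebroidFrame (a : ∀ x, Basis (Fin 𝒢.rank) ℝ (𝒢.algebroidFiber x)) (U : Set M) :
    Prop :=
  ∀ i, ContMDiffOn 𝓘(ℝ, E) 𝓘(ℝ, F).tangent ∞
    (fun x => (⟨𝒢.one x, a x i⟩ : TangentBundle 𝓘(ℝ, F) G)) U

/-- Smooth frames of the tangent bundle of the objects over `U`. -/
def IsSmoothObjectFrame (f : ∀ x : M, Basis (Fin (finrank ℝ E)) ℝ (TangentSpace 𝓘(ℝ, E) x))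
    (U : Set M) : Prop :=
  ∀ j, ContMDiffOn 𝓘(ℝ, E) 𝓘(ℝ, E).tangent ∞
    (fun x => (⟨x, f x j⟩ : TangentBundle 𝓘(ℝ, E) M)) U

/-- The vertical coordinates of a smooth frame of the Lie algebroid are smooth. -/
lemma contMDiffAt_mdiff_vert (χ₁ : 𝒢.AdaptedChart)
    {a : ∀ x, Basis (Fin 𝒢.rank) ℝ (𝒢.algebroidFiber x)} {U : Set M} (hU : IsOpen U)
    (ha : IsSmoothAlgebroidFrame a U) {y : M} (hy : y ∈ U) (hy₁ : 𝒢.one y ∈ χ₁.dom.source)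
    (i : Fin 𝒢.rank) :
    ContMDiffAt 𝓘(ℝ, E) 𝓘(ℝ, Fin 𝒢.rank → ℝ) ∞
      (fun x => mdiff F (Fin 𝒢.rank → ℝ) χ₁.vert (𝒢.one x) (𝒢.algebroidIncl x (a x i))) y :=
  ((ha i).mdiff_apply (w := fun x => 𝒢.algebroidIncl x (a x i)) χ₁.dom.open_source
    χ₁.contMDiffOn_vert).contMDiffAt
    ((hU.inter (χ₁.dom.open_source.preimage 𝒢.contMDiff_one.continuous)).mem_nhds ⟨hy, hy₁⟩)

lemma contMDiffAt_codDet (χ : 𝒢.AdaptedChart)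
    {f : ∀ x : M, Basis (Fin (finrank ℝ E)) ℝ (TangentSpace 𝓘(ℝ, E) x)} {U : Set M}
    (hU : IsOpen U) (hf : IsSmoothObjectFrame f U) {y : M} (hy : y ∈ U)
    (hy' : y ∈ χ.cod.source) :
    ContMDiffAt 𝓘(ℝ, E) 𝓘(ℝ, ℝ) ∞ (fun x => codDet χ (f x)) y := by
  refine ContMDiffAt.basis_det _ fun j => ?_
  exact ((hf j).mdiff_apply (γ := id) (w := fun x => modelFrame (f x) j) χ.cod.open_source
    χ.contMDiffOn_cod).contMDiffAt ((hU.inter χ.cod.open_source).mem_nhds ⟨hy, hy'⟩)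

/-- The entries of `vertMatrix` are derivatives of the product in charts, in the directions of the
frame, by `mdiff_vert_translateRight`. -/
lemma contMDiffAt_vertMatrix (χ : 𝒢.AdaptedChart)
    {b : ∀ x, Basis (Fin 𝒢.rank) ℝ (𝒢.algebroidFiber x)} {U : Set M} (hU : IsOpen U)
    (hb : IsSmoothAlgebroidFrame b U) {g : G} (hg : g ∈ χ.dom.source) (hy : 𝒢.tgt g ∈ U) :
    ContMDiffAt 𝓘(ℝ, F) 𝓘(ℝ, ℝ) ∞ (fun g => (vertMatrix χ g (b (𝒢.tgt g))).det) g := by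
  obtain ⟨χ₁, hg₁⟩ := 𝒢.exists_adaptedChart (𝒢.one (𝒢.tgt g))
  refine ContMDiffAt.matrix_det fun i i' => ?_
  have hone : ContMDiff 𝓘(ℝ, F) 𝓘(ℝ, F) ∞ fun g => 𝒢.one (𝒢.tgt g) :=
    𝒢.contMDiff_one.comp 𝒢.contMDiff_tgt
  have hq : ContMDiffAt 𝓘(ℝ, F) 𝓘(ℝ, F × (Fin 𝒢.rank → ℝ)) ∞
      (fun g => (χ.dom g, χ₁.vert (𝒢.one (𝒢.tgt g)))) g :=
    (χ.contMDiffOn_dom.contMDiffAt (χ.dom.open_source.mem_nhds hg)).prodMk_space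
      (ContMDiffAt.comp g (g := χ₁.vert)
        (χ₁.contMDiffOn_vert.contMDiffAt (χ₁.dom.open_source.mem_nhds hg₁)) (hone g))
  have hK : ContMDiffAt 𝓘(ℝ, F) 𝓘(ℝ, F × (Fin 𝒢.rank → ℝ) →L[ℝ] (Fin 𝒢.rank → ℝ)) ∞
      (fun g => fderiv ℝ (prodChart χ χ₁) (χ.dom g, χ₁.vert (𝒢.one (𝒢.tgt g)))) g :=
    ((contDiffAt_prodChart χ χ₁ hg hg₁).fderiv_right (m := ∞) (by simp)).contMDiffAt.comp g hq
  have hb' : ContMDiffAt 𝓘(ℝ, F) 𝓘(ℝ, Fin 𝒢.rank → ℝ) ∞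
      (fun g => mdiff F (Fin 𝒢.rank → ℝ) χ₁.vert (𝒢.one (𝒢.tgt g))
        (𝒢.algebroidIncl _ (b (𝒢.tgt g) i'))) g :=
    (contMDiffAt_mdiff_vert χ₁ hU hb hy hg₁ i').comp g (𝒢.contMDiff_tgt g)
  have h1 := hK.clm_apply (contMDiffAt_const (c := (0 : F)) |>.prodMk_space hb')
  have h2 : ContMDiffAt 𝓘(ℝ, F) 𝓘(ℝ, ℝ) ∞ (fun g => fderiv ℝ (prodChart χ χ₁)
      (χ.dom g, χ₁.vert (𝒢.one (𝒢.tgt g)))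
      (0, mdiff F (Fin 𝒢.rank → ℝ) χ₁.vert (𝒢.one (𝒢.tgt g))
        (𝒢.algebroidIncl _ (b (𝒢.tgt g) i'))) i) g :=
    ((contDiff_apply ℝ ℝ i).contMDiff _).comp g h1
  refine h2.congr_of_eventuallyEq ?_
  filter_upwards [χ.dom.open_source.mem_nhds hg,
    (χ₁.dom.open_source.preimage hone.continuous).mem_nhds hg₁] with g' h3 h4
  rw [vertMatrix, Matrix.of_apply, mdiff_vert_translateRight χ χ₁ h3 h4]

lemma vertMatrix_det_ne_zero (χ : 𝒢.AdaptedChart) {g : G} (hg : g ∈ χ.dom.source) {y : M}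
    (hy : 𝒢.tgt g = y) (b : Basis (Fin 𝒢.rank) ℝ (𝒢.algebroidFiber y))
    (f : Basis (Fin (finrank ℝ E)) ℝ (TangentSpace 𝓘(ℝ, E) (𝒢.src g))) :
    (vertMatrix χ g b).det ≠ 0 ∧ codDet χ f ≠ 0 := by
  obtain ⟨w, hw⟩ := exists_lift_src (𝒢 := 𝒢) g (modelFrame f)
  have h1 := det_translateRight χ hg rfl hy b f hw
  have h2 := (χ.frameAt hg).det_sumElim_ne_zero (L := (mdiff F E 𝒢.src g).toLinearMap)
    (translateRight_injective hy) (mdiff_src_translateRight hy) b (modelFrame f) hw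
  rw [h1] at h2
  exact mul_ne_zero_iff.1 h2

/-- In smooth frames, the factor by which an arrow acts depends smoothly on the arrow. -/
lemma contMDiffAt_signedDet {a b : ∀ x, Basis (Fin 𝒢.rank) ℝ (𝒢.algebroidFiber x)}
    {f h : ∀ x : M, Basis (Fin (finrank ℝ E)) ℝ (TangentSpace 𝓘(ℝ, E) x)} {U U' : Set M}
    (hU : IsOpen U) (hU' : IsOpen U')
    (ha : IsSmoothAlgebroidFrame a U) (hf : IsSmoothObjectFrame f U)
    (hb : IsSmoothAlgebroidFrame b U') (hh : IsSmoothObjectFrame h U') {g : G}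
    (hs : 𝒢.src g ∈ U) (ht : 𝒢.tgt g ∈ U') :
    ContMDiffAt 𝓘(ℝ, F) 𝓘(ℝ, ℝ) ∞
      (fun g => 𝒢.signedDet g (a (𝒢.src g)) (f (𝒢.src g)) (b (𝒢.tgt g)) (h (𝒢.tgt g))) g := by
  obtain ⟨χ, hg⟩ := 𝒢.exists_adaptedChart g
  obtain ⟨χ', hg'⟩ := 𝒢.exists_adaptedChart (𝒢.inv g)
  have h1 := contMDiffAt_invJacobian χ χ' hg hg'
  have h2 : ContMDiffAt 𝓘(ℝ, F) 𝓘(ℝ, ℝ) ∞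
      (fun g => (vertMatrix χ' (𝒢.inv g) (a (𝒢.src g))).det) g := by
    have := (contMDiffAt_vertMatrix χ' hU ha hg' (by rwa [𝒢.tgt_inv])).comp g (𝒢.contMDiff_inv g)
    refine this.congr_of_eventuallyEq (Filter.Eventually.of_forall fun g => ?_)
    simp only [Function.comp_apply]
    rw [𝒢.tgt_inv]
  have hsrc : 𝒢.src g ∈ χ.cod.source := χ.src_mem g hg
  have htgt : 𝒢.tgt g ∈ χ'.cod.source := by
    have := χ'.src_mem _ hg'
    rwa [𝒢.src_inv] at this
  have h3 : ContMDiffAt 𝓘(ℝ, F) 𝓘(ℝ, ℝ) ∞ (fun g => codDet χ' (h (𝒢.tgt g))) g :=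
    (contMDiffAt_codDet χ' hU' hh ht htgt).comp g (𝒢.contMDiff_tgt g)
  have h4 := contMDiffAt_vertMatrix χ hU' hb hg ht
  have h5 : ContMDiffAt 𝓘(ℝ, F) 𝓘(ℝ, ℝ) ∞ (fun g => codDet χ (f (𝒢.src g))) g :=
    (contMDiffAt_codDet χ hU hf hs hsrc).comp g (𝒢.contMDiff_src g)
  have h0 := vertMatrix_det_ne_zero χ hg rfl (b (𝒢.tgt g)) (f (𝒢.src g))
  have h6 := (contMDiffAt_const (c := (-1 : ℝ) ^ 𝒢.rank)).mul
    ((h1.mul (h2.mul h3)).div₀ (h4.mul h5) (mul_ne_zero h0.1 h0.2))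
  refine h6.congr_of_eventuallyEq ?_
  filter_upwards [χ.dom.open_source.mem_nhds hg,
    (χ'.dom.open_source.preimage 𝒢.contMDiff_inv.continuous).mem_nhds hg'] with g' e1 e2
  rw [signedDet, exchangeDetAt_eq_charts χ χ' e1 e2 rfl rfl]
  rfl

end LieGroupoid

/-! ### The transverse bundles are representations -/

namespace LieGroupoid

variable {E F M G : Type*}
  [NormedAddCommGroup E] [NormedSpace ℝ E] [NormedAddCommGroup F] [NormedSpace ℝ F]
  [TopologicalSpace M] [ChartedSpace E M] [TopologicalSpace G] [ChartedSpace F G]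
  [FiniteDimensional ℝ E] [FiniteDimensional ℝ F]
  [IsManifold 𝓘(ℝ, E) ∞ M] [IsManifold 𝓘(ℝ, F) ∞ G] {𝒢 : LieGroupoid E F M G}

/-! #### Local smooth frames -/

lemma exists_algebroidFrame {x : M} {u : Fin 𝒢.rank → F} (hu : LinearIndependent ℝ u)
    (h0 : ∀ i, mdiff F E 𝒢.src (𝒢.one x) (u i) = 0) :
    ∃ a : Basis (Fin 𝒢.rank) ℝ (𝒢.algebroidFiber x), ∀ i, 𝒢.algebroidIncl x (a i) = u i := by
  have : FiniteDimensional ℝ (TangentSpace 𝓘(ℝ, F) (𝒢.one x)) :=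
    inferInstanceAs (FiniteDimensional ℝ F)
  let v : Fin 𝒢.rank → 𝒢.algebroidFiber x := fun i => ⟨u i, h0 i⟩
  have hv : LinearIndependent ℝ v := LinearIndependent.of_comp (𝒢.algebroidIncl x) hu
  refine ⟨Basis.mk hv (hv.span_eq_top_of_card_eq_finrank' ?_).ge, fun i => ?_⟩
  · rw [Fintype.card_fin, 𝒢.finrank_algebroidFiber]
  · rw [Basis.mk_apply]
    rfl

lemma exists_objectFrame (x : M) {u : Fin (finrank ℝ E) → E} (hu : LinearIndependent ℝ u) :
    ∃ f : Basis (Fin (finrank ℝ E)) ℝ (TangentSpace 𝓘(ℝ, E) x), ∀ j, modelFrame f j = u j := by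
  let f : Basis (Fin (finrank ℝ E)) ℝ E :=
    Basis.mk hu (hu.span_eq_top_of_card_eq_finrank' (Fintype.card_fin _)).ge
  refine ⟨f, fun j => ?_⟩
  change f j = u j
  rw [Basis.mk_apply]

/-- The vertical coordinate vectors of an adapted chart at a unit form a smooth frame of the Lie
algebroid. -/
lemma exists_smooth_algebroidFrame (𝒢 : LieGroupoid E F M G) (x₀ : M) :
    ∃ (U : Set M) (a : ∀ x, Basis (Fin 𝒢.rank) ℝ (𝒢.algebroidFiber x)),
      IsOpen U ∧ x₀ ∈ U ∧ IsSmoothAlgebroidFrame a U := by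
  obtain ⟨χ, hx₀⟩ := 𝒢.exists_adaptedChart (𝒢.one x₀)
  let c : Fin 𝒢.rank → F := fun i => χ.equiv.symm (0, Pi.basisFun ℝ _ i)
  let u : M → Fin 𝒢.rank → F := fun x i => mdiff F F χ.dom.symm (χ.dom (𝒢.one x)) (c i)
  set U : Set M := 𝒢.one ⁻¹' χ.dom.source
  have hU : IsOpen U := χ.dom.open_source.preimage 𝒢.contMDiff_one.continuous
  have key : ∀ x ∈ U, ∃ a : Basis (Fin 𝒢.rank) ℝ (𝒢.algebroidFiber x),
      ∀ i, 𝒢.algebroidIncl x (a i) = u x i := by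
    intro x hx
    have h1 : ∀ i, χ.equiv (mdiff F F χ.dom (𝒢.one x) (u x i)) = (0, Pi.basisFun ℝ _ i) := by
      intro i
      rw [mdiff_mdiff_symm χ.dom_mem hx, ContinuousLinearEquiv.apply_symm_apply]
    refine exists_algebroidFrame ?_ fun i => ?_
    · refine LinearIndependent.of_comp ((LinearMap.snd ℝ E (Fin 𝒢.rank → ℝ)) ∘ₗ
        (χ.equiv.toLinearEquiv : F →ₗ[ℝ] E × (Fin 𝒢.rank → ℝ)) ∘ₗ
          (mdiff F F χ.dom (𝒢.one x)).toLinearMap) ?_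
      convert (Pi.basisFun ℝ (Fin 𝒢.rank)).linearIndependent using 1
      funext i
      exact congrArg Prod.snd (h1 i)
    · have h2 := congrArg Prod.fst (h1 i)
      rw [χ.equiv_mdiff_dom hx] at h2
      rw [← mdiff_symm_mdiff χ.cod_mem (χ.src_mem _ hx) (mdiff F E 𝒢.src (𝒢.one x) (u x i))]
      simp only at h2
      rw [h2, map_zero]
  have key' : ∀ x, ∃ a : Basis (Fin 𝒢.rank) ℝ (𝒢.algebroidFiber x),
      x ∈ U → ∀ i, 𝒢.algebroidIncl x (a i) = u x i := by
    intro x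
    by_cases hx : x ∈ U
    · obtain ⟨a, ha⟩ := key x hx
      exact ⟨a, fun _ => ha⟩
    · exact ⟨𝒢.someAlgebroidFrame x, fun h => absurd h hx⟩
  choose a ha using key'
  refine ⟨U, a, hU, hx₀, fun i => ?_⟩
  have h1 : ContMDiffOn 𝓘(ℝ, E) 𝓘(ℝ, F) ∞ (fun x => χ.dom (𝒢.one x)) U :=
    χ.contMDiffOn_dom.comp 𝒢.contMDiff_one.contMDiffOn fun x hx => hx
  have h2 := h1.tangent_mk (contMDiffOn_const (c := c i)) χ.dom.open_target χ.contMDiffOn_dom_symm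
    fun x hx => χ.dom.map_source hx
  refine h2.congr fun x hx => ?_
  have h3 := ha x hx i
  refine (congrArg (fun w : F => (⟨𝒢.one x, w⟩ : TangentBundle 𝓘(ℝ, F) G)) h3).trans ?_
  change (⟨𝒢.one x, u x i⟩ : TangentBundle 𝓘(ℝ, F) G) = ⟨_, u x i⟩
  rw [χ.dom.left_inv hx]

/-- The coordinate vectors of a chart form a smooth frame of the tangent bundle. -/
lemma exists_smooth_objectFrame {φ : OpenPartialHomeomorph M E}
    (hφ : φ ∈ IsManifold.maximalAtlas 𝓘(ℝ, E) ∞ M) :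
    ∃ f : ∀ x : M, Basis (Fin (finrank ℝ E)) ℝ (TangentSpace 𝓘(ℝ, E) x),
      IsSmoothObjectFrame f φ.source ∧
        ∀ x ∈ φ.source, ∀ j, mdiff E E φ x (modelFrame (f x) j) = finBasis ℝ E j := by
  let u : M → Fin (finrank ℝ E) → E := fun x j => mdiff E E φ.symm (φ x) (finBasis ℝ E j)
  have key : ∀ x ∈ φ.source, ∃ f : Basis (Fin (finrank ℝ E)) ℝ (TangentSpace 𝓘(ℝ, E) x),
      ∀ j, modelFrame f j = u x j := by
    intro x hx
    refine exists_objectFrame x (LinearIndependent.of_comp (mdiff E E φ x).toLinearMap ?_)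
    convert (finBasis ℝ E).linearIndependent using 1
    funext j
    exact mdiff_mdiff_symm hφ hx _
  have key' : ∀ x, ∃ f : Basis (Fin (finrank ℝ E)) ℝ (TangentSpace 𝓘(ℝ, E) x),
      x ∈ φ.source → ∀ j, modelFrame f j = u x j := by
    intro x
    by_cases hx : x ∈ φ.source
    · obtain ⟨f, hf⟩ := key x hx
      exact ⟨f, fun _ => hf⟩
    · exact ⟨finBasis ℝ E, fun h => absurd h hx⟩
  choose f hf using key'
  refine ⟨f, fun j => ?_, fun x hx j => ?_⟩
  · have h2 := (contMDiffOn_of_mem_maximalAtlas hφ).tangent_mk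
      (contMDiffOn_const (c := finBasis ℝ E j)) φ.open_target
      (contMDiffOn_symm_of_mem_maximalAtlas hφ) fun x hx => φ.map_source hx
    refine h2.congr fun x hx => ?_
    refine (congrArg (fun w : E => (⟨x, w⟩ : TangentBundle 𝓘(ℝ, E) M)) (hf x hx j)).trans ?_
    change (⟨x, u x j⟩ : TangentBundle 𝓘(ℝ, E) M) = ⟨_, u x j⟩
    rw [φ.left_inv hx]
  · rw [hf x hx]
    exact mdiff_mdiff_symm hφ hx _

/-! #### Coefficients of transverse densities and volumes -/

variable (δ : ℝ →*₀ ℝ) (𝒢) in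
/-- The coefficient of an element of a fibre of the transverse bundle with respect to the element
determined by frames of `A_x` and of `T_x M`. -/
def coeff {x : M} (a : Basis (Fin 𝒢.rank) ℝ (𝒢.algebroidFiber x))
    (f : Basis (Fin (finrank ℝ E)) ℝ (TangentSpace 𝓘(ℝ, E) x)) :
    (𝒢.transverseBundle δ).fiber x →ₗ[ℝ] ℝ := 𝒢.transverseEval δ a.dualBasis f

variable (δ : ℝ →*₀ ℝ) (𝒢) in
/-- The element of a fibre of the transverse bundle determined by frames of `A_x` and of `T_x M`. -/
def unitVector {x : M} (a : Basis (Fin 𝒢.rank) ℝ (𝒢.algebroidFiber x))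
    (f : Basis (Fin (finrank ℝ E)) ℝ (TangentSpace 𝓘(ℝ, E) x)) :
    (𝒢.transverseBundle δ).fiber x := 𝒢.transverseGen δ a.dualBasis f

section Coeff

variable {δ : ℝ →*₀ ℝ} {x : M} (a a' : Basis (Fin 𝒢.rank) ℝ (𝒢.algebroidFiber x))
  (f f' : Basis (Fin (finrank ℝ E)) ℝ (TangentSpace 𝓘(ℝ, E) x))

lemma coeff_smul_unitVector (ξ : (𝒢.transverseBundle δ).fiber x) :
    𝒢.coeff δ a f ξ • 𝒢.unitVector δ a f = ξ := 𝒢.transverseEval_smul_gen δ a.dualBasis f ξ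

/-- As `A` enters through its dual, its frames transform inversely to those of the tangent space. -/
lemma coeff_unitVector_change : 𝒢.coeff δ a f (𝒢.unitVector δ a' f') = δ (a.det a' * f'.det f) :=
  𝒢.transverseEval_gen_change δ a a' f f'

lemma coeff_unitVector : 𝒢.coeff δ a f (𝒢.unitVector δ a f) = 1 :=
  𝒢.transverseEval_gen δ a.dualBasis f

lemma coeff_smul_unitVector_eq (c : ℝ) : 𝒢.coeff δ a f (c • 𝒢.unitVector δ a f) = c := by
  rw [map_smul, coeff_unitVector, smul_eq_mul, _root_.mul_one]

lemma coeff_change (ξ : (𝒢.transverseBundle δ).fiber x) :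
    𝒢.coeff δ a' f' ξ = δ (a'.det a * f.det f') * 𝒢.coeff δ a f ξ := by
  conv_lhs => rw [← coeff_smul_unitVector a f ξ, map_smul, coeff_unitVector_change]
  rw [smul_eq_mul, mul_comm]

lemma unitVector_ne_zero : 𝒢.unitVector δ a f ≠ 0 := by
  intro h
  have := coeff_unitVector (δ := δ) a f
  rw [h, map_zero] at this
  exact zero_ne_one this

lemma coeff_injective : Function.Injective (𝒢.coeff δ a f) := by
  intro ξ η h
  rw [← coeff_smul_unitVector a f ξ, h, coeff_smul_unitVector]

end Coeff

/-- The action of an arrow on the transverse bundle, in frames. -/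
lemma act_eq_iff {δ : ℝ →*₀ ℝ} {g : G} {x y : M} (hx : 𝒢.src g = x) (hy : 𝒢.tgt g = y)
    (a : Basis (Fin 𝒢.rank) ℝ (𝒢.algebroidFiber x))
    (f : Basis (Fin (finrank ℝ E)) ℝ (TangentSpace 𝓘(ℝ, E) x))
    (b : Basis (Fin 𝒢.rank) ℝ (𝒢.algebroidFiber y))
    (h : Basis (Fin (finrank ℝ E)) ℝ (TangentSpace 𝓘(ℝ, E) y))
    (σ τ : ∀ x, (𝒢.transverseBundle δ).fiber x) :
    (𝒢.transverseBundle δ).act g (σ (𝒢.src g)) = τ (𝒢.tgt g) ↔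
      δ (𝒢.signedDet g a f b h) * 𝒢.coeff δ a f (σ x) = 𝒢.coeff δ b h (τ y) := by
  subst hx hy
  set a₀ := 𝒢.someAlgebroidFrame (𝒢.src g)
  set f₀ := 𝒢.someObjectFrame (𝒢.src g)
  set b₀ := 𝒢.someAlgebroidFrame (𝒢.tgt g)
  set h₀ := 𝒢.someObjectFrame (𝒢.tgt g)
  have e : (𝒢.transverseBundle δ).act g (σ (𝒢.src g)) =
      𝒢.coeff δ a₀ f₀ (σ (𝒢.src g)) • δ (𝒢.signedDet g a₀ f₀ b₀ h₀) • 𝒢.unitVector δ b₀ h₀ := rfl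
  rw [← (coeff_injective b h).eq_iff, e, map_smul, map_smul, coeff_unitVector_change,
    coeff_change a₀ a f₀ f, signedDet_change rfl rfl a₀ a f₀ f b₀ b h₀ h]
  simp only [smul_eq_mul]
  rw [← _root_.mul_assoc (δ (_ / _)), ← map_mul δ (_ / _)]
  have h1 := (b₀.isUnit_det b).ne_zero
  have h2 := (f₀.isUnit_det f).ne_zero
  have h3 : 𝒢.signedDet g a₀ f₀ b₀ h₀ * (a₀.det a * h₀.det h) / (b₀.det b * f₀.det f) *
      (a.det a₀ * f₀.det f) = 𝒢.signedDet g a₀ f₀ b₀ h₀ * (b.det b₀ * h₀.det h) := by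
    have h4 := (a₀.isUnit_det a).ne_zero
    rw [Basis.det_swap a₀ a, Basis.det_swap b₀ b]
    field_simp
  rw [h3, map_mul δ (𝒢.signedDet g a₀ f₀ b₀ h₀)]
  refine Eq.congr ?_ rfl
  ring

/-! #### The axioms of a representation -/

variable {δ : ℝ →*₀ ℝ}

lemma mem_frames_iff {e : Set M × (∀ x, (𝒢.transverseBundle δ).fiber x)} :
    e ∈ (𝒢.transverseBundle δ).frames ↔ IsOpen e.1 ∧
      ∃ (a : ∀ x, Basis (Fin 𝒢.rank) ℝ (𝒢.algebroidFiber x))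
        (f : ∀ x, Basis (Fin (finrank ℝ E)) ℝ (TangentSpace 𝓘(ℝ, E) x)),
        IsSmoothAlgebroidFrame a e.1 ∧ IsSmoothObjectFrame f e.1 ∧
          ∀ x ∈ e.1, e.2 x = 𝒢.unitVector δ (a x) (f x) := Iff.rfl

/-- The characters `δ` of interest are smooth away from zero, and are applied to determinants of
changes of frames only. -/
lemma contMDiffAt_comp_of_ne_zero (hδ : ContDiffOn ℝ ∞ δ {0}ᶜ) {H N : Type*} [NormedAddCommGroup H]
    [NormedSpace ℝ H] [TopologicalSpace N] [ChartedSpace H N] {c : N → ℝ} {x : N}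
    (hc : ContMDiffAt 𝓘(ℝ, H) 𝓘(ℝ, ℝ) ∞ c x) (h0 : c x ≠ 0) :
    ContMDiffAt 𝓘(ℝ, H) 𝓘(ℝ, ℝ) ∞ (fun y => δ (c y)) x :=
  ContMDiffAt.comp x (g := δ)
    (hδ.contDiffAt (isOpen_compl_singleton.mem_nhds h0)).contMDiffAt hc

/-- The transition functions of local frames are the coefficients of the action of the units. -/
lemma contMDiffAt_coeff_unitVector (hδ : ContDiffOn ℝ ∞ δ {0}ᶜ)
    {a a' : ∀ x, Basis (Fin 𝒢.rank) ℝ (𝒢.algebroidFiber x)}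
    {f f' : ∀ x : M, Basis (Fin (finrank ℝ E)) ℝ (TangentSpace 𝓘(ℝ, E) x)} {U U' : Set M}
    (hU : IsOpen U) (hU' : IsOpen U')
    (ha : IsSmoothAlgebroidFrame a U) (hf : IsSmoothObjectFrame f U)
    (ha' : IsSmoothAlgebroidFrame a' U') (hf' : IsSmoothObjectFrame f' U') {x : M}
    (hx : x ∈ U) (hx' : x ∈ U') :
    ContMDiffAt 𝓘(ℝ, E) 𝓘(ℝ, ℝ) ∞
      (fun x => 𝒢.coeff δ (a x) (f x) (𝒢.unitVector δ (a' x) (f' x))) x := by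
  have h1 := (contMDiffAt_signedDet hU' hU ha' hf' ha hf (g := 𝒢.one x) (by rwa [𝒢.src_one])
    (by rwa [𝒢.tgt_one])).comp x (𝒢.contMDiff_one x)
  have h2 : ∀ y, 𝒢.signedDet (𝒢.one y) (a' (𝒢.src (𝒢.one y))) (f' (𝒢.src (𝒢.one y)))
      (a (𝒢.tgt (𝒢.one y))) (f (𝒢.tgt (𝒢.one y))) = (a y).det (a' y) * (f' y).det (f y) := by
    intro y
    rw [𝒢.src_one, 𝒢.tgt_one, signedDet_change (𝒢.src_one y) (𝒢.tgt_one y) (a y) (a' y) (f' y)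
      (f' y) (a y) (a y) (f' y) (f y), signedDet_one,
      Basis.det_self, Basis.det_self, _root_.mul_one, div_one, _root_.one_mul]
  refine (contMDiffAt_comp_of_ne_zero hδ h1
    (signedDet_ne_zero rfl rfl _ _ _ _)).congr_of_eventuallyEq
    (Filter.Eventually.of_forall fun y => ?_)
  simp only [Function.comp_apply]
  rw [h2, coeff_unitVector_change]

/-- The transverse bundle of a character `δ` of `ℝ` that is smooth away from zero is a
representation: arrows act by `δ` of the multiplicative function `signedDet`. -/
theorem isRepresentation_transverseBundle (hδ : ContDiffOn ℝ ∞ δ {0}ᶜ) :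
    (𝒢.transverseBundle δ).IsRepresentation where
  finrank_fiber x := 𝒢.finrank_transverseFiber δ x
  isOpen_frame e he := he.1
  frame_ne_zero e he x hx := by
    obtain ⟨-, a, f, -, -, h⟩ := mem_frames_iff.1 he
    rw [h x hx]
    exact unitVector_ne_zero _ _
  frames_cover x := by
    obtain ⟨U, a, hU, hx, ha⟩ := exists_smooth_algebroidFrame 𝒢 x
    obtain ⟨f, hf, -⟩ := exists_smooth_objectFrame (IsManifold.chart_mem_maximalAtlas (I := 𝓘(ℝ, E))
      (n := ∞) x)
    refine ⟨(U ∩ (chartAt E x).source, fun x => 𝒢.unitVector δ (a x) (f x)), mem_frames_iff.2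
      ⟨hU.inter (chartAt E x).open_source, a, f, fun i => (ha i).mono Set.inter_subset_left,
      fun j => (hf j).mono Set.inter_subset_right, fun _ _ => rfl⟩, hx, mem_chart_source E x⟩
  contMDiffOn_transition := by
    intro e he e' he' c hc
    obtain ⟨hU, a, f, ha, hf, h⟩ := mem_frames_iff.1 he
    obtain ⟨hU', a', f', ha', hf', h'⟩ := mem_frames_iff.1 he'
    refine ContMDiffOn.congr (f := fun x => 𝒢.coeff δ (a x) (f x) (𝒢.unitVector δ (a' x) (f' x)))
      (fun x hx => (contMDiffAt_coeff_unitVector hδ hU hU' ha hf ha' hf' hx.1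
        hx.2).contMDiffWithinAt) fun x hx => ?_
    rw [← h' x hx.2, hc x hx, h x hx.1, coeff_smul_unitVector_eq]
  contMDiffOn_act := by
    intro e he e' he' c hc
    obtain ⟨hU, a, f, ha, hf, h⟩ := mem_frames_iff.1 he
    obtain ⟨hU', b, k, hb, hk, h'⟩ := mem_frames_iff.1 he'
    refine ContMDiffOn.congr (f := fun g => δ (𝒢.signedDet g (a (𝒢.src g)) (f (𝒢.src g))
      (b (𝒢.tgt g)) (k (𝒢.tgt g)))) (fun g hg => (contMDiffAt_comp_of_ne_zero hδ
        (contMDiffAt_signedDet hU hU' ha hf hb hk hg.1 hg.2)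
        (signedDet_ne_zero rfl rfl _ _ _ _)).contMDiffWithinAt) fun g hg => ?_
    have h1 := (act_eq_iff rfl rfl (a (𝒢.src g)) (f (𝒢.src g)) (b (𝒢.tgt g)) (k (𝒢.tgt g)) e.2
      (c g • e'.2)).1 (hc g hg)
    rw [Pi.smul_apply, h _ hg.1, h' _ hg.2, coeff_unitVector, coeff_smul_unitVector_eq,
      _root_.mul_one] at h1
    exact h1.symm
  act_one x σ := by
    rw [act_eq_iff (𝒢.src_one x) (𝒢.tgt_one x) (𝒢.someAlgebroidFrame x) (𝒢.someObjectFrame x)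
      (𝒢.someAlgebroidFrame x) (𝒢.someObjectFrame x), signedDet_one, map_one, _root_.one_mul]
  act_mul g h hgh σ τ ρ h₁ h₂ := by
    have h₁' := (act_eq_iff rfl hgh.symm (𝒢.someAlgebroidFrame _) (𝒢.someObjectFrame _)
      (𝒢.someAlgebroidFrame (𝒢.src g)) (𝒢.someObjectFrame (𝒢.src g)) _ _).1 h₁
    have h₂' := (act_eq_iff rfl rfl (𝒢.someAlgebroidFrame _) (𝒢.someObjectFrame _)
      (𝒢.someAlgebroidFrame (𝒢.tgt g)) (𝒢.someObjectFrame (𝒢.tgt g)) _ _).1 h₂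
    rw [act_eq_iff (𝒢.src_mul g h hgh) (𝒢.tgt_mul g h hgh) (𝒢.someAlgebroidFrame _)
      (𝒢.someObjectFrame _) (𝒢.someAlgebroidFrame _) (𝒢.someObjectFrame _),
      signedDet_mul rfl rfl rfl hgh.symm _ _ (𝒢.someAlgebroidFrame _) (𝒢.someObjectFrame _),
      map_mul, _root_.mul_assoc, h₁', h₂']

lemma contDiffOn_absHom : ContDiffOn ℝ ∞ (absHom : ℝ →*₀ ℝ) {0}ᶜ := fun _ hx =>
  (contDiffAt_abs hx).contDiffWithinAt

theorem isRepresentation_transverseVolume : 𝒢.transverseVolume.IsRepresentation :=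
  isRepresentation_transverseBundle contDiff_id.contDiffOn

theorem isRepresentation_transverseDensity : 𝒢.transverseDensity.IsRepresentation :=
  isRepresentation_transverseBundle contDiffOn_absHom

end LieGroupoid

/-! ### The modular class -/

namespace LieGroupoid

variable {E F M G : Type*}
  [NormedAddCommGroup E] [NormedSpace ℝ E] [NormedAddCommGroup F] [NormedSpace ℝ F]
  [TopologicalSpace M] [ChartedSpace E M] [TopologicalSpace G] [ChartedSpace F G]
  [FiniteDimensional ℝ E] [FiniteDimensional ℝ F]
  [IsManifold 𝓘(ℝ, E) ∞ M] [IsManifold 𝓘(ℝ, F) ∞ G] {𝒢 : LieGroupoid E F M G}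

/-- A section is smooth if its coefficients with respect to smooth frames of `A` and `TM` are. -/
lemma isSmoothSection_of_coeff {δ : ℝ →*₀ ℝ} {σ : ∀ x, (𝒢.transverseBundle δ).fiber x}
    (h : ∀ (U : Set M) (a : ∀ x, Basis (Fin 𝒢.rank) ℝ (𝒢.algebroidFiber x))
      (f : ∀ x : M, Basis (Fin (finrank ℝ E)) ℝ (TangentSpace 𝓘(ℝ, E) x)), IsOpen U →
      IsSmoothAlgebroidFrame a U → IsSmoothObjectFrame f U →
      ContMDiffOn 𝓘(ℝ, E) 𝓘(ℝ, ℝ) ∞ (fun x => 𝒢.coeff δ (a x) (f x) (σ x)) U) :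
    (𝒢.transverseBundle δ).IsSmoothSection σ := by
  intro e he c hc
  obtain ⟨hU, a, f, ha, hf, h'⟩ := mem_frames_iff.1 he
  refine (h e.1 a f hU ha hf).congr fun x hx => ?_
  rw [hc x hx, h' x hx, coeff_smul_unitVector_eq]

lemma _root_.LieGroupoid.LineRepData.IsSmoothSection.coeff {δ : ℝ →*₀ ℝ}
    {σ : ∀ x, (𝒢.transverseBundle δ).fiber x} (hσ : (𝒢.transverseBundle δ).IsSmoothSection σ)
    {U : Set M} {a : ∀ x, Basis (Fin 𝒢.rank) ℝ (𝒢.algebroidFiber x)}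
    {f : ∀ x : M, Basis (Fin (finrank ℝ E)) ℝ (TangentSpace 𝓘(ℝ, E) x)} (hU : IsOpen U)
    (ha : IsSmoothAlgebroidFrame a U) (hf : IsSmoothObjectFrame f U) :
    ContMDiffOn 𝓘(ℝ, E) 𝓘(ℝ, ℝ) ∞ (fun x => 𝒢.coeff δ (a x) (f x) (σ x)) U :=
  hσ (U, fun x => 𝒢.unitVector δ (a x) (f x))
    (mem_frames_iff.2 ⟨hU, a, f, ha, hf, fun _ _ => rfl⟩) _
    fun _ _ => (coeff_smul_unitVector _ _ _).symm

lemma coeff_abs_unitVector_pos {x : M} (a a' : Basis (Fin 𝒢.rank) ℝ (𝒢.algebroidFiber x))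
    (f f' : Basis (Fin (finrank ℝ E)) ℝ (TangentSpace 𝓘(ℝ, E) x)) :
    0 < 𝒢.coeff absHom a f (𝒢.unitVector absHom a' f') := by
  rw [coeff_unitVector_change]
  exact abs_pos.2 (mul_ne_zero (a.isUnit_det a').ne_zero (f'.isUnit_det f).ne_zero)

lemma isPositiveSection_of_coeff {σ : ∀ x, (𝒢.transverseBundle absHom).fiber x}
    (h : ∀ x, ∃ (a : Basis (Fin 𝒢.rank) ℝ (𝒢.algebroidFiber x))
      (f : Basis (Fin (finrank ℝ E)) ℝ (TangentSpace 𝓘(ℝ, E) x)),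
      0 < 𝒢.coeff absHom a f (σ x)) : 𝒢.IsPositiveSection σ := by
  intro x α f'
  obtain ⟨a, f, h0⟩ := h x
  change 0 < 𝒢.transverseEval absHom α f' (show 𝒢.TransverseFiber absHom x from σ x)
  rw [𝒢.transverseEval_change absHom a.dualBasis α f f']
  exact mul_pos (abs_pos.2 (mul_ne_zero (a.dualBasis.isUnit_det α).ne_zero
    (f.isUnit_det f').ne_zero)) h0

lemma IsPositiveSection.coeff_pos {σ : ∀ x, (𝒢.transverseBundle absHom).fiber x}
    (h : 𝒢.IsPositiveSection σ) {x : M} (a : Basis (Fin 𝒢.rank) ℝ (𝒢.algebroidFiber x))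
    (f : Basis (Fin (finrank ℝ E)) ℝ (TangentSpace 𝓘(ℝ, E) x)) :
    0 < 𝒢.coeff absHom a f (σ x) := h x a.dualBasis f

lemma IsPositiveSection.ne_zero {σ : ∀ x, (𝒢.transverseBundle absHom).fiber x}
    (h : 𝒢.IsPositiveSection σ) (x : M) : σ x ≠ 0 := by
  intro h0
  have h1 := h.coeff_pos (𝒢.someAlgebroidFrame x) (𝒢.someObjectFrame x)
  rw [h0] at h1
  exact h1.ne' (map_zero (𝒢.coeff absHom (𝒢.someAlgebroidFrame x) (𝒢.someObjectFrame x)))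

/-- Local positive sections are glued with a partition of unity. -/
lemma exists_isPositiveSection [T2Space M] [SecondCountableTopology M]
    (𝒢 : LieGroupoid E F M G) :
    ∃ σ, (𝒢.transverseBundle absHom).IsSmoothSection σ ∧ 𝒢.IsPositiveSection σ := by
  have : LocallyCompactSpace M := ChartedSpace.locallyCompactSpace E M
  choose U a hU hxU ha using exists_smooth_algebroidFrame 𝒢
  choose f hf _ using fun x : M => exists_smooth_objectFrame
    (IsManifold.chart_mem_maximalAtlas (I := 𝓘(ℝ, E)) (n := ∞) x)
  set W : M → Set M := fun i => U i ∩ (chartAt E i).source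
  have hW : ∀ i, IsOpen (W i) := fun i => (hU i).inter (chartAt E i).open_source
  have haW : ∀ i, IsSmoothAlgebroidFrame (a i) (W i) := fun i j =>
    (ha i j).mono Set.inter_subset_left
  have hfW : ∀ i, IsSmoothObjectFrame (f i) (W i) := fun i j =>
    (hf i j).mono Set.inter_subset_right
  obtain ⟨ρ, hρ⟩ := SmoothPartitionOfUnity.exists_isSubordinate 𝓘(ℝ, E) isClosed_univ W hW
    fun x _ => Set.mem_iUnion.2 ⟨x, hxU x, mem_chart_source E x⟩
  let s : M → ∀ x, (𝒢.transverseBundle absHom).fiber x := fun i x =>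
    𝒢.unitVector absHom (a i x) (f i x)
  let σ : ∀ x, (𝒢.transverseBundle absHom).fiber x := fun x => ∑ᶠ i, ρ i x • s i x
  have hσ : ∀ (x : M) (b : Basis (Fin 𝒢.rank) ℝ (𝒢.algebroidFiber x))
      (h : Basis (Fin (finrank ℝ E)) ℝ (TangentSpace 𝓘(ℝ, E) x)),
      𝒢.coeff absHom b h (σ x) = ∑ᶠ i, ρ i x • 𝒢.coeff absHom b h (s i x) := by
    intro x b h
    have hfin : (Function.support fun i => ρ i x • s i x).Finite := by
      refine (ρ.locallyFinite.point_finite x).subset fun i hi => ?_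
      intro h0
      exact hi (by simp only [h0, zero_smul])
    refine ((𝒢.coeff absHom b h).toAddMonoidHom.map_finsum hfin).trans ?_
    exact finsum_congr fun i => (𝒢.coeff absHom b h).map_smul (ρ i x) (s i x)
  refine ⟨σ, isSmoothSection_of_coeff fun V b h hV hb hh => ?_, isPositiveSection_of_coeff
    fun x => ⟨𝒢.someAlgebroidFrame x, 𝒢.someObjectFrame x, ?_⟩⟩
  · simp only [hσ]
    intro x hx
    refine (ρ.contMDiffAt_finsum fun i hi => ?_).contMDiffWithinAt
    exact contMDiffAt_coeff_unitVector contDiffOn_absHom hV (hW i) hb hh (haW i) (hfW i) hx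
      (hρ i hi)
  · refine (hσ x _ _).symm ▸ ?_
    exact ρ.finsum_smul_mem_convex (t := Set.Ioi 0) (Set.mem_univ x)
      (g := fun i x => 𝒢.coeff absHom (𝒢.someAlgebroidFrame x) (𝒢.someObjectFrame x) (s i x))
      (fun i _ => coeff_abs_unitVector_pos _ _ _ _) (convex_Ioi 0)

section ModularClass

variable {σ : ∀ x, (𝒢.transverseBundle absHom).fiber x}

/-- A positive smooth section of the density bundle computes the modular class. -/
lemma isModularClass (hσ : (𝒢.transverseBundle absHom).IsSmoothSection σ)
    (hσ0 : 𝒢.IsPositiveSection σ) {c : 𝒢.cocycles} (hc : ∀ g, c.1 g =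
      Real.log |lineRatio (σ (𝒢.tgt g)) ((𝒢.transverseBundle absHom).act g (σ (𝒢.src g)))|) :
    𝒢.IsModularClass (𝒢.cohomologyClass c) := by
  refine ⟨⟨σ, hσ, hσ0⟩, fun σ' hσ' hσ0' => ?_⟩
  obtain ⟨c', hc', hcc⟩ := (isRepresentation_transverseDensity.isTrivialCharClass hσ hσ0.ne_zero
    hc).2 σ' hσ' hσ0'.ne_zero
  exact ⟨c', fun g => by rw [hc', Real.log_abs], hcc⟩

lemma IsModularClass.unique {κ κ' : 𝒢.H1} (h : 𝒢.IsModularClass κ) (h' : 𝒢.IsModularClass κ') :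
    κ = κ' := by
  obtain ⟨⟨σ, hσ, hσ0⟩, h⟩ := h
  obtain ⟨c, hc, rfl⟩ := h σ hσ hσ0
  obtain ⟨c', hc', rfl⟩ := h'.2 σ hσ hσ0
  congr 1
  ext g
  rw [hc, hc']

/-- The square of a transverse density, as a section of the tensor square of the transverse volume
bundle. -/
def squareSection (σ : ∀ x, (𝒢.transverseBundle absHom).fiber x) (x : M) :
    (𝒢.transverseBundle (MonoidWithZeroHom.id ℝ)).tensorSquare.fiber x :=
  𝒢.coeff absHom (𝒢.someAlgebroidFrame x) (𝒢.someObjectFrame x) (σ x) ^ 2 •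
    (𝒢.unitVector (MonoidWithZeroHom.id ℝ) (𝒢.someAlgebroidFrame x) (𝒢.someObjectFrame x) ⊗ₜ[ℝ]
      𝒢.unitVector (MonoidWithZeroHom.id ℝ) (𝒢.someAlgebroidFrame x) (𝒢.someObjectFrame x))

/-- The square of a density does not depend on the frames: its coefficient changes by `|d|²` and
`unitVector ⊗ unitVector` by `d²`. -/
lemma squareSection_eq (σ : ∀ x, (𝒢.transverseBundle absHom).fiber x) {x : M}
    (a : Basis (Fin 𝒢.rank) ℝ (𝒢.algebroidFiber x))
    (f : Basis (Fin (finrank ℝ E)) ℝ (TangentSpace 𝓘(ℝ, E) x)) :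
    squareSection σ x = 𝒢.coeff absHom a f (σ x) ^ 2 •
      (𝒢.unitVector (MonoidWithZeroHom.id ℝ) a f ⊗ₜ[ℝ]
        𝒢.unitVector (MonoidWithZeroHom.id ℝ) a f) := by
  rw [squareSection, ← coeff_smul_unitVector a f (𝒢.unitVector (MonoidWithZeroHom.id ℝ)
    (𝒢.someAlgebroidFrame x) (𝒢.someObjectFrame x)), coeff_unitVector_change,
    coeff_change (𝒢.someAlgebroidFrame x) a (𝒢.someObjectFrame x) f, TensorProduct.smul_tmul_smul,
    smul_smul, mul_pow]
  congr 1
  change _ = |_| ^ 2 * _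
  rw [sq_abs]
  simp only [MonoidWithZeroHom.id_apply]
  ring

lemma squareSection_ne_zero (hσ0 : 𝒢.IsPositiveSection σ) (x : M) : squareSection σ x ≠ 0 :=
  smul_ne_zero (pow_ne_zero 2 (hσ0.coeff_pos _ _).ne') (tmul_self_ne_zero (unitVector_ne_zero _ _))

lemma isSmoothSection_squareSection (hσ : (𝒢.transverseBundle absHom).IsSmoothSection σ) :
    (𝒢.transverseBundle (MonoidWithZeroHom.id ℝ)).tensorSquare.IsSmoothSection
      (squareSection σ) := by
  rintro _ ⟨e, he, rfl⟩ c hc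
  obtain ⟨hU, a, f, ha, hf, h⟩ := mem_frames_iff.1 he
  have h1 := LineRepData.IsSmoothSection.coeff hσ hU ha hf
  refine (h1.mul h1).congr fun x hx => ?_
  have h2 := hc x hx
  simp only [h x hx] at h2
  rw [squareSection_eq σ (a x) (f x)] at h2
  have h3 := smul_left_injective ℝ (tmul_self_ne_zero (unitVector_ne_zero
    (δ := MonoidWithZeroHom.id ℝ) (a x) (f x))) h2
  rw [← h3, sq]
  rfl

/-- An arrow acts on transverse volumes by `d = signedDet` and on densities by `|d|`, and
`d² = |d|²`. -/
lemma act_squareSection {g : G} {r : ℝ}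
    (hr : (𝒢.transverseBundle absHom).act g (σ (𝒢.src g)) = r • σ (𝒢.tgt g)) :
    (𝒢.transverseBundle (MonoidWithZeroHom.id ℝ)).tensorSquare.act g (squareSection σ (𝒢.src g)) =
      r ^ 2 • squareSection σ (𝒢.tgt g) := by
  set a := fun x => 𝒢.someAlgebroidFrame x
  set f := fun x : M => 𝒢.someObjectFrame x
  set d := 𝒢.signedDet g (a (𝒢.src g)) (f (𝒢.src g)) (a (𝒢.tgt g)) (f (𝒢.tgt g))
  set u : ∀ x, (𝒢.transverseBundle (MonoidWithZeroHom.id ℝ)).fiber x := fun x =>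
    𝒢.unitVector (MonoidWithZeroHom.id ℝ) (a x) (f x)
  have h1 : (𝒢.transverseBundle (MonoidWithZeroHom.id ℝ)).act g (u (𝒢.src g)) =
      (d • u) (𝒢.tgt g) := by
    refine (act_eq_iff rfl rfl (a (𝒢.src g)) (f (𝒢.src g)) (a (𝒢.tgt g)) (f (𝒢.tgt g)) u
      (d • u)).2 ?_
    rw [Pi.smul_apply]
    exact (congrArg _ (coeff_unitVector _ _)).trans
      ((_root_.mul_one d).trans (coeff_smul_unitVector_eq _ _ d).symm)
  have h2 : |d| * 𝒢.coeff absHom (a (𝒢.src g)) (f (𝒢.src g)) (σ (𝒢.src g)) =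
      r * 𝒢.coeff absHom (a (𝒢.tgt g)) (f (𝒢.tgt g)) (σ (𝒢.tgt g)) := by
    refine ((act_eq_iff rfl rfl (a (𝒢.src g)) (f (𝒢.src g)) (a (𝒢.tgt g)) (f (𝒢.tgt g)) σ
      (r • σ)).1 hr).trans ?_
    exact (𝒢.coeff absHom _ _).map_smul _ _
  have h3 : (𝒢.transverseBundle (MonoidWithZeroHom.id ℝ)).tensorSquare.act g
      (u (𝒢.src g) ⊗ₜ[ℝ] u (𝒢.src g)) = (d * d) • (u (𝒢.tgt g) ⊗ₜ[ℝ] u (𝒢.tgt g)) := by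
    change (𝒢.transverseBundle (MonoidWithZeroHom.id ℝ)).act g (u (𝒢.src g)) ⊗ₜ[ℝ]
      (𝒢.transverseBundle (MonoidWithZeroHom.id ℝ)).act g (u (𝒢.src g)) = _
    rw [h1, Pi.smul_apply, TensorProduct.smul_tmul_smul]
  refine (((𝒢.transverseBundle (MonoidWithZeroHom.id ℝ)).tensorSquare.act g).map_smul _ _).trans ?_
  refine (congrArg _ h3).trans ?_
  have key (p q s t : ℝ) (h : p * q = s * t)
      (v : (𝒢.transverseBundle (MonoidWithZeroHom.id ℝ)).tensorSquare.fiber (𝒢.tgt g)) :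
      p • q • v = s • t • v := by
    rw [smul_smul, smul_smul, h]
  refine key _ _ _ _ ?_ _
  have h4 := congrArg (· ^ 2) h2
  simp only [mul_pow, sq_abs] at h4
  rw [← h4]
  ring

/-- The modular class and the characteristic class of the transverse volume bundle are computed by
the same positive density `σ`: its square is a section of the tensor square of the volume bundle,
whose cocycle is twice that of `σ`. -/
theorem modularClass_eq_charClass [T2Space M] [SecondCountableTopology M]
    (𝒢 : LieGroupoid E F M G) :
    𝒢.IsModularClass 𝒢.modularClass ∧
      𝒢.transverseVolume.tensorSquare.IsTrivialCharClass
        𝒢.transverseVolume.tensorSquare.trivialCharClass ∧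
      𝒢.modularClass = 𝒢.transverseVolume.charClass := by
  obtain ⟨σ, hσ, hσ0⟩ := exists_isPositiveSection 𝒢
  have hD : (𝒢.transverseBundle absHom).IsRepresentation := isRepresentation_transverseDensity
  have hV : (𝒢.transverseBundle (MonoidWithZeroHom.id ℝ)).tensorSquare.IsRepresentation :=
    isRepresentation_transverseVolume.tensorSquare
  obtain ⟨c, hc⟩ := hD.exists_cocycle hσ hσ0.ne_zero
  obtain ⟨r, hr, -, -, -⟩ := hD.exists_factor hσ0.ne_zero
  have h2c : ∀ g, ((2 : ℝ) • c).1 g = Real.log |lineRatio (squareSection σ (𝒢.tgt g))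
      ((𝒢.transverseBundle (MonoidWithZeroHom.id ℝ)).tensorSquare.act g
        (squareSection σ (𝒢.src g)))| := by
    intro g
    change (2 : ℝ) * c.1 g = _
    rw [hc, hD.lineRatio_eq_inv hσ0.ne_zero (hr g),
      hV.lineRatio_eq_inv (squareSection_ne_zero hσ0) (act_squareSection (hr g)), Real.log_abs,
      Real.log_abs, Real.log_inv, Real.log_inv, Real.log_pow]
    push_cast
    ring
  have h1 := isModularClass hσ hσ0 hc
  have h2 := hV.isTrivialCharClass (isSmoothSection_squareSection hσ) (squareSection_ne_zero hσ0)
    h2c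
  have h1' : 𝒢.IsModularClass 𝒢.modularClass := Classical.epsilon_spec ⟨_, h1⟩
  have h2' : 𝒢.transverseVolume.tensorSquare.IsTrivialCharClass
      𝒢.transverseVolume.tensorSquare.trivialCharClass := Classical.epsilon_spec ⟨_, h2⟩
  refine ⟨h1', h2', ?_⟩
  rw [LineRepData.charClass, ← h2.unique h2', h1'.unique h1]
  change _ = (1 / 2 : ℝ) • ((2 : ℝ) • 𝒢.cohomologyClass c)
  rw [smul_smul]
  norm_num

end ModularClass

end LieGroupoid

/-! ### Manifolds as groupoids with unit arrows only -/

section UnitGroupoid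

variable {E M : Type*} [NormedAddCommGroup E] [NormedSpace ℝ E] [FiniteDimensional ℝ E]
  [TopologicalSpace M] [ChartedSpace E M] [IsManifold 𝓘(ℝ, E) ∞ M]

/-- A cocycle vanishes on units, hence everywhere if there are only unit arrows. -/
lemma unitGroupoid_H1_eq_zero [T2Space M] (κ : (unitGroupoid E M).H1) : κ = 0 := by
  obtain ⟨c, rfl⟩ := Submodule.Quotient.mk_surjective _ κ
  have hc : c = 0 := by
    ext g
    have h : c.1 g = c.1 g + c.1 g := c.2 g g rfl
    exact left_eq_add.1 h
  rw [hc]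
  rfl

/-- The determinant of the coordinates of a frame of `T_x M` in a chart. -/
def chartDet (φ : OpenPartialHomeomorph M E) {x : M}
    (f : Basis (Fin (finrank ℝ E)) ℝ (TangentSpace 𝓘(ℝ, E) x)) : ℝ :=
  (finBasis ℝ E).det fun j => mdiff E E φ x (LieGroupoid.modelFrame f j)

lemma chartDet_change (φ : OpenPartialHomeomorph M E) {x : M}
    (f f' : Basis (Fin (finrank ℝ E)) ℝ (TangentSpace 𝓘(ℝ, E) x)) :
    chartDet φ f' = chartDet φ f * f.det f' :=
  DFunLike.congr_fun (AlternatingMap.eq_smul_basis_det (LieGroupoid.modelFrame f)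
    ((finBasis ℝ E).det.compLinearMap (mdiff E E φ x).toLinearMap))
    (fun j => LieGroupoid.modelFrame f' j)

/-- The chain rule for the coordinates of a frame. -/
lemma chartDet_comp {φ ψ : OpenPartialHomeomorph M E} {x : M} (J : E →L[ℝ] E)
    (h : mdiff E E ψ x = J.comp (mdiff E E φ x))
    (f : Basis (Fin (finrank ℝ E)) ℝ (TangentSpace 𝓘(ℝ, E) x)) :
    chartDet ψ f = J.det * chartDet φ f := by
  rw [chartDet, h]
  exact (finBasis ℝ E).det_comp J.toLinearMap _

/-- The Jacobian determinant at `x` of the transition map from `φ` to `ψ`. -/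
def transitionDet (φ ψ : OpenPartialHomeomorph M E) (x : M) : ℝ :=
  (fderiv ℝ (φ.symm.trans ψ) (φ x)).det

lemma chartDet_eq_transitionDet_mul {φ ψ : OpenPartialHomeomorph M E}
    (hφ : φ ∈ IsManifold.maximalAtlas 𝓘(ℝ, E) ∞ M) (hψ : ψ ∈ IsManifold.maximalAtlas 𝓘(ℝ, E) ∞ M)
    {x : M} (hx : x ∈ φ.source) (hx' : x ∈ ψ.source)
    (f : Basis (Fin (finrank ℝ E)) ℝ (TangentSpace 𝓘(ℝ, E) x)) :
    chartDet ψ f = transitionDet φ ψ x * chartDet φ f := by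
  refine chartDet_comp _ ?_ f
  have h1 := mdiff_comp (f := φ.symm) (f' := ψ) (p := φ x)
    (by rw [φ.left_inv hx]; exact mdifferentiableAt_chart hψ hx')
    (mdifferentiableAt_chart_symm hφ (φ.map_source hx))
  rw [mdiff_eq_fderiv, φ.left_inv hx] at h1
  change _ = (fderiv ℝ (ψ ∘ φ.symm) (φ x)).comp _
  rw [h1]
  ext v
  simp only [ContinuousLinearMap.comp_apply, mdiff_symm_mdiff hφ hx v]

/-- The reflection in a coordinate hyperplane. -/
lemma exists_continuousLinearEquiv_det_eq_neg_one (h : 0 < finrank ℝ E) :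
    ∃ ρ : E ≃L[ℝ] E, ρ.toContinuousLinearMap.det = -1 := by
  let b := finBasis ℝ E
  let w : Fin (finrank ℝ E) → ℝˣ := Function.update 1 ⟨0, h⟩ (-1)
  let ρ : E ≃ₗ[ℝ] E := b.equiv (b.unitsSMul w) (Equiv.refl _)
  refine ⟨ρ.toContinuousLinearEquiv, ?_⟩
  have h1 := b.det_comp ρ.toLinearMap b
  rw [b.det_self, mul_one] at h1
  have h2 : (ρ.toLinearMap ∘ b : Fin (finrank ℝ E) → E) = b.unitsSMul w := by
    funext i
    exact b.equiv_apply i (b.unitsSMul w) (Equiv.refl _)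
  rw [h2, b.det_unitsSMul_self] at h1
  refine h1.symm.trans ?_
  rw [← Units.coe_prod, Finset.prod_update_of_mem (Finset.mem_univ _)]
  simp

/-- A manifold is orientable if there is a nowhere vanishing function `w` on its frames which
changes by the determinant under a change of frame and is continuous along smooth frames: the
charts whose coordinate frames are positive cover the manifold, as coordinate frames of constant
sign can be reflected. -/
lemma isOrientableManifold_of_frameFunction
    (w : ∀ x : M, Basis (Fin (finrank ℝ E)) ℝ (TangentSpace 𝓘(ℝ, E) x) → ℝ)
    (hw0 : ∀ x f, w x f ≠ 0) (hw : ∀ x f f', w x f' = f.det f' * w x f)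
    (hcont : ∀ (U : Set M) (f : ∀ x : M, Basis (Fin (finrank ℝ E)) ℝ (TangentSpace 𝓘(ℝ, E) x)),
      IsOpen U → LieGroupoid.IsSmoothObjectFrame f U → ContinuousOn (fun x => w x (f x)) U) :
    IsOrientableManifold E M := by
  rcases Nat.eq_zero_or_pos (finrank ℝ E) with hE | hE
  · -- In dimension zero all determinants are one.
    refine ⟨_, subset_rfl, fun x => ⟨_, IsManifold.chart_mem_maximalAtlas x, mem_chart_source E x⟩,
      fun φ _ ψ _ u _ => ?_⟩
    rw [ContinuousLinearMap.det, LinearMap.det_eq_one_of_finrank_eq_zero hE]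
    exact zero_lt_one
  -- `P φ` says that coordinates in `φ` and `w` induce the same orientation of each tangent space.
  set P : OpenPartialHomeomorph M E → Prop := fun φ =>
    ∀ x ∈ φ.source, ∀ f, 0 < chartDet φ f * w x f
  have hP : ∀ (φ : OpenPartialHomeomorph M E) (x : M) f f',
      0 < chartDet φ f * w x f → 0 < chartDet φ f' * w x f' := by
    intro φ x f f' h
    rw [chartDet_change φ f f', hw x f f']
    have h1 := (f.isUnit_det f').ne_zero
    have h2 : 0 < f.det f' * f.det f' := mul_self_pos.2 h1
    nlinarith [mul_pos h2 h]
  refine ⟨{φ | φ ∈ IsManifold.maximalAtlas 𝓘(ℝ, E) ∞ M ∧ P φ}, fun φ h => h.1, fun x₀ => ?_, ?_⟩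
  · set φ := chartAt E x₀
    have hφ : φ ∈ IsManifold.maximalAtlas 𝓘(ℝ, E) ∞ M := IsManifold.chart_mem_maximalAtlas x₀
    have hx₀ : x₀ ∈ φ.source := mem_chart_source E x₀
    obtain ⟨f, hf, hf'⟩ := LieGroupoid.exists_smooth_objectFrame hφ
    have hdet : ∀ x ∈ φ.source, chartDet φ (f x) = 1 := by
      intro x hx
      rw [chartDet, funext (hf' x hx), Basis.det_self]
    have hc := hcont φ.source f φ.open_source hf
    rcases (hw0 x₀ (f x₀)).lt_or_gt with h0 | h0
    · obtain ⟨ρ, hρ⟩ := exists_continuousLinearEquiv_det_eq_neg_one hE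
      set V := φ.source ∩ (fun x => w x (f x)) ⁻¹' Set.Iio 0
      have hV : IsOpen V := hc.isOpen_inter_preimage φ.open_source isOpen_Iio
      set φ' := φ.restrOpen V hV
      have hφ' : φ' ∈ IsManifold.maximalAtlas 𝓘(ℝ, E) ∞ M :=
        OpenPartialHomeomorph.mem_maximalAtlas_of_contMDiffOn _
          ((contMDiffOn_of_mem_maximalAtlas hφ).mono fun x hx => hx.1)
          ((contMDiffOn_symm_of_mem_maximalAtlas hφ).mono fun x hx => hx.1)
      have hψ : φ'.transHomeomorph ρ.toHomeomorph ∈ IsManifold.maximalAtlas 𝓘(ℝ, E) ∞ M :=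
        OpenPartialHomeomorph.mem_maximalAtlas_of_contMDiffOn _
          (ρ.contDiff.contMDiff.comp_contMDiffOn (contMDiffOn_of_mem_maximalAtlas hφ'))
          ((contMDiffOn_symm_of_mem_maximalAtlas hφ').comp ρ.symm.contDiff.contMDiff.contMDiffOn
            fun x hx => hx)
      refine ⟨φ'.transHomeomorph ρ.toHomeomorph, ⟨hψ, fun x hx f' => ?_⟩, hx₀, hx₀, h0⟩
      have hx' : x ∈ V := hx.2
      refine hP _ x (f x) f' ?_
      have h1 : mdiff E E (φ'.transHomeomorph ρ.toHomeomorph) x =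
          ρ.toContinuousLinearMap.comp (mdiff E E φ x) := by
        have h2 := mdiff_comp (f := φ) (f' := ρ) (p := x)
          ρ.differentiableAt.mdifferentiableAt (mdifferentiableAt_chart hφ hx'.1)
        rw [mdiff_eq_fderiv, ρ.fderiv] at h2
        exact h2
      rw [chartDet_comp _ h1, hρ, hdet x hx'.1]
      have h2 : w x (f x) < 0 := hx'.2
      linarith
    · set V := φ.source ∩ (fun x => w x (f x)) ⁻¹' Set.Ioi 0
      have hV : IsOpen V := hc.isOpen_inter_preimage φ.open_source isOpen_Ioi
      refine ⟨φ.restrOpen V hV, ⟨OpenPartialHomeomorph.mem_maximalAtlas_of_contMDiffOn _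
          ((contMDiffOn_of_mem_maximalAtlas hφ).mono fun x hx => hx.1)
          ((contMDiffOn_symm_of_mem_maximalAtlas hφ).mono fun x hx => hx.1), fun x hx f' => ?_⟩,
        hx₀, hx₀, h0⟩
      have hx' : x ∈ V := hx.2
      refine hP _ x (f x) f' ?_
      change 0 < chartDet φ (f x) * _
      rw [hdet x hx'.1, one_mul]
      exact hx'.2
  · rintro φ ⟨hφ, hφP⟩ ψ ⟨hψ, hψP⟩ u hu
    have hu' : u ∈ φ.target ∧ φ.symm u ∈ ψ.source := by simpa using hu
    have f : Basis (Fin (finrank ℝ E)) ℝ (TangentSpace 𝓘(ℝ, E) (φ.symm u)) := finBasis ℝ E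
    have h1 := hφP _ (φ.map_target hu'.1) f
    have h2 := hψP _ hu'.2 f
    rw [chartDet_eq_transitionDet_mul hφ hψ (φ.map_target hu'.1) hu'.2, mul_assoc, transitionDet,
      φ.right_inv hu'.1] at h2
    exact pos_of_mul_pos_left h2 h1.le

/-- Over a groupoid with unit arrows only, the values of a transverse volume form at frames are
those of a volume form of the manifold. -/
theorem isOrientableManifold_of_isTransverseVolumeForm [T2Space M]
    {σ : ∀ x, (unitGroupoid E M).transverseVolume.fiber x}
    (hσ : (unitGroupoid E M).IsTransverseVolumeForm σ) : IsOrientableManifold E M := by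
  set a := (unitGroupoid E M).someAlgebroidFrame
  let σ' : ∀ x, ((unitGroupoid E M).transverseBundle (MonoidWithZeroHom.id ℝ)).fiber x := σ
  refine isOrientableManifold_of_frameFunction
    (fun x f => (unitGroupoid E M).coeff (MonoidWithZeroHom.id ℝ) (a x) f (σ' x)) ?_ ?_ ?_
  · intro x f h
    exact hσ.2.1 x (LieGroupoid.coeff_injective (a x) f (h.trans (map_zero _).symm))
  · intro x f f'
    rw [LieGroupoid.coeff_change (a x) (a x) f f', Basis.det_self, one_mul]
    rfl
  · intro U f hU hf
    have hr : (unitGroupoid E M).rank = 0 := Nat.sub_self _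
    have ha : LieGroupoid.IsSmoothAlgebroidFrame a U := fun i => absurd i.2 (by omega)
    exact (LieGroupoid.LineRepData.IsSmoothSection.coeff (σ := σ') hσ.1 hU ha hf).continuousOn

/-- The modular class of a groupoid with unit arrows only does not detect orientability. -/
theorem unitGroupoid_of_not_orientable [T2Space M] (h : ¬ IsOrientableManifold E M) :
    (unitGroupoid E M).modularClass = 0 ∧
      ¬ ∃ σ, (unitGroupoid E M).IsTransverseVolumeForm σ :=
  ⟨unitGroupoid_H1_eq_zero _, fun ⟨_, hσ⟩ => h (isOrientableManifold_of_isTransverseVolumeForm hσ)⟩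

end UnitGroupoid

/-! ### A non-orientable manifold -/

section Orientability

variable {E M : Type*} [NormedAddCommGroup E] [NormedSpace ℝ E] [FiniteDimensional ℝ E]
  [TopologicalSpace M] [ChartedSpace E M] [IsManifold 𝓘(ℝ, E) ∞ M]

/-- The chain rule for transition maps, tested on a frame. -/
lemma transitionDet_mul {φ ψ χ : OpenPartialHomeomorph M E}
    (hφ : φ ∈ IsManifold.maximalAtlas 𝓘(ℝ, E) ∞ M) (hψ : ψ ∈ IsManifold.maximalAtlas 𝓘(ℝ, E) ∞ M)
    (hχ : χ ∈ IsManifold.maximalAtlas 𝓘(ℝ, E) ∞ M) {x : M} (hx : x ∈ φ.source)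
    (hx' : x ∈ ψ.source) (hx'' : x ∈ χ.source) :
    transitionDet φ χ x = transitionDet ψ χ x * transitionDet φ ψ x := by
  obtain ⟨f, -, hf⟩ := LieGroupoid.exists_smooth_objectFrame hφ
  have h1 : chartDet φ (f x) = 1 := by rw [chartDet, funext (hf x hx), Basis.det_self]
  have h2 := chartDet_eq_transitionDet_mul hφ hχ hx hx'' (f x)
  rw [chartDet_eq_transitionDet_mul hψ hχ hx' hx'', chartDet_eq_transitionDet_mul hφ hψ hx hx', h1,
    mul_one, mul_one] at h2
  exact h2.symm

lemma transitionDet_ne_zero {φ ψ : OpenPartialHomeomorph M E}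
    (hφ : φ ∈ IsManifold.maximalAtlas 𝓘(ℝ, E) ∞ M) (hψ : ψ ∈ IsManifold.maximalAtlas 𝓘(ℝ, E) ∞ M)
    {x : M} (hx : x ∈ φ.source) (hx' : x ∈ ψ.source) : transitionDet φ ψ x ≠ 0 := by
  obtain ⟨f, -, hf⟩ := LieGroupoid.exists_smooth_objectFrame hψ
  have h1 : chartDet ψ (f x) = 1 := by rw [chartDet, funext (hf x hx'), Basis.det_self]
  intro h
  rw [chartDet_eq_transitionDet_mul hφ hψ hx hx', h, zero_mul] at h1
  exact zero_ne_one h1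

lemma continuousOn_transitionDet {φ ψ : OpenPartialHomeomorph M E}
    (hφ : φ ∈ IsManifold.maximalAtlas 𝓘(ℝ, E) ∞ M)
    (hψ : ψ ∈ IsManifold.maximalAtlas 𝓘(ℝ, E) ∞ M) :
    ContinuousOn (transitionDet φ ψ) (φ.source ∩ ψ.source) := by
  have h1 : ContDiffOn ℝ ∞ (φ.symm.trans ψ) (φ.symm.trans ψ).source := by
    refine ContMDiffOn.contDiffOn ?_
    refine (contMDiffOn_of_mem_maximalAtlas hψ).comp
      ((contMDiffOn_symm_of_mem_maximalAtlas hφ).mono fun u hu => ?_) fun u hu => ?_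
    · exact hu.1
    · exact hu.2
  have h2 := h1.continuousOn_fderiv_of_isOpen (φ.symm.trans ψ).open_source (by simp)
  refine (ContinuousLinearMap.continuous_det.comp_continuousOn h2).comp
    (φ.continuousOn.mono Set.inter_subset_left) fun x hx => ?_
  have h3 : φ x ∈ φ.target ∧ φ.symm (φ x) ∈ ψ.source :=
    ⟨φ.map_source hx.1, by rw [φ.left_inv hx.1]; exact hx.2⟩
  simpa using h3

/-- On an orientable manifold, a chart with connected domain compares with the charts of an
oriented atlas by a constant sign. -/
lemma transitionDet_mul_pos_of_oriented {𝒜 : Set (OpenPartialHomeomorph M E)}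
    (h𝒜 : 𝒜 ⊆ IsManifold.maximalAtlas 𝓘(ℝ, E) ∞ M) (hcov : ∀ x : M, ∃ φ ∈ 𝒜, x ∈ φ.source)
    (hpos : ∀ φ ∈ 𝒜, ∀ ψ ∈ 𝒜, ∀ x ∈ φ.source ∩ ψ.source, 0 < transitionDet φ ψ x)
    {φ : OpenPartialHomeomorph M E} (hφ : φ ∈ IsManifold.maximalAtlas 𝓘(ℝ, E) ∞ M)
    (hconn : IsPreconnected φ.source) {ψ ψ' : OpenPartialHomeomorph M E} (hψ : ψ ∈ 𝒜) (hψ' : ψ' ∈ 𝒜)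
    {x y : M} (hx : x ∈ φ.source ∩ ψ.source) (hy : y ∈ φ.source ∩ ψ'.source) :
    0 < transitionDet φ ψ x * transitionDet φ ψ' y := by
  -- The points where the determinant of the transition to some chart of the atlas lies in `I`. For
  -- the negative and the positive half-lines these sets are open and disjoint, and cover the domain
  -- of `φ`.
  set S : Set ℝ → Set M := fun I =>
    {z | ∃ χ ∈ 𝒜, z ∈ (φ.source ∩ χ.source) ∩ transitionDet φ χ ⁻¹' I}
  have hS : ∀ I, IsOpen I → IsOpen (S I) := by
    intro I hI
    have : S I = ⋃ χ ∈ 𝒜, (φ.source ∩ χ.source) ∩ transitionDet φ χ ⁻¹' I := by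
      ext z
      simp only [S, Set.mem_ofPred_eq, Set.mem_iUnion, exists_prop]
    rw [this]
    exact isOpen_biUnion fun χ hχ => (continuousOn_transitionDet hφ
      (h𝒜 hχ)).isOpen_inter_preimage (φ.open_source.inter χ.open_source) hI
  have hmem : ∀ (χ) (_ : χ ∈ 𝒜) (z) (_ : z ∈ φ.source ∩ χ.source),
      (transitionDet φ χ z < 0 ∧ z ∈ S (Set.Iio 0)) ∨
        (0 < transitionDet φ χ z ∧ z ∈ S (Set.Ioi 0)) := by
    intro χ hχ z hz
    exact (transitionDet_ne_zero hφ (h𝒜 hχ) hz.1 hz.2).lt_or_gt.imp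
      (fun h => ⟨h, χ, hχ, hz, h⟩) fun h => ⟨h, χ, hχ, hz, h⟩
  have hdisj : S (Set.Iio 0) ∩ S (Set.Ioi 0) = ∅ := by
    rw [Set.eq_empty_iff_forall_notMem]
    rintro z ⟨⟨χ, hχ, hz, h1⟩, ⟨χ', hχ', hz', h2⟩⟩
    have h3 := transitionDet_mul hφ (h𝒜 hχ) (h𝒜 hχ') hz.1 hz.2 hz'.2
    have h4 := hpos χ hχ χ' hχ' z ⟨hz.2, hz'.2⟩
    have h5 : transitionDet φ χ' z < 0 := h3 ▸ mul_neg_of_pos_of_neg h4 h1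
    exact lt_asymm h5 h2
  have hno : ∀ z ∈ φ.source ∩ S (Set.Iio 0), ∀ z' ∈ φ.source ∩ S (Set.Ioi 0), False := by
    intro z hz z' hz'
    obtain ⟨p, -, hp⟩ := hconn _ _ (hS _ isOpen_Iio) (hS _ isOpen_Ioi) (fun p hp => by
      obtain ⟨χ, hχ, hpχ⟩ := hcov p
      exact (hmem χ hχ p ⟨hp, hpχ⟩).imp And.right And.right) ⟨z, hz⟩ ⟨z', hz'⟩
    exact Set.eq_empty_iff_forall_notMem.1 hdisj p hp
  rcases hmem ψ hψ x hx with ⟨h1, h2⟩ | ⟨h1, h2⟩ <;>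
    rcases hmem ψ' hψ' y hy with ⟨h3, h4⟩ | ⟨h3, h4⟩
  · exact mul_pos_of_neg_of_neg h1 h3
  · exact (hno x ⟨hx.1, h2⟩ y ⟨hy.1, h4⟩).elim
  · exact (hno y ⟨hy.1, h4⟩ x ⟨hx.1, h2⟩).elim
  · exact mul_pos h1 h3

/-- On an orientable manifold, the Jacobian determinant of the transition between two charts with
connected domains has constant sign. -/
lemma IsOrientableManifold.transitionDet_mul_pos (h : IsOrientableManifold E M)
    {φ ψ : OpenPartialHomeomorph M E}
    (hφ : φ ∈ IsManifold.maximalAtlas 𝓘(ℝ, E) ∞ M) (hψ : ψ ∈ IsManifold.maximalAtlas 𝓘(ℝ, E) ∞ M)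
    (hφ' : IsPreconnected φ.source) (hψ' : IsPreconnected ψ.source) {x y : M}
    (hx : x ∈ φ.source ∩ ψ.source) (hy : y ∈ φ.source ∩ ψ.source) :
    0 < transitionDet φ ψ x * transitionDet φ ψ y := by
  obtain ⟨𝒜, h𝒜, hcov, hpos⟩ := h
  have hpos' : ∀ φ ∈ 𝒜, ∀ ψ ∈ 𝒜, ∀ x ∈ φ.source ∩ ψ.source, 0 < transitionDet φ ψ x := by
    intro φ hφ ψ hψ x hx
    refine hpos φ hφ ψ hψ (φ x) ?_
    have h3 : φ x ∈ φ.target ∧ φ.symm (φ x) ∈ ψ.source :=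
      ⟨φ.map_source hx.1, by rw [φ.left_inv hx.1]; exact hx.2⟩
    simpa using h3
  obtain ⟨χ, hχ, hxχ⟩ := hcov x
  obtain ⟨χ', hχ', hyχ⟩ := hcov y
  have h1 := transitionDet_mul_pos_of_oriented h𝒜 hcov hpos' hφ hφ' hχ hχ' ⟨hx.1, hxχ⟩ ⟨hy.1, hyχ⟩
  have h2 := transitionDet_mul_pos_of_oriented h𝒜 hcov hpos' hψ hψ' hχ hχ' ⟨hx.2, hxχ⟩ ⟨hy.2, hyχ⟩
  rw [transitionDet_mul hφ hψ (h𝒜 hχ) hx.1 hx.2 hxχ,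
    transitionDet_mul hφ hψ (h𝒜 hχ') hy.1 hy.2 hyχ, mul_mul_mul_comm] at h1
  exact pos_of_mul_pos_right h1 h2.le

end Orientability

/-- The Möbius band, as the total space of the tautological line bundle over the real projective
line: the points are the pairs of an orthogonal projection of rank one of the plane, with matrix
`(A, B; B, 1 - A)`, and of a vector `(C, D)` in its range. -/
def MoebiusBand : Set (ℝ × ℝ × ℝ × ℝ) :=
  {p | p.1 * (1 - p.1) = p.2.1 ^ 2 ∧ p.1 * p.2.2.2 = p.2.1 * p.2.2.1 ∧
    p.2.1 * p.2.2.2 = (1 - p.1) * p.2.2.1}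

namespace MoebiusBand

/-- The projection onto the line of slope `m`, and the vector of abscissa `b / (1 + m ^ 2)` in this
line. -/
def ofSlope (q : ℝ × ℝ) : MoebiusBand :=
  ⟨((1 + q.1 ^ 2)⁻¹, q.1 * (1 + q.1 ^ 2)⁻¹, q.2 * (1 + q.1 ^ 2)⁻¹, q.2 * q.1 * (1 + q.1 ^ 2)⁻¹), by
    have h : 1 + q.1 ^ 2 ≠ 0 := by positivity
    refine ⟨?_, ?_, ?_⟩ <;> field_simp <;> ring⟩

/-- The chart on the set of the lines that are not vertical: the coordinates are the slope of the
line and the multiple of the projection of the first basis vector that the given vector is. -/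
def slopeChart : OpenPartialHomeomorph MoebiusBand (ℝ × ℝ) where
  toFun p := (p.1.2.1 / p.1.1, p.1.2.2.1 / p.1.1)
  invFun := ofSlope
  source := {p | p.1.1 ≠ 0}
  target := Set.univ
  map_source' _ _ := Set.mem_univ _
  map_target' q _ := by
    have h : 1 + q.1 ^ 2 ≠ 0 := by positivity
    exact inv_ne_zero h
  left_inv' p hp := by
    obtain ⟨⟨a, b, c, d⟩, h1, h2, h3⟩ := p
    simp only [Set.mem_ofPred_eq] at hp h1 h2 h3
    have h : (1 + (b / a) ^ 2)⁻¹ = a := by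
      rw [div_pow, ← h1]
      field_simp
      ring
    refine Subtype.ext ?_
    simp only [ofSlope, h]
    refine Prod.ext rfl (Prod.ext ?_ (Prod.ext ?_ ?_))
    · exact div_mul_cancel₀ _ hp
    · exact div_mul_cancel₀ _ hp
    · simp only
      field_simp
      linarith
  right_inv' q _ := by
    have h : 1 + q.1 ^ 2 ≠ 0 := by positivity
    refine Prod.ext ?_ ?_ <;> simp only [ofSlope] <;> field_simp
  open_source := isOpen_ne_fun (by fun_prop) continuous_const
  open_target := isOpen_univ
  continuousOn_toFun := by
    refine ContinuousOn.prodMk ?_ ?_ <;>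
    exact ContinuousOn.div (by fun_prop) (by fun_prop) fun p hp => hp
  continuousOn_invFun := by
    have h : ∀ q : ℝ × ℝ, 1 + q.1 ^ 2 ≠ 0 := fun q => by positivity
    have h' : Continuous fun q : ℝ × ℝ => (1 + q.1 ^ 2)⁻¹ := by
      exact Continuous.inv₀ (by fun_prop) h
    refine Continuous.continuousOn (Continuous.subtype_mk ?_ _)
    fun_prop

/-- The reflection of the plane that exchanges the coordinates. -/
def reflection : MoebiusBand ≃ₜ MoebiusBand where
  toFun p := ⟨(1 - p.1.1, p.1.2.1, p.1.2.2.2, p.1.2.2.1), by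
    obtain ⟨h1, h2, h3⟩ := p.2
    exact ⟨by linarith, by linarith, by linarith⟩⟩
  invFun p := ⟨(1 - p.1.1, p.1.2.1, p.1.2.2.2, p.1.2.2.1), by
    obtain ⟨h1, h2, h3⟩ := p.2
    exact ⟨by linarith, by linarith, by linarith⟩⟩
  left_inv p := by simp
  right_inv p := by simp
  continuous_toFun := by fun_prop
  continuous_invFun := by fun_prop

/-- The chart on the set of the lines that are not horizontal. -/
def coslopeChart : OpenPartialHomeomorph MoebiusBand (ℝ × ℝ) :=
  reflection.transOpenPartialHomeomorph slopeChart

/-- The transition map between the two charts. -/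
def transition (q : ℝ × ℝ) : ℝ × ℝ := (q.1⁻¹, q.2 * q.1⁻¹)

lemma reflection_ofSlope_source {q : ℝ × ℝ} :
    reflection (ofSlope q) ∈ slopeChart.source ↔ q.1 ≠ 0 := by
  have h : 1 + q.1 ^ 2 ≠ 0 := by positivity
  change 1 - (1 + q.1 ^ 2)⁻¹ ≠ 0 ↔ _
  have : 1 - (1 + q.1 ^ 2)⁻¹ = q.1 ^ 2 * (1 + q.1 ^ 2)⁻¹ := by field_simp; ring
  rw [this]
  simp [h]

lemma slopeChart_reflection_ofSlope {q : ℝ × ℝ} (hq : q.1 ≠ 0) :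
    slopeChart (reflection (ofSlope q)) = transition q := by
  have h : 1 + q.1 ^ 2 ≠ 0 := by positivity
  have h1 : 1 - (1 + q.1 ^ 2)⁻¹ = q.1 ^ 2 * (1 + q.1 ^ 2)⁻¹ := by field_simp; ring
  change (q.1 * (1 + q.1 ^ 2)⁻¹ / (1 - (1 + q.1 ^ 2)⁻¹),
    q.2 * q.1 * (1 + q.1 ^ 2)⁻¹ / (1 - (1 + q.1 ^ 2)⁻¹)) = _
  rw [h1, transition]
  refine Prod.ext ?_ ?_ <;> simp only <;> field_simp

lemma contDiffOn_transition : ContDiffOn ℝ ∞ transition {q | q.1 ≠ 0} :=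
  (contDiffOn_fst.inv fun _ hq => hq).prodMk
    (contDiffOn_snd.mul (contDiffOn_fst.inv fun _ hq => hq))

/-- The smooth structure is given by the slope and coslope charts. -/
instance : ChartedSpace (ℝ × ℝ) MoebiusBand where
  atlas := {slopeChart, coslopeChart}
  chartAt p := open scoped Classical in if p.1.1 ≠ 0 then slopeChart else coslopeChart
  mem_chart_source p := by
    split_ifs with h
    · exact h
    · change 1 - p.1.1 ≠ 0
      rw [not_not.1 h]
      norm_num
  chart_mem_atlas p := by
    split_ifs <;> simp

instance : IsManifold 𝓘(ℝ, ℝ × ℝ) ∞ MoebiusBand := by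
  refine isManifold_of_contDiffOn _ _ _ fun e e' he he' => ?_
  have hid : ∀ e : OpenPartialHomeomorph MoebiusBand (ℝ × ℝ),
      ContDiffOn ℝ ∞ (e.symm.trans e) (e.symm.trans e).source := by
    intro e
    refine contDiffOn_id.congr fun u hu => ?_
    exact e.right_inv hu.1
  suffices ContDiffOn ℝ ∞ (e.symm.trans e') (e.symm.trans e').source by simpa using this
  rcases he with rfl | rfl <;> rcases he' with rfl | rfl
  · exact hid _
  · have hs : ∀ q ∈ (slopeChart.symm.trans coslopeChart).source, q.1 ≠ 0 := fun q hq =>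
      reflection_ofSlope_source.1 hq.2
    exact (contDiffOn_transition.mono hs).congr fun q hq =>
      slopeChart_reflection_ofSlope (hs q hq)
  · have hs : ∀ q ∈ (coslopeChart.symm.trans slopeChart).source, q.1 ≠ 0 := fun q hq =>
      reflection_ofSlope_source.1 hq.2
    exact (contDiffOn_transition.mono hs).congr fun q hq =>
      slopeChart_reflection_ofSlope (hs q hq)
  · exact hid _

/-- The slope chart is onto the plane. -/
lemma isPreconnected_slopeChart : IsPreconnected slopeChart.source := by
  rw [← slopeChart.symm_image_target_eq_source]
  exact isPreconnected_univ.image _ slopeChart.symm.continuousOn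

lemma isPreconnected_coslopeChart : IsPreconnected coslopeChart.source := by
  have h : coslopeChart.target = Set.univ := rfl
  rw [← coslopeChart.symm_image_target_eq_source, h]
  exact isPreconnected_univ.image _ coslopeChart.symm.continuousOn

/-- The Jacobian of `(m, b) ↦ (1/m, b/m)` is `-1/m² · 1/m`, which takes both signs. -/
lemma transitionDet_ofSlope {m : ℝ} (hm : m ≠ 0) :
    transitionDet slopeChart coslopeChart (ofSlope (m, 0)) = -(m ^ 3)⁻¹ := by
  have h0 : slopeChart (ofSlope (m, 0)) = (m, 0) := slopeChart.right_inv (Set.mem_univ _)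
  have hev : slopeChart.symm.trans coslopeChart =ᶠ[nhds ((m, 0) : ℝ × ℝ)] transition := by
    have : {q : ℝ × ℝ | q.1 ≠ 0} ∈ nhds ((m, 0) : ℝ × ℝ) :=
      (isOpen_ne_fun continuous_fst continuous_const).mem_nhds hm
    filter_upwards [this] with q hq
    exact slopeChart_reflection_ofSlope hq
  have h1 : HasFDerivAt (fun q : ℝ × ℝ => q.1⁻¹)
      ((-(m ^ 2)⁻¹) • ContinuousLinearMap.fst ℝ ℝ ℝ) (m, 0) :=
    (hasDerivAt_inv hm).comp_hasFDerivAt ((m, 0) : ℝ × ℝ) hasFDerivAt_fst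
  have h2 : HasFDerivAt transition
      ((-(m ^ 2)⁻¹ • ContinuousLinearMap.id ℝ ℝ).prodMap (m⁻¹ • ContinuousLinearMap.id ℝ ℝ))
      ((m, 0) : ℝ × ℝ) := by
    have h3 := h1.prodMk ((hasFDerivAt_snd (𝕜 := ℝ) (p := ((m, 0) : ℝ × ℝ))).mul h1)
    refine h3.congr_fderiv ?_
    ext <;> simp
  rw [transitionDet, h0, hev.fderiv_eq, h2.fderiv]
  have h4 := LinearMap.det_prodMap ((-(m ^ 2)⁻¹) • (LinearMap.id : ℝ →ₗ[ℝ] ℝ))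
    (m⁻¹ • (LinearMap.id : ℝ →ₗ[ℝ] ℝ))
  refine h4.trans ?_
  simp only [LinearMap.det_smul, LinearMap.det_id, finrank_self, pow_one, mul_one]
  field_simp

/-- Both charts have connected domains, but their transition has Jacobians of both signs, at the
slopes `1` and `-1`. -/
theorem not_isOrientableManifold : ¬ IsOrientableManifold (ℝ × ℝ) MoebiusBand := by
  intro h
  have h1 : slopeChart ∈ IsManifold.maximalAtlas 𝓘(ℝ, ℝ × ℝ) ∞ MoebiusBand :=
    IsManifold.subset_maximalAtlas (Or.inl rfl)
  have h2 : coslopeChart ∈ IsManifold.maximalAtlas 𝓘(ℝ, ℝ × ℝ) ∞ MoebiusBand :=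
    IsManifold.subset_maximalAtlas (Or.inr rfl)
  have h3 : ∀ m : ℝ, m ≠ 0 → ofSlope (m, 0) ∈ slopeChart.source ∩ coslopeChart.source :=
    fun m hm => ⟨slopeChart.map_target (Set.mem_univ _), reflection_ofSlope_source.2 hm⟩
  have h4 := h.transitionDet_mul_pos h1 h2 isPreconnected_slopeChart isPreconnected_coslopeChart
    (h3 1 one_ne_zero) (h3 (-1) (by norm_num))
  rw [transitionDet_ofSlope one_ne_zero, transitionDet_ofSlope (by norm_num)] at h4
  norm_num at h4

end MoebiusBand

end

/-- For every Lie groupoid `𝒢` the transverse volume and density bundles are representations, the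
classes `mod(𝒢)` and `θ(V_A^tr) = ½ θ(V_A^tr ⊗ V_A^tr)` are well defined, and
`mod(𝒢) = θ(V_A^tr)`. However, `mod(𝒢) = 0` is not equivalent to the existence of a transverse
volume form: every non-orientable manifold, viewed as a groupoid with unit arrows only, is a
counterexample, and non-orientable manifolds exist. -/
theorem mainTheorem4 :
    (∀ (E : Type u₁) (F : Type u₂) (M : Type u₃) (G : Type u₄)
        [NormedAddCommGroup E] [NormedSpace ℝ E] [FiniteDimensional ℝ E]
        [NormedAddCommGroup F] [NormedSpace ℝ F] [FiniteDimensional ℝ F]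
        [TopologicalSpace M] [ChartedSpace E M] [IsManifold 𝓘(ℝ, E) ∞ M]
        [T2Space M] [SecondCountableTopology M]
        [TopologicalSpace G] [ChartedSpace F G] [IsManifold 𝓘(ℝ, F) ∞ G]
        (𝒢 : LieGroupoid E F M G),
      𝒢.transverseVolume.IsRepresentation ∧
      𝒢.transverseDensity.IsRepresentation ∧
      𝒢.IsModularClass 𝒢.modularClass ∧
      𝒢.transverseVolume.tensorSquare.IsTrivialCharClass
        𝒢.transverseVolume.tensorSquare.trivialCharClass ∧
      𝒢.modularClass = 𝒢.transverseVolume.charClass) ∧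
    (∀ (E : Type u₁) (M : Type u₃)
        [NormedAddCommGroup E] [NormedSpace ℝ E] [FiniteDimensional ℝ E]
        [TopologicalSpace M] [ChartedSpace E M] [IsManifold 𝓘(ℝ, E) ∞ M]
        [T2Space M] [SecondCountableTopology M],
      ¬ IsOrientableManifold E M →
        (unitGroupoid E M).modularClass = 0 ∧
        ¬ ∃ σ, (unitGroupoid E M).IsTransverseVolumeForm σ) ∧
    (∃ (E M : Type) (_ : NormedAddCommGroup E) (_ : NormedSpace ℝ E) (_ : FiniteDimensional ℝ E)
        (_ : TopologicalSpace M) (_ : ChartedSpace E M) (_ : IsManifold 𝓘(ℝ, E) ∞ M)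
        (_ : T2Space M) (_ : SecondCountableTopology M),
      ¬ IsOrientableManifold E M ∧
      ¬ ((unitGroupoid E M).modularClass = 0 ↔
        ∃ σ, (unitGroupoid E M).IsTransverseVolumeForm σ)) := by
  refine ⟨?_, ?_, ?_⟩
  · intro E F M G _ _ _ _ _ _ _ _ _ _ _ _ _ _ 𝒢
    exact ⟨LieGroupoid.isRepresentation_transverseVolume,
      LieGroupoid.isRepresentation_transverseDensity, 𝒢.modularClass_eq_charClass⟩
  · intro E M _ _ _ _ _ _ _ _ h
    exact unitGroupoid_of_not_orientable h
  · refine ⟨ℝ × ℝ, MoebiusBand, inferInstance, inferInstance, inferInstance, inferInstance,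
      inferInstance, inferInstance, inferInstance, inferInstance,
      MoebiusBand.not_isOrientableManifold, fun h => ?_⟩
    have h' := unitGroupoid_of_not_orientable MoebiusBand.not_isOrientableManifold
    exact h'.2 (h.1 h'.1)
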